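/- Let $k$ be an algebraically closed field. A $k$-linear category is called finite if it is equivalent, as a $k$-linear category, to the category of finite-dimensional modules over a finite-dimensional $k$-algebra. For finite $k$-linear categories $\mathcal A,\mathcal B$ let $\mathrm{Fun}_{\mathrm{lex}}(\mathcal A,\mathcal B)$ and $\mathrm{Fun}_{\mathrm{rex}}(\mathcal A,\mathcal B)$ denote the categories of $k$-linear left exact, respectively right exact, functors $\mathcal A\to\mathcal B$ and natural transformations. For $a\in\mathcal A$ write $\bar a$ for the corresponding object of $\mathcal A^{\mathrm{op}}$. For a finite-dimensional vector space $V$ and $b\in\mathcal B$ let $V\otimes b\in\mathcal B$ be the object representing $\mathrm{Hom}_{\mathcal B}(-,b)\otimes_k V$ (a direct sum of $\dim V$ copies of $b$). A Deligne product of $\mathcal A^{\mathrm{op}}$ and $\mathcal B$ is an abelian $k$-linear category $\mathcal A^{\mathrm{op}}\boxtimes\mathcal B$ with a $k$-bilinear functor $\boxtimes:\mathcal A^{\mathrm{op}}\times\mathcal B\to\mathcal A^{\mathrm{op}}\boxtimes\mathcal B$, exact in each variable, such that for every abelian $k$-linear category $\mathcal X$ restriction along $\boxtimes$ is an equivalence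 from the category of $k$-linear right exact functors $\mathcal A^{\mathrm{op}}\boxtimes\mathcal B\to\mathcal X$ to the category of $k$-bilinear functors $\mathcal A^{\mathrm{op}}\times\mathcal B\to\mathcal X$ that are right exact in each variable. **Theorem (categorical Eilenberg-Watts theorem).** Let $\mathcal A,\mathcal B$ be finite $k$-linear categories. A Deligne product of $\mathcal A^{\mathrm{op}}$ and $\mathcal B$ exists, and every Deligne product $\mathcal A^{\mathrm{op}}\boxtimes\mathcal B$ is a finite $k$-linear category for which the following hold. 1. There is a $k$-linear left exact functor $\Phi^l:\mathcal A^{\mathrm{op}}\boxtimes\mathcal B\to\mathrm{Fun}_{\mathrm{lex}}(\mathcal A,\mathcal B)$ with $\Phi^l(\bar a\boxtimes b)\cong\mathrm{Hom}_{\mathcal A}(a,-)\otimes b$ naturally in $\bar a$ and $b$, and a $k$-linear right exact functor $\Phi^r:\mathcal A^{\mathrm{op}}\boxtimes\mathcal B\to\mathrm{Fun}_{\mathrm{rex}}(\mathcal A,\mathcal B)$ with $\Phi^r(\bar a\boxtimes b)\cong\mathrm{Hom}_{\mathcal A}(-,a)^*\otimes b$ naturally in $\bar a$ and $b$. 2.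 For all $F\in\mathrm{Fun}_{\mathrm{lex}}(\mathcal A,\mathcal B)$ and $G\in\mathrm{Fun}_{\mathrm{rex}}(\mathcal A,\mathcal B)$ the coend $\Psi^l(F)=\int^{a\in\mathcal A}\bar a\boxtimes F(a)$ and the end $\Psi^r(G)=\int_{a\in\mathcal A}\bar a\boxtimes G(a)$ exist in $\mathcal A^{\mathrm{op}}\boxtimes\mathcal B$, and they define $k$-linear functors $\Psi^l:\mathrm{Fun}_{\mathrm{lex}}(\mathcal A,\mathcal B)\to\mathcal A^{\mathrm{op}}\boxtimes\mathcal B$ and $\Psi^r:\mathrm{Fun}_{\mathrm{rex}}(\mathcal A,\mathcal B)\to\mathcal A^{\mathrm{op}}\boxtimes\mathcal B$. 3. For any $\Phi^l$ and $\Phi^r$ as in 1, the pairs $(\Psi^l,\Phi^l)$ and $(\Phi^r,\Psi^r)$ are quasi-inverse pairs of adjoint equivalences $$\mathrm{Fun}_{\mathrm{lex}}(\mathcal A,\mathcal B)\;\simeq\;\mathcal A^{\mathrm{op}}\boxtimes\mathcal B\;\simeq\;\mathrm{Fun}_{\mathrm{rex}}(\mathcal A,\mathcal B),$$ and the composites $\Gamma^{rl}=\Phi^r\circ\Psi^l:\mathrm{Fun}_{\mathrm{lex}}(\mathcal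 A,\mathcal B)\to\mathrm{Fun}_{\mathrm{rex}}(\mathcal A,\mathcal B)$ and $\Gamma^{lr}=\Phi^l\circ\Psi^r:\mathrm{Fun}_{\mathrm{rex}}(\mathcal A,\mathcal B)\to\mathrm{Fun}_{\mathrm{lex}}(\mathcal A,\mathcal B)$ likewise form a quasi-inverse pair of adjoint equivalences. -/

import Mathlib

open CategoryTheory CategoryTheory.Limits Opposite

universe w v v₁ v₂ v₃ u u₁ u₂ u₃

noncomputable section

namespace EilenbergWatts

/-! ### Finite linear categories -/

section Finite

variable (k : Type w) [Field k] (C : Type u) [Category.{v} C] [Preadditive C] [Linear k C]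

/-- A `k`-linear category is *finite* if it is equivalent, as a `k`-linear category, to the
category of finite-dimensional modules over a finite-dimensional `k`-algebra `R`. (Over such an
`R`, a module is finite-dimensional over `k` iff it is finitely generated over `R`.) -/
class IsFiniteLinear : Prop where
  exists_equivalence : ∃ (R : Type w) (_ : Ring R) (_ : Algebra k R) (_ : Module.Finite k R)
    (F : C ⥤ FGModuleCat.{w} R), F.IsEquivalence ∧ F.Additive ∧ F.Linear k

variable {C}

open scoped ModuleCat in
theorem finite_hom_fgModuleCat (R : Type w) [Ring R] [Algebra k R] [Module.Finite k R]
    (M N : FGModuleCat.{w} R) : Module.Finite k (M ⟶ N) := by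
  have hM : Module.Finite k M.obj := Module.Finite.trans R M
  have hN : Module.Finite k N.obj := Module.Finite.trans R N
  let φ : (M ⟶ N) →ₗ[k] (M.obj →ₗ[k] N.obj) :=
    { toFun := fun f => f.hom.hom.restrictScalars k
      map_add' := fun _ _ => rfl
      map_smul' := fun r f => by
        ext x
        rfl }
  refine Module.Finite.of_injective φ fun f g h => ?_
  ext x
  exact LinearMap.congr_fun h x

/-- Morphism spaces of a finite linear category are finite-dimensional. -/
instance finite_hom [IsFiniteLinear k C] (X Y : C) : Module.Finite k (X ⟶ Y) := by
  obtain ⟨R, _, _, _, F, _, _, _⟩ := IsFiniteLinear.exists_equivalence (k := k) (C := C)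
  have := finite_hom_fgModuleCat k R (F.obj X) (F.obj Y)
  exact Module.Finite.of_injective (F.mapLinearMap k : (X ⟶ Y) →ₗ[k] _) F.map_injective

theorem hasFiniteBiproducts [IsFiniteLinear k C] : HasFiniteBiproducts C := by
  obtain ⟨R, _, _, _, F, _, _, _⟩ := IsFiniteLinear.exists_equivalence (k := k) (C := C)
  have : IsNoetherianRing R := isNoetherian_of_tower k inferInstance
  have : HasFiniteProducts C :=
    ⟨fun _ => Adjunction.hasLimitsOfShape_of_equivalence F⟩
  exact HasFiniteBiproducts.of_hasFiniteProducts

end Finite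

/-- The opposite of a `k`-linear category, with the same scalar multiplication on morphisms. -/
instance linearOpposite (k : Type w) [Semiring k] (C : Type u) [Category.{v} C] [Preadditive C]
    [Linear k C] : Linear k Cᵒᵖ where
  homModule X Y :=
    { smul := fun r f => (r • f.unop).op
      one_smul := fun f => Quiver.Hom.unop_inj (one_smul k f.unop)
      mul_smul := fun r s f => Quiver.Hom.unop_inj (mul_smul r s f.unop)
      smul_zero := fun r => Quiver.Hom.unop_inj (smul_zero (A := (Y.unop ⟶ X.unop)) r)
      smul_add := fun r f g => Quiver.Hom.unop_inj (smul_add r f.unop g.unop)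
      add_smul := fun r s f => Quiver.Hom.unop_inj (add_smul r s f.unop)
      zero_smul := fun f => Quiver.Hom.unop_inj (zero_smul k f.unop) }
  smul_comp _ _ _ r f g := Quiver.Hom.unop_inj (Linear.comp_smul _ _ _ g.unop r f.unop)
  comp_smul _ _ _ f r g := Quiver.Hom.unop_inj (Linear.smul_comp _ _ _ r g.unop f.unop)

/-! ### Linear exact functors -/

section Exact

variable (k : Type w) [Field k]
  {C : Type u₁} [Category.{v₁} C] [Preadditive C] [Linear k C]
  {E : Type u₂} [Category.{v₂} E] [Preadditive E] [Linear k E]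
  {X : Type u₃} [Category.{v₃} X] [Preadditive X] [Linear k X]

/-- `k`-linear left exact functors. -/
structure IsLinearLex (F : C ⥤ E) : Prop where
  additive : F.Additive
  linear : F.Linear k
  lex : PreservesFiniteLimits F

/-- `k`-linear right exact functors. -/
structure IsLinearRex (F : C ⥤ E) : Prop where
  additive : F.Additive
  linear : F.Linear k
  rex : PreservesFiniteColimits F

variable (C E) in
/-- The category of `k`-linear left exact functors and all natural transformations. -/
abbrev FunLex := ObjectProperty.FullSubcategory (fun F : C ⥤ E => IsLinearLex k F)

variable (C E) in
/-- The category of `k`-linear right exact functors and all natural transformations. -/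
abbrev FunRex := ObjectProperty.FullSubcategory (fun F : C ⥤ E => IsLinearRex k F)

/-- Bifunctors that are linear and left exact in each variable. -/
structure IsBilinearLex (G : C ⥤ E ⥤ X) : Prop where
  left : ∀ e : E, IsLinearLex k (G.flip.obj e)
  right : ∀ c : C, IsLinearLex k (G.obj c)

/-- Bifunctors that are linear and right exact in each variable. -/
structure IsBilinearRex (G : C ⥤ E ⥤ X) : Prop where
  left : ∀ e : E, IsLinearRex k (G.flip.obj e)
  right : ∀ c : C, IsLinearRex k (G.obj c)

end Exact

/-- The bifunctor `(c, e) ↦ F (T (c, e))`. -/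
abbrev postcomp {C : Type u₁} [Category.{v₁} C] {E : Type u₂} [Category.{v₂} E]
    {D : Type u₃} [Category.{v₃} D] {X : Type u} [Category.{v} X]
    (T : C ⥤ E ⥤ D) (F : D ⥤ X) : C ⥤ E ⥤ X :=
  T ⋙ (Functor.whiskeringRight E D X).obj F

/-! ### The Deligne product -/

/-- The bifunctor `T : C × E → D` exhibits the abelian `k`-linear category `D` as a *Deligne
product* of `C` and `E`: it is bilinear, exact in each variable, and restriction along `T` is an
equivalence from the category of linear right exact functors `D ⥤ X` to the category of bifunctors
`C ⥤ E ⥤ X` which are linear and right exact in each variable, for every abelian `k`-linear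
category `X`. Here `D` and `X` range over the locally small categories, relative to the universe of
`k`; this universe contains the modules over all finite-dimensional `k`-algebras, and in particular
`D` itself is among the `X`. The equivalence of functor categories is spelled out as essential surjectivity (`fac`) and full
faithfulness (`bijective`). -/
structure IsDeligneProduct (k : Type w) [Field k]
    {C : Type u₁} [Category.{v₁} C] [Preadditive C] [Linear k C]
    {E : Type u₂} [Category.{v₂} E] [Preadditive E] [Linear k E]
    {D : Type (w + 1)} [Category.{w} D] [Abelian D] [Linear k D]
    (T : C ⥤ E ⥤ D) : Prop where
  lex : IsBilinearLex k T
  rex : IsBilinearRex k T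
  fac : ∀ (X : Type (w + 1)) [Category.{w} X] [Abelian X] [Linear k X] (G : C ⥤ E ⥤ X),
    IsBilinearRex k G → ∃ F : D ⥤ X, IsLinearRex k F ∧ Nonempty (postcomp T F ≅ G)
  bijective : ∀ (X : Type (w + 1)) [Category.{w} X] [Abelian X] [Linear k X] (F F' : D ⥤ X),
    IsLinearRex k F → IsLinearRex k F' →
      Function.Bijective (fun τ : F ⟶ F' =>
        (Functor.whiskerLeft T ((Functor.whiskeringRight E D X).map τ) :
          postcomp T F ⟶ postcomp T F'))

/-! ### The tensor product of an object with a finite-dimensional vector space -/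

section Tensor

variable (k : Type w) [Field k]
  (C : Type u) [Category.{v} C] [Preadditive C] [Linear k C] [HasFiniteBiproducts C]

/-- The action `V ↦ c ↦ V ⊗ c` of finite-dimensional vector spaces on a `k`-linear category with
finite direct sums. Picking a basis of each `V`, the object `V ⊗ c` is the direct sum of `dim V`
copies of `c`, and `f ⊗ g` is the matrix of `f` with entries multiplied by `g`. -/
def vecTensor : FGModuleCat.{v₁} k ⥤ C ⥤ C where
  obj V :=
    { obj := fun c => ⨁ fun _ : Fin (Module.finrank k V) => c
      map := fun g => biproduct.map fun _ => g
      map_id := fun c => by ext; simp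
      map_comp := fun f g => by ext; simp }
  map {V W} f :=
    { app := fun c => biproduct.matrix fun i j =>
        LinearMap.toMatrix (Module.finBasis k V) (Module.finBasis k W) f.hom.hom j i • 𝟙 c
      naturality := fun c c' g => by
        ext
        simp [biproduct.map_matrix, biproduct.matrix_map] }
  map_id V := by
    ext c i j
    by_cases h : i = j
    · subst h
      simp
    · simp [biproduct.ι_π_ne _ (Ne.symm h), Matrix.one_apply_ne h]
  map_comp {U V W} f g := by
    ext c i j
    simp [LinearMap.toMatrix_comp _ (Module.finBasis k V) _, Matrix.mul_apply, Finset.sum_smul,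
      mul_smul, biproduct.lift_desc]

end Tensor

/-! ### The Hom and dual Hom functors, and the four Eilenberg-Watts functors -/

section Functors

variable (k : Type w) [Field k]
  (A : Type u₁) [Category.{v₁} A] [Preadditive A] [Linear k A] [IsFiniteLinear k A]
  (B : Type u₂) [Category.{v₂} B] [Preadditive B] [Linear k B]

/-- The Hom functor `(a, x) ↦ Hom(a, x)` with values in finite-dimensional vector spaces. -/
def homFunctor : Aᵒᵖ ⥤ A ⥤ FGModuleCat.{v₁} k where
  obj a :=
    { obj := fun x => FGModuleCat.of k (a.unop ⟶ x)
      map := fun f => FGModuleCat.ofHom (Linear.rightComp k a.unop f)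
      map_id := fun _ => FGModuleCat.hom_ext (LinearMap.ext fun h => Category.comp_id h)
      map_comp := fun f g => FGModuleCat.hom_ext
        (LinearMap.ext fun h => (Category.assoc h f g).symm) }
  map g :=
    { app := fun x => FGModuleCat.ofHom (Linear.leftComp k x g.unop)
      naturality := fun _ _ f => FGModuleCat.hom_ext
        (LinearMap.ext fun h => (Category.assoc g.unop h f).symm) }
  map_id _ := NatTrans.ext (funext fun _ => FGModuleCat.hom_ext
    (LinearMap.ext fun h => Category.id_comp h))
  map_comp f g := NatTrans.ext (funext fun _ => FGModuleCat.hom_ext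
    (LinearMap.ext fun h => Category.assoc g.unop f.unop h))

/-- The dual Hom functor `(a, x) ↦ Hom(x, a)^*`. -/
def dualHomFunctor : Aᵒᵖ ⥤ A ⥤ FGModuleCat.{max w v₁} k where
  obj a :=
    { obj := fun x => FGModuleCat.of k (Module.Dual k (x ⟶ a.unop))
      map := fun f => FGModuleCat.ofHom (Linear.leftComp k a.unop f).dualMap
      map_id := fun _ => FGModuleCat.hom_ext (LinearMap.ext fun φ => LinearMap.ext fun h =>
        congrArg φ (Category.id_comp h))
      map_comp := fun f g => FGModuleCat.hom_ext (LinearMap.ext fun φ => LinearMap.ext fun h =>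
        congrArg φ (Category.assoc f g h)) }
  map g :=
    { app := fun x => FGModuleCat.ofHom (Linear.rightComp k x g.unop).dualMap
      naturality := fun _ _ f => FGModuleCat.hom_ext (LinearMap.ext fun φ => LinearMap.ext fun h =>
        congrArg φ (Category.assoc f h g.unop).symm) }
  map_id _ := NatTrans.ext (funext fun _ => FGModuleCat.hom_ext
    (LinearMap.ext fun φ => LinearMap.ext fun h => congrArg φ (Category.comp_id h)))
  map_comp f g := NatTrans.ext (funext fun _ => FGModuleCat.hom_ext
    (LinearMap.ext fun φ => LinearMap.ext fun h =>
      congrArg φ (Category.assoc h g.unop f.unop).symm))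

variable [IsFiniteLinear k B]

/-- The bifunctor `(a, b) ↦ Hom(a, -) ⊗ b`. -/
def homTensor : Aᵒᵖ ⥤ B ⥤ A ⥤ B :=
  haveI := hasFiniteBiproducts k (C := B)
  homFunctor k A ⋙ (Functor.whiskeringRight A _ _).obj (vecTensor k B) ⋙ flipFunctor A B B

/-- The bifunctor `(a, b) ↦ Hom(-, a)^* ⊗ b`. -/
def dualHomTensor : Aᵒᵖ ⥤ B ⥤ A ⥤ B :=
  haveI := hasFiniteBiproducts k (C := B)
  dualHomFunctor k A ⋙ (Functor.whiskeringRight A _ _).obj (vecTensor k B) ⋙ flipFunctor A B B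

variable {A B} {D : Type u₃} [Category.{v₃} D] [Preadditive D] [Linear k D]
  (T : Aᵒᵖ ⥤ B ⥤ D)

/-- `Φ` is a functor `Φˡ`: the linear left exact functor on the Deligne product with
`Φ(a ⊠ b) ≅ Hom(a, -) ⊗ b`, naturally in `a` and `b`. -/
structure IsPhiL (Φ : D ⥤ FunLex k A B) : Prop where
  exact : IsLinearLex k Φ
  iso : Nonempty (postcomp T (Φ ⋙ ObjectProperty.ι _) ≅ homTensor k A B)

/-- `Φ` is a functor `Φʳ`: the linear right exact functor on the Deligne product with
`Φ(a ⊠ b) ≅ Hom(-, a)^* ⊗ b`, naturally in `a` and `b`. -/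
structure IsPhiR (Φ : D ⥤ FunRex k A B) : Prop where
  exact : IsLinearRex k Φ
  iso : Nonempty (postcomp T (Φ ⋙ ObjectProperty.ι _) ≅ dualHomTensor k A B)

end Functors

section Psi

variable (k : Type w) [Field k]
  {A : Type u₁} [Category.{v₁} A] [Preadditive A] [Linear k A]
  {B : Type u₂} [Category.{v₂} B] [Preadditive B] [Linear k B]
  {D : Type u₃} [Category.{v₃} D] (T : Aᵒᵖ ⥤ B ⥤ D)

/-- The bifunctor `(a, x) ↦ a ⊠ F(x)` whose (co)end is taken. -/
abbrev integrand (F : A ⥤ B) : Aᵒᵖ ⥤ A ⥤ D :=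
  T ⋙ (Functor.whiskeringLeft A B D).obj F

/-- The natural transformation of integrands induced by `τ : F ⟶ G`. -/
abbrev integrandMap {F G : A ⥤ B} (τ : F ⟶ G) : integrand T F ⟶ integrand T G :=
  Functor.whiskerLeft T ((Functor.whiskeringLeft A B D).map τ)

/-- The functor `Ψˡ : F ↦ ∫^a a ⊠ F(a)`. -/
def psiL (h : ∀ F : FunLex k A B, HasCoend (integrand T F.obj)) : FunLex k A B ⥤ D where
  obj F := haveI := h F; coend (integrand T F.obj)
  map {F G} τ := haveI := h F; haveI := h G; coend.map (integrandMap T τ.hom)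
  map_id F := by
    have := h F
    apply coend.hom_ext
    intro j
    simp
  map_comp {F G H} σ τ := by
    have := h F
    have := h G
    have := h H
    apply coend.hom_ext
    intro j
    simp

/-- The functor `Ψʳ : G ↦ ∫_a a ⊠ G(a)`. -/
def psiR (h : ∀ G : FunRex k A B, HasEnd (integrand T G.obj)) : FunRex k A B ⥤ D where
  obj F := haveI := h F; end_ (integrand T F.obj)
  map {F G} τ := haveI := h F; haveI := h G; end_.map (integrandMap T τ.hom)
  map_id F := by
    have := h F
    apply end_.hom_ext
    intro j
    simp
  map_comp {F G H} σ τ := by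
    have := h F
    have := h G
    have := h H
    apply end_.hom_ext
    intro j
    simp

end Psi

end EilenbergWatts

end

/-!
# The categorical Eilenberg-Watts theorem

*Deligne products.* A right exact functor is determined by its value at a progenerator `P` together
with the action of `End P` on this value, and every such action occurs
(`IsProgenerator.existsUnique_natTrans`, `IsProgenerator.exists_functor`). Applying this in each
variable, a biexact bilinear functor `T` is a Deligne product as soon as it sends some pair of
progenerators to a progenerator with `End (T (P, Q)) ≅ End P ⊗ End Q`
(`PreservesProgenerators.isDeligneProduct`). The outer tensor product of modules over `R` and `S`,
with values in modules over `R ⊗ S`, has this property for the regular modules. This shows that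
Deligne products exist, and, by uniqueness, that all of them are finite. The opposite of a category
of modules has the linear dual of `R` as a progenerator, and the outer tensor product also preserves
these progenerators of the opposite categories; hence the opposite of a Deligne product is a
Deligne product of the opposites (`IsDeligneProduct.isFiniteLinear_and_op`). This makes every
statement about left exact functors and coends equivalent to one about right exact functors and
ends.

*The functor `Ψˡ`.* An object `d` of the Deligne product defines a left exact functor `F`, where
`F a` represents `Hom(a ⊠ -, d)`; it comes with a dinatural family `a ⊠ F a ⟶ d`, which is called
universal below. Since `F a` exists as the value of a right adjoint of `a ⊠ -`, every `d` occurs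
(`IsDeligneProduct.exists_functor`). Conversely, for left exact `F` the bifunctor
`(a, b) ↦ Hom(b, F a)` extends to a right exact functor from the Deligne product to the opposite of
finite-dimensional vector spaces. This extension has a right adjoint, so it is represented by an
object `d`, and `F` occurs (`IsDeligneProduct.exists_universalFamily`). The universal property of
the Deligne product, applied to the functors `Hom(-, d)`, shows that a universal family is an
initial dinatural family (`IsUniversalFamily.exists_desc`). So `d` is the coend `∫^a a ⊠ F a`, and
`Ψˡ` is an equivalence (`IsDeligneProduct.isEquivalence_psiL`).

*The functors `Φˡ`.* By the Yoneda lemma `Hom(Hom(a, -) ⊗ b, F) ≅ Hom(b, F a)`, from which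
`Ψˡ(Hom(a, -) ⊗ b) ≅ a ⊠ b` (`IsDeligneProduct.exists_iso_psiL_homTensor`). Thus a quasi-inverse of
`Ψˡ` is a functor `Φˡ`. For any other `Φˡ`, the composite `Φˡ ⋙ Ψˡ` is left exact and agrees with
the identity on the objects `a ⊠ b`, so it is isomorphic to the identity, by the universal property
of the opposite Deligne product (`IsPhiL.exists_equivalence`). The argument for `Φʳ` and `Ψʳ` is
dual.
-/

noncomputable section

namespace EilenbergWatts

/-! ### Right exact functors out of a category with a projective generator -/

section Progenerator

attribute [local instance] Abelian.hasFiniteBiproducts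

variable {C : Type u₁} [Category.{v₁} C] [Abelian C]
  {X : Type u₂} [Category.{v₂} X] [Preadditive X]

/-- A projective object `P` such that every object is a quotient of a finite direct sum of copies
of `P`. -/
structure IsProgenerator (P : C) : Prop where
  projective : Projective P
  exists_epi : ∀ c : C, ∃ (n : ℕ) (p : (⨁ fun _ : Fin n => P) ⟶ c), Epi p

/-- A right exact functor is determined by its value on a progenerator `P`: morphisms `F c ⟶ N`
are the same as `End P`-equivariant maps `Hom(P, c) → Hom(F P, N)`. -/
theorem IsProgenerator.existsUnique_desc {P : C} (hP : IsProgenerator P) (F : C ⥤ X) [F.Additive]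
    [PreservesFiniteColimits F] {c : C} {N : X} (θ : (P ⟶ c) →+ (F.obj P ⟶ N))
    (hθ : ∀ (r : P ⟶ P) (h : P ⟶ c), θ (r ≫ h) = F.map r ≫ θ h) :
    ∃! t : F.obj c ⟶ N, ∀ h, F.map h ≫ t = θ h := by
  obtain ⟨n, p, hp⟩ := hP.exists_epi c
  obtain ⟨m, q, hq⟩ := hP.exists_epi (kernel p)
  have := hP.projective
  have hF {m : ℕ} {Z : X} (s s' : F.obj (⨁ fun _ : Fin m => P) ⟶ Z)
      (h : ∀ i, F.map (biproduct.ι (fun _ : Fin m => P) i) ≫ s =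
        F.map (biproduct.ι (fun _ : Fin m => P) i) ≫ s') : s = s' := by
    rw [← Category.id_comp s, ← Category.id_comp s', ← F.map_id, ← biproduct.total,
      F.map_sum, Preadditive.sum_comp, Preadditive.sum_comp]
    simp [h]
  -- On the presentation `Pᵐ ⟶ Pⁿ ⟶ c ⟶ 0`, the map `θ` prescribes a morphism out of `F (Pⁿ)`;
  -- equivariance makes it vanish on the image of `F (Pᵐ)`.
  let s : F.obj (⨁ fun _ : Fin n => P) ⟶ N :=
    ∑ i, F.map (biproduct.π (fun _ : Fin n => P) i) ≫
      θ (biproduct.ι (fun _ : Fin n => P) i ≫ p)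
  have hs (g : P ⟶ ⨁ fun _ : Fin n => P) : F.map g ≫ s = θ (g ≫ p) := by
    conv_rhs => rw [← Category.comp_id g, ← biproduct.total]
    simp only [s, Preadditive.comp_sum, Preadditive.sum_comp, map_sum, ← F.map_comp_assoc,
      Category.assoc]
    refine Finset.sum_congr rfl fun i _ => ?_
    rw [← hθ, Category.assoc]
  have hc : IsColimit (CokernelCofork.ofπ (f := kernel.ι p) p (kernel.condition p)) :=
    Abelian.epiIsCokernelOfKernel (KernelFork.ofι (kernel.ι p) (kernel.condition p))
      (kernelIsKernel p)
  have hc' : IsColimit (CokernelCofork.ofπ (f := q ≫ kernel.ι p) p (by simp)) :=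
    isCokernelEpiComp hc q rfl
  have hs0 : F.map (q ≫ kernel.ι p) ≫ s = 0 := by
    refine hF _ _ fun i => ?_
    rw [← F.map_comp_assoc, hs]
    simp
  have hcF := CokernelCofork.mapIsColimit _ hc' F
  have hpF : Epi (F.map p) := inferInstance
  obtain ⟨d, hd⟩ : ∃ d : F.obj c ⟶ N, F.map p ≫ d = s :=
    ⟨hcF.desc (CokernelCofork.ofπ s hs0),
      hcF.fac (CokernelCofork.ofπ s hs0) WalkingParallelPair.one⟩
  refine ⟨d, fun h => ?_, fun t ht => ?_⟩
  · rw [← Projective.factorThru_comp h p, F.map_comp, Category.assoc, hd, hs]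
  · rw [← cancel_epi (F.map p), hd]
    refine hF _ _ fun i => ?_
    rw [hs, ← ht, F.map_comp, Category.assoc]

theorem IsProgenerator.hom_ext {P : C} (hP : IsProgenerator P) (F : C ⥤ X) [F.Additive]
    [PreservesFiniteColimits F] {c : C} {N : X} (s t : F.obj c ⟶ N)
    (h : ∀ g : P ⟶ c, F.map g ≫ s = F.map g ≫ t) : s = t :=
  (hP.existsUnique_desc F (c := c) (N := N)
    { toFun := fun g => F.map g ≫ t
      map_zero' := by simp
      map_add' := by simp }
    (fun r h => by simp)).unique h (fun _ => rfl)

/-- An `End P`-equivariant morphism `F P ⟶ F' P` extends uniquely to a natural transformation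
`F ⟶ F'` if `F` is right exact. -/
theorem IsProgenerator.existsUnique_natTrans {P : C} (hP : IsProgenerator P) (F F' : C ⥤ X)
    [F.Additive] [PreservesFiniteColimits F] [F'.Additive] (φ : F.obj P ⟶ F'.obj P)
    (hφ : ∀ r : P ⟶ P, F.map r ≫ φ = φ ≫ F'.map r) :
    ∃! τ : F ⟶ F', τ.app P = φ := by
  have key (c : C) := hP.existsUnique_desc F (c := c) (N := F'.obj c)
    { toFun := fun g => φ ≫ F'.map g
      map_zero' := by simp
      map_add' := by simp }
    (fun r h => by simp [reassoc_of% hφ])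
  choose t ht _ using key
  refine ⟨{ app := t, naturality := fun c c' f => hP.hom_ext F _ _ fun g => ?_ }, ?_, ?_⟩
  · have h1 := ht c' (g ≫ f)
    have h2 := ht c g
    simp only [AddMonoidHom.coe_mk, ZeroHom.coe_mk] at h1 h2
    rw [← F.map_comp_assoc, h1, reassoc_of% h2, F'.map_comp]
  · simpa using ht P (𝟙 P)
  · intro τ hτ
    ext c
    refine hP.hom_ext F _ _ fun g => ?_
    refine Eq.trans ?_ (ht c g).symm
    rw [τ.naturality, hτ]
    rfl

theorem IsProgenerator.natTrans_ext {P : C} (hP : IsProgenerator P) {F F' : C ⥤ X}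
    [F.Additive] [PreservesFiniteColimits F] [F'.Additive] {σ τ : F ⟶ F'}
    (h : σ.app P = τ.app P) : σ = τ :=
  (hP.existsUnique_natTrans F F' (τ.app P) (fun r => τ.naturality r)).unique h rfl

/-- Being a progenerator is invariant under equivalence and isomorphism. -/
theorem IsProgenerator.of_equivalence {C' : Type u₂} [Category.{v₂} C'] [Abelian C'] {P : C}
    (hP : IsProgenerator P) (F : C ⥤ C') [F.IsEquivalence] [F.Additive] {P' : C'}
    (e : F.obj P ≅ P') : IsProgenerator P' := by
  refine ⟨?_, fun c => ?_⟩
  · have := hP.projective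
    exact Projective.of_iso e ((F.asEquivalence.map_projective_iff P).2 this)
  · obtain ⟨n, p, hp⟩ := hP.exists_epi (F.inv.obj c)
    let ε : F.obj (F.inv.obj c) ≅ c := F.asEquivalence.counitIso.app c
    refine ⟨n,
      (biproduct.mapIso fun _ => e.symm).hom ≫ (F.mapBiproduct _).inv ≫ F.map p ≫ ε.hom, ?_⟩
    have : Epi (F.map p) := inferInstance
    have : Epi (F.map p ≫ ε.hom) := epi_comp _ _
    have : Epi ((F.mapBiproduct fun _ : Fin n => P).inv ≫ F.map p ≫ ε.hom) := epi_comp _ _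
    exact epi_comp _ _

end Progenerator

/-! ### Exactness from representability -/

section Representability

variable {C : Type u₁} [Category.{v₁} C] {X : Type u₂} [Category.{v₂} X]

/-- If `Hom(F c, x)` is, naturally in `c`, a functor of `c` that turns finite colimits into limits,
for each `x`, then `F` is right exact. -/
theorem preservesFiniteColimits_of_equiv (F : C ⥤ X) (W : X → Cᵒᵖ ⥤ Type v)
    [∀ x, PreservesFiniteLimits (W x)] (e : ∀ (x : X) (c : C), (F.obj c ⟶ x) ≃ (W x).obj (op c))
    (he : ∀ (x : X) (c c' : C) (f : c ⟶ c') (h : F.obj c' ⟶ x),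
      e x c (F.map f ≫ h) = (W x).map f.op (e x c' h)) :
    PreservesFiniteColimits F := by
  have hW (x : X) : PreservesFiniteLimits (F.op ⋙ yoneda.obj x) := by
    let i : F.op ⋙ yoneda.obj x ⋙ uliftFunctor.{v} ≅ W x ⋙ uliftFunctor.{v₂} :=
      NatIso.ofComponents (fun c => Equiv.toIso
        (Equiv.ulift.trans ((e x c.unop).trans Equiv.ulift.symm))) (fun {c c'} f => by
          ext h
          exact congrArg ULift.up (he x c'.unop c.unop f.unop h.down))
    have : PreservesFiniteLimits (W x ⋙ uliftFunctor.{v₂}) := comp_preservesFiniteLimits _ _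
    have : PreservesFiniteLimits ((F.op ⋙ yoneda.obj x) ⋙ uliftFunctor.{v}) :=
      preservesFiniteLimits_of_natIso i.symm
    exact ⟨fun J _ _ => preservesLimitsOfShape_of_reflects_of_preserves _ uliftFunctor.{v}⟩
  refine ⟨fun J _ _ => ⟨fun {K} => ⟨fun {c} hc => ⟨?_⟩⟩⟩⟩
  exact (Limits.Cocone.isColimitYonedaEquiv _).symm fun x =>
    isLimitOfPreserves (F.op ⋙ yoneda.obj x) hc.op

/-- If `Hom(x, F c)` is, naturally in `c`, a left exact functor of `c`, for each `x`, then `F` is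
left exact. -/
theorem preservesFiniteLimits_of_equiv (F : C ⥤ X) (W : X → C ⥤ Type v)
    [∀ x, PreservesFiniteLimits (W x)] (e : ∀ (x : X) (c : C), (x ⟶ F.obj c) ≃ (W x).obj c)
    (he : ∀ (x : X) (c c' : C) (f : c ⟶ c') (h : x ⟶ F.obj c),
      e x c' (h ≫ F.map f) = (W x).map f (e x c h)) :
    PreservesFiniteLimits F := by
  have hW (x : X) : PreservesFiniteLimits (F ⋙ coyoneda.obj (op x)) := by
    let i : F ⋙ coyoneda.obj (op x) ⋙ uliftFunctor.{v} ≅ W x ⋙ uliftFunctor.{v₂} :=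
      NatIso.ofComponents (fun c => Equiv.toIso
        (Equiv.ulift.trans ((e x c).trans Equiv.ulift.symm))) (fun {c c'} f => by
          ext h
          exact congrArg ULift.up (he x c c' f h.down))
    have : PreservesFiniteLimits (W x ⋙ uliftFunctor.{v₂}) := comp_preservesFiniteLimits _ _
    have : PreservesFiniteLimits ((F ⋙ coyoneda.obj (op x)) ⋙ uliftFunctor.{v}) :=
      preservesFiniteLimits_of_natIso i.symm
    exact ⟨fun J _ _ => preservesLimitsOfShape_of_reflects_of_preserves _ uliftFunctor.{v}⟩
  refine ⟨fun J _ _ => ⟨fun {K} => ⟨fun {c} hc => ⟨?_⟩⟩⟩⟩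
  exact (Limits.Cone.isLimitCoyonedaEquiv _).symm fun x =>
    isLimitOfPreserves (F ⋙ coyoneda.obj x) hc

end Representability

section Extension

variable {D : Type u₁} [Category.{v} D] [Abelian D] {X : Type u₂} [Category.{v} X] [Abelian X]

attribute [local instance] Abelian.hasFiniteBiproducts

/-- Any object `x` with an action of `End P`, for a progenerator `P`, is the value at `P` of a right
exact functor. This functor is the left adjoint of `N ↦ Hom(x, N)`, a functor to modules over
`End P`, restricted to the modules `Hom(P, d)`. -/
theorem IsProgenerator.exists_functor {P : D} (hP : IsProgenerator P) (x : X)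
    (ρ : End P →+* End x) :
    ∃ (F : D ⥤ X) (e : F.obj P ≅ x), F.Additive ∧ PreservesFiniteColimits F ∧
      ∀ r : P ⟶ P, F.map r ≫ e.hom = e.hom ≫ ρ r := by
  have := hP.projective
  let U : X ⥤ ModuleCat.{v} (End P)ᵐᵒᵖ := preadditiveCoyonedaObj x ⋙ ModuleCat.restrictScalars ρ.op
  let J : D ⥤ ModuleCat.{v} (End P)ᵐᵒᵖ := preadditiveCoyonedaObj P
  have hU : U.Additive := inferInstance
  let eP : (U ⋙ coyoneda.obj (op (J.obj P))).CorepresentableBy x :=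
    { homEquiv := fun {N} =>
        { toFun := fun f => ModuleCat.ofHom (Y := (U.obj N : Type v))
            { toFun := fun r => (show x ⟶ x from ρ r) ≫ f
              map_add' := fun r s => by
                have : ρ (r + s) = ρ r + ρ s := map_add ρ r s
                erw [this]
                exact Preadditive.add_comp _ _ _ _ _ _
              map_smul' := fun r s => by
                have : ρ (show End P from r.unop ≫ s) = ρ s * ρ r.unop :=
                  map_mul ρ (show End P from s) r.unop
                erw [this]
                exact Category.assoc _ _ _ }
          invFun := fun θ => θ.hom (𝟙 P)
          left_inv := fun f => by
            exact (congrArg (fun s : x ⟶ x => s ≫ f) (map_one ρ)).trans (Category.id_comp f)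
          right_inv := fun θ => by
            refine ModuleCat.hom_ext (LinearMap.ext fun r => ?_)
            refine (θ.hom.map_smul (MulOpposite.op (show End P from r)) (𝟙 P)).symm.trans ?_
            exact congrArg θ.hom (Category.comp_id (show P ⟶ P from r)) }
      homEquiv_comp := fun g f => by
        refine ModuleCat.hom_ext (LinearMap.ext fun r => ?_)
        exact (Category.assoc _ _ _).symm }
  -- The objects at which the left adjoint of `U` is defined are closed under colimits, and `J`
  -- preserves the presentations by `P`.
  have h1 : U.leftAdjointObjIsDefined (J.obj P) := eP.isCorepresentable
  have h2 (n : ℕ) : U.leftAdjointObjIsDefined (J.obj (⨁ fun _ : Fin n => P)) :=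
    U.leftAdjointObjIsDefined_of_isColimit
      (isColimitOfPreserves J (biproduct.isColimit (fun _ : Fin n => P))) (fun _ => h1)
  have h3 (d : D) : U.leftAdjointObjIsDefined (J.obj d) := by
    obtain ⟨n, p, hp⟩ := hP.exists_epi d
    obtain ⟨m, q, hq⟩ := hP.exists_epi (kernel p)
    have hc : IsColimit (CokernelCofork.ofπ (f := kernel.ι p) p (kernel.condition p)) :=
      Abelian.epiIsCokernelOfKernel (KernelFork.ofι (kernel.ι p) (kernel.condition p))
        (kernelIsKernel p)
    have hc' : IsColimit (CokernelCofork.ofπ (f := q ≫ kernel.ι p) p (by simp)) :=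
      isCokernelEpiComp hc q rfl
    refine U.leftAdjointObjIsDefined_of_isColimit (isColimitOfPreserves J hc') ?_
    rintro (_ | _)
    · exact h2 m
    · exact h2 n
  let F : D ⥤ X := ObjectProperty.lift _ J h3 ⋙ U.partialLeftAdjoint
  let φ {d : D} {N : X} : (F.obj d ⟶ N) ≃ (J.obj d ⟶ U.obj N) := U.partialLeftAdjointHomEquiv
  have φ_comp {d : D} {N N' : X} (f : F.obj d ⟶ N) (g : N ⟶ N') : φ (f ≫ g) = φ f ≫ U.map g :=
    U.partialLeftAdjointHomEquiv_comp f g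
  have φ_map {d d' : D} {N : X} (f : d ⟶ d') (g : F.obj d' ⟶ N) :
      φ (F.map f ≫ g) = J.map f ≫ φ g :=
    U.partialLeftAdjointHomEquiv_map_comp _ g
  have φ_add {d : D} {N : X} (f g : F.obj d ⟶ N) : φ (f + g) = φ f + φ g := by
    have (f : F.obj d ⟶ N) : φ f = φ (𝟙 _) ≫ U.map f := by rw [← φ_comp, Category.id_comp]
    rw [this, this f, this g, U.map_add, Preadditive.comp_add]
  have hadd : F.Additive := ⟨fun {d d' f g} => φ.injective <| by
    rw [φ_add, ← Category.comp_id (F.map (f + g)), ← Category.comp_id (F.map f),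
      ← Category.comp_id (F.map g), φ_map, φ_map, φ_map, J.map_add, Preadditive.add_comp]⟩
  have hrex : PreservesFiniteColimits F := by
    have (N : X) : PreservesFiniteLimits (J.op ⋙ yoneda.obj (U.obj N)) := by
      have : PreservesFiniteLimits J.op := preservesFiniteLimits_op J
      exact comp_preservesFiniteLimits _ _
    exact preservesFiniteColimits_of_equiv F (fun N => J.op ⋙ yoneda.obj (U.obj N))
      (fun N d => φ) (fun N d d' f h => φ_map f h)
  have eP_comp {N N' : X} (f : x ⟶ N) (g : N ⟶ N') :
      eP.homEquiv (f ≫ g) = eP.homEquiv f ≫ U.map g := eP.homEquiv_comp g f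
  let e : F.obj P ≅ x :=
    { hom := φ.symm (eP.homEquiv (𝟙 x))
      inv := eP.homEquiv.symm (φ (𝟙 _))
      hom_inv_id := φ.injective (by
        rw [φ_comp, Equiv.apply_symm_apply, ← eP_comp, Category.id_comp, Equiv.apply_symm_apply])
      inv_hom_id := eP.homEquiv.injective (by
        rw [eP_comp, Equiv.apply_symm_apply, ← φ_comp, Category.id_comp, Equiv.apply_symm_apply]) }
  refine ⟨F, e, hadd, hrex, fun r => φ.injective ?_⟩
  have hφe : φ e.hom = eP.homEquiv (𝟙 x) := φ.apply_symm_apply _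
  rw [φ_map, φ_comp, hφe, ← eP_comp, Category.id_comp]
  refine ModuleCat.hom_ext (LinearMap.ext fun s => ?_)
  exact (Category.comp_id _).trans (map_mul ρ (show End P from r) (show End P from s))

end Extension

/-! ### Recognizing Deligne products -/

section LinearExact

variable (k : Type w) [Field k]
  {C : Type u₁} [Category.{v₁} C] [Preadditive C] [Linear k C]
  {E : Type u₂} [Category.{v₂} E] [Preadditive E] [Linear k E]
  {X : Type u₃} [Category.{v₃} X] [Preadditive X] [Linear k X]

variable {k} in
theorem IsLinearRex.comp {F : C ⥤ E} (hF : IsLinearRex k F) {G : E ⥤ X} (hG : IsLinearRex k G) :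
    IsLinearRex k (F ⋙ G) := by
  obtain ⟨_, _, _⟩ := hF
  obtain ⟨_, _, _⟩ := hG
  exact ⟨inferInstance, inferInstance, comp_preservesFiniteColimits _ _⟩

variable {k} in
theorem IsLinearLex.comp {F : C ⥤ E} (hF : IsLinearLex k F) {G : E ⥤ X} (hG : IsLinearLex k G) :
    IsLinearLex k (F ⋙ G) := by
  obtain ⟨_, _, _⟩ := hF
  obtain ⟨_, _, _⟩ := hG
  exact ⟨inferInstance, inferInstance, comp_preservesFiniteLimits _ _⟩

variable {k} in
theorem additive_linear_of_iso {F G : C ⥤ E} (e : F ≅ G) (h₁ : F.Additive) (h₂ : F.Linear k) :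
    G.Additive ∧ G.Linear k := by
  have hmap {c c' : C} (f : c ⟶ c') : G.map f = e.inv.app c ≫ F.map f ≫ e.hom.app c' := by simp
  refine ⟨⟨fun {c c' f g} => ?_⟩, ⟨fun {c c'} f a => ?_⟩⟩
  · rw [hmap, hmap f, hmap g, F.map_add, Preadditive.add_comp, Preadditive.comp_add]
  · rw [hmap, hmap f, F.map_smul, Linear.smul_comp, Linear.comp_smul]

variable {k} in
theorem IsLinearRex.of_iso {F G : C ⥤ E} (hF : IsLinearRex k F) (e : F ≅ G) : IsLinearRex k G := by
  obtain ⟨h₁, h₂, _⟩ := hF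
  exact ⟨(additive_linear_of_iso e h₁ h₂).1, (additive_linear_of_iso e h₁ h₂).2,
    preservesFiniteColimits_of_natIso e⟩

variable {k} in
theorem IsLinearLex.of_iso {F G : C ⥤ E} (hF : IsLinearLex k F) (e : F ≅ G) : IsLinearLex k G := by
  obtain ⟨h₁, h₂, _⟩ := hF
  exact ⟨(additive_linear_of_iso e h₁ h₂).1, (additive_linear_of_iso e h₁ h₂).2,
    preservesFiniteLimits_of_natIso e⟩

/-- A linear functor acts on endomorphism algebras by homomorphisms. -/
def mapEnd (F : C ⥤ E) [F.Additive] [F.Linear k] (c : C) : End c →ₐ[k] End (F.obj c) :=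
  AlgHom.ofLinearMap (F.mapLinearMap k) (F.map_id c) (fun f g => F.map_comp g f)

variable {k} in
/-- The action of `End c ⊗ End e` on `G (c, e)` for a bilinear functor `G`. -/
def endTensor {G : C ⥤ E ⥤ X} (hG : IsBilinearRex k G) (c : C) (e : E) :
    TensorProduct k (End c) (End e) →ₐ[k] End ((G.obj c).obj e) :=
  haveI := (hG.left e).additive
  haveI := (hG.left e).linear
  haveI := (hG.right c).additive
  haveI := (hG.right c).linear
  Algebra.TensorProduct.lift (mapEnd k (G.flip.obj e) c) (mapEnd k (G.obj c) e)
    (fun f g => ((G.map f).naturality g))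

variable {k} in
theorem endTensor_tmul {G : C ⥤ E ⥤ X} (hG : IsBilinearRex k G) (c : C) (e : E) (f : c ⟶ c)
    (g : e ⟶ e) : endTensor hG c e ((show End c from f) ⊗ₜ[k] (show End e from g)) =
      (G.obj c).map g ≫ (G.map f).app e :=
  rfl

end LinearExact

section Recognition

variable {k : Type w} [Field k]
  {C : Type u₁} [Category.{v₁} C] [Abelian C] [Linear k C]
  {E : Type u₂} [Category.{v₂} E] [Abelian E] [Linear k E]

section Extend

variable {X : Type u₃} [Category.{v₃} X] [Preadditive X] [Linear k X]
  {P : C} {Q : E} {G G' : C ⥤ E ⥤ X}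

/-- Transformations of bifunctors that are right exact in each variable are determined by their
value at a pair of progenerators. -/
theorem natTrans₂_ext (hP : IsProgenerator P) (hQ : IsProgenerator Q) (hG : IsBilinearRex k G)
    (hG' : IsBilinearRex k G') {σ τ : G ⟶ G'} (h : (σ.app P).app Q = (τ.app P).app Q) : σ = τ := by
  have h1 : σ.app P = τ.app P := by
    obtain ⟨_, _, _⟩ := hG.right P
    obtain ⟨_, _, _⟩ := hG'.right P
    exact hQ.natTrans_ext h
  ext c e
  obtain ⟨_, _, _⟩ := hG.left e
  obtain ⟨_, _, _⟩ := hG'.left e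
  have h2 : ((flipFunctor C E X).map σ).app e = ((flipFunctor C E X).map τ).app e :=
    hP.natTrans_ext (F := G.flip.obj e) (F' := G'.flip.obj e) (congrArg (fun s => s.app e) h1)
  exact congrArg (fun s => s.app c) h2

/-- A morphism at a pair of progenerators which is equivariant for both endomorphism algebras
extends to a transformation of bifunctors: extend first in the second variable, then in the
first. -/
theorem exists_natTrans₂ (hP : IsProgenerator P) (hQ : IsProgenerator Q) (hG : IsBilinearRex k G)
    (hG' : IsBilinearRex k G') (φ : (G.obj P).obj Q ⟶ (G'.obj P).obj Q)
    (hl : ∀ f : P ⟶ P, (G.map f).app Q ≫ φ = φ ≫ (G'.map f).app Q)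
    (hr : ∀ g : Q ⟶ Q, (G.obj P).map g ≫ φ = φ ≫ (G'.obj P).map g) :
    ∃ σ : G ⟶ G', (σ.app P).app Q = φ := by
  obtain ⟨_, _, _⟩ := hG.right P
  obtain ⟨_, _, _⟩ := hG'.right P
  obtain ⟨ψ, hψ, -⟩ := hQ.existsUnique_natTrans (G.obj P) (G'.obj P) φ hr
  have hψl (f : P ⟶ P) : G.map f ≫ ψ = ψ ≫ G'.map f :=
    hQ.natTrans_ext (by simp [hψ, hl])
  have key (e : E) : ∃! τ : G.flip.obj e ⟶ G'.flip.obj e, τ.app P = ψ.app e := by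
    obtain ⟨_, _, _⟩ := hG.left e
    obtain ⟨_, _, _⟩ := hG'.left e
    exact hP.existsUnique_natTrans (G.flip.obj e) (G'.flip.obj e) (ψ.app e) fun f =>
      congr_app (hψl f) e
  choose τ hτ _ using key
  have hnat {e e' : E} (g : e ⟶ e') : G.flip.map g ≫ τ e' = τ e ≫ G'.flip.map g := by
    obtain ⟨_, _, _⟩ := hG.left e
    obtain ⟨_, _, _⟩ := hG'.left e'
    refine hP.natTrans_ext ?_
    have := ψ.naturality g
    simp only [NatTrans.comp_app, hτ]
    exact this
  refine ⟨{ app := fun c => { app := fun e => (τ e).app c, naturality := fun e e' g => ?_ },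
            naturality := fun c c' f => ?_ }, ?_⟩
  · exact congrArg (fun s => s.app c) (hnat g)
  · ext e
    exact (τ e).naturality f
  · exact (hτ Q).trans hψ

end Extend

variable {D : Type u₃} [Category.{v} D] [Abelian D] [Linear k D]

/-- A biexact bilinear functor `T` which sends a pair of progenerators to a progenerator whose
endomorphism algebra is the tensor product of the two endomorphism algebras. -/
structure PreservesProgenerators (k : Type w) [Field k] [Linear k C] [Linear k E] [Linear k D]
    (T : C ⥤ E ⥤ D) (P : C) (Q : E) : Prop where
  lex : IsBilinearLex k T
  rex : IsBilinearRex k T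
  left : IsProgenerator P
  right : IsProgenerator Q
  tensor : IsProgenerator ((T.obj P).obj Q)
  bijective : Function.Bijective (endTensor rex P Q)

theorem IsBilinearRex.postcomp {X : Type u} [Category.{v₃} X] [Preadditive X] [Linear k X]
    {T : C ⥤ E ⥤ D} (hT : IsBilinearRex k T) {F : D ⥤ X} (hF : IsLinearRex k F) :
    IsBilinearRex k (postcomp T F) :=
  ⟨fun e => (hT.left e).comp hF, fun c => (hT.right c).comp hF⟩

/-- Restriction along `T` is fully faithful on right exact functors: both sides are the morphisms at
the progenerators that commute with the endomorphism algebra, which is spanned by the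
endomorphisms `T (f, g)`. -/
theorem PreservesProgenerators.bijective_whiskering {T : C ⥤ E ⥤ D} {P : C} {Q : E}
    (h : PreservesProgenerators k T P Q) {X : Type u} [Category.{v₃} X] [Preadditive X] [Linear k X]
    {F F' : D ⥤ X} (hF : IsLinearRex k F) (hF' : IsLinearRex k F') :
    Function.Bijective (fun τ : F ⟶ F' =>
      (Functor.whiskerLeft T ((Functor.whiskeringRight E D X).map τ) :
        postcomp T F ⟶ postcomp T F')) := by
  obtain ⟨_, _, _⟩ := id hF
  obtain ⟨_, _, _⟩ := id hF'
  refine ⟨fun τ τ' hτ => h.tensor.natTrans_ext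
    (congr_app (congr_app hτ P) Q), fun σ => ?_⟩
  have hcomm (r : (T.obj P).obj Q ⟶ (T.obj P).obj Q) :
      F.map r ≫ (σ.app P).app Q = (σ.app P).app Q ≫ F'.map r := by
    obtain ⟨z, rfl⟩ := h.bijective.2 r
    induction z with
    | zero =>
      rw [map_zero]
      exact (F.map_zero _ _ =≫ _).trans (zero_comp.trans (comp_zero.symm.trans
        (_ ≫= (F'.map_zero _ _).symm)))
    | add x y hx hy =>
      rw [map_add]
      refine (F.map_add =≫ _).trans ?_
      refine Eq.trans ?_ (_ ≫= F'.map_add.symm)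
      rw [Preadditive.add_comp, Preadditive.comp_add, hx, hy]
    | tmul f g =>
      have h1 := (σ.app P).naturality g
      have h2 := congrArg (fun s => s.app Q) (σ.naturality f)
      have h3 := endTensor_tmul h.rex P Q f g
      dsimp at h1 h2
      refine (congrArg F.map h3 =≫ _).trans ?_
      refine Eq.trans ?_ (_ ≫= (congrArg F'.map h3).symm)
      rw [F.map_comp, F'.map_comp, Category.assoc, h2, reassoc_of% h1]
  obtain ⟨τ, hτ, -⟩ := h.tensor.existsUnique_natTrans F F' _ hcomm
  exact ⟨τ, natTrans₂_ext h.left h.right (h.rex.postcomp hF) (h.rex.postcomp hF') hτ⟩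

/-- A bifunctor `G` that is right exact in each variable extends along `T`: the algebra
`End (T (P, Q)) ≅ End P ⊗ End Q` acts on `G (P, Q)`, and this action determines a right exact
functor. -/
theorem PreservesProgenerators.exists_factorization {T : C ⥤ E ⥤ D} {P : C} {Q : E}
    (h : PreservesProgenerators k T P Q) {X : Type u} [Category.{v} X] [Abelian X] [Linear k X]
    {G : C ⥤ E ⥤ X} (hG : IsBilinearRex k G) :
    ∃ F : D ⥤ X, IsLinearRex k F ∧ Nonempty (EilenbergWatts.postcomp T F ≅ G) := by
  let α := AlgEquiv.ofBijective _ h.bijective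
  let ρ : End ((T.obj P).obj Q) →ₐ[k] End ((G.obj P).obj Q) :=
    (endTensor hG P Q).comp α.symm.toAlgHom
  have hρ (f : P ⟶ P) (g : Q ⟶ Q) :
      ρ ((T.obj P).map g ≫ (T.map f).app Q) = (G.obj P).map g ≫ (G.map f).app Q := by
    rw [← endTensor_tmul hG, ← endTensor_tmul h.rex]
    exact congrArg (endTensor hG P Q)
      (α.symm_apply_apply ((show End P from f) ⊗ₜ[k] (show End Q from g)))
  obtain ⟨F, e, _, _, he⟩ := h.tensor.exists_functor ((G.obj P).obj Q) ρ.toRingHom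
  have hF : IsLinearRex k F := by
    refine ⟨inferInstance, ⟨fun {d d'} f a => ?_⟩, inferInstance⟩
    refine h.tensor.hom_ext F _ _ fun g => ?_
    have h1 : F.map (a • 𝟙 ((T.obj P).obj Q)) = a • 𝟙 _ := by
      rw [← cancel_mono e.hom, he]
      have : ρ (a • 𝟙 ((T.obj P).obj Q)) = a • 𝟙 _ :=
        (map_smul ρ a (1 : End ((T.obj P).obj Q))).trans (congrArg (a • ·) (map_one ρ))
      refine (_ ≫= this).trans ?_
      rw [Linear.smul_comp, Category.id_comp]
      exact (Linear.comp_smul _ _ _ _ _ _).trans (congrArg (a • ·) (Category.comp_id _))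
    rw [← F.map_comp, Linear.comp_smul, Linear.comp_smul, ← F.map_comp, ← Category.id_comp (g ≫ f),
      ← Linear.smul_comp, F.map_comp, h1]
    simp
  have hT := h.rex.postcomp hF
  have hl (f : P ⟶ P) : F.map ((T.map f).app Q) ≫ e.hom = e.hom ≫ (G.map f).app Q := by
    refine (he _).trans (_ ≫= ?_)
    have := hρ f (𝟙 Q)
    simpa using this
  have hr (g : Q ⟶ Q) : F.map ((T.obj P).map g) ≫ e.hom = e.hom ≫ (G.obj P).map g := by
    refine (he _).trans (_ ≫= ?_)
    have := hρ (𝟙 P) g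
    simpa using this
  obtain ⟨σ, hσ⟩ := exists_natTrans₂ h.left h.right hT hG e.hom hl hr
  obtain ⟨σ', hσ'⟩ := exists_natTrans₂ h.left h.right hG hT e.inv
    (fun f => by rw [Iso.comp_inv_eq, Category.assoc, Iso.eq_inv_comp]; exact (hl f).symm)
    (fun g => by rw [Iso.comp_inv_eq, Category.assoc, Iso.eq_inv_comp]; exact (hr g).symm)
  exact ⟨F, hF, ⟨⟨σ, σ', natTrans₂_ext h.left h.right hT hT (by simp [hσ, hσ']),
    natTrans₂_ext h.left h.right hG hG (by simp [hσ, hσ'])⟩⟩⟩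

/-- The recognition principle for Deligne products. -/
theorem PreservesProgenerators.isDeligneProduct {D : Type (w + 1)} [Category.{w} D] [Abelian D]
    [Linear k D] {T : C ⥤ E ⥤ D} {P : C} {Q : E} (h : PreservesProgenerators k T P Q) :
    IsDeligneProduct k T where
  lex := h.lex
  rex := h.rex
  fac _ _ _ _ _ hG := h.exists_factorization hG
  bijective _ _ _ _ _ _ hF hF' := h.bijective_whiskering hF hF'

end Recognition

/-! ### Finite linear categories -/

section FGModuleCat

variable {k : Type w} [Field k] (R : Type w) [Ring R]

/-- The morphism from the regular module which sends `1` to `m`. -/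
abbrev fromRegular {M : FGModuleCat.{w} R} (m : M) : FGModuleCat.of R R ⟶ M :=
  FGModuleCat.ofHom (LinearMap.toSpanSingleton R M m)

variable {R}

theorem fromRegular_apply_one {M : FGModuleCat.{w} R} (h : FGModuleCat.of R R ⟶ M) :
    fromRegular R (M := M) (h.hom.hom (1 : R)) = h := by
  ext
  exact one_smul R (h.hom.hom (1 : R))

theorem fromRegular_smul {M : FGModuleCat.{w} R} (r : R) (m : M) :
    fromRegular R (M := M) (r • m) =
      fromRegular R (M := FGModuleCat.of R R) r ≫ fromRegular R (M := M) m := by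
  ext
  exact (one_smul R (r • m)).trans (congrArg (· • m) (one_smul R r).symm)

theorem fromRegular_add {M : FGModuleCat.{w} R} (m m' : M) :
    fromRegular R (M := M) (m + m') = fromRegular R (M := M) m + fromRegular R (M := M) m' := by
  ext
  exact smul_add (1 : R) m m'

theorem comp_fromRegular {M M' : FGModuleCat.{w} R} (m : M) (f : M ⟶ M') :
    fromRegular R (M := M) m ≫ f = fromRegular R (M := M') (f.hom.hom m) := by
  ext
  exact f.hom.hom.map_smul (1 : R) m

theorem fgModuleCat_surjective_of_epi [IsNoetherianRing R] {M M' : FGModuleCat.{w} R}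
    (f : M ⟶ M') [Epi f] : Function.Surjective f.hom.hom :=
  (ModuleCat.epi_iff_surjective ((forget₂ (FGModuleCat R) (ModuleCat R)).map f)).1 inferInstance

attribute [local instance] Abelian.hasFiniteBiproducts

/-- The regular module is a progenerator. -/
theorem isProgenerator_regular [IsNoetherianRing R] : IsProgenerator (FGModuleCat.of R R) := by
  refine ⟨⟨fun {M M'} f e _ => ?_⟩, fun M => ?_⟩
  · obtain ⟨m, hm⟩ := fgModuleCat_surjective_of_epi e (f.hom.hom (1 : R))
    exact ⟨fromRegular R m, by rw [comp_fromRegular, hm, fromRegular_apply_one]⟩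
  · obtain ⟨n, g, hg⟩ := Module.Finite.exists_fin (R := R) (M := M)
    refine ⟨n, biproduct.desc fun i => fromRegular R (g i), ⟨fun {Z} s t hst => ?_⟩⟩
    ext x
    have hx : x ∈ Submodule.span R (Set.range g) := hg ▸ Submodule.mem_top
    have hi (i : Fin n) : s.hom.hom (g i) = t.hom.hom (g i) := by
      have := biproduct.ι (fun _ : Fin n => FGModuleCat.of R R) i ≫= hst
      rw [biproduct.ι_desc_assoc, biproduct.ι_desc_assoc, comp_fromRegular,
        comp_fromRegular] at this
      have := congrArg (fun f : FGModuleCat.of R R ⟶ Z => f.hom.hom (1 : R)) this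
      exact (one_smul R _).symm.trans (this.trans (one_smul R _))
    exact LinearMap.eqOn_span (f := s.hom.hom) (g := t.hom.hom)
      (by rintro _ ⟨i, rfl⟩; exact hi i) hx

variable {X : Type u} [Category.{w} X] [Preadditive X]

open scoped ModuleCat in
theorem fromRegular_algebraMap [Algebra k R] (a : k) :
    fromRegular R (M := FGModuleCat.of R R) (algebraMap k R a) = a • 𝟙 _ := by
  ext
  exact (one_mul (algebraMap k R a)).trans (mul_one (algebraMap k R a)).symm

/-- `Hom(F R, N)` as a module over `R`. -/
@[reducible]
def homModule (F : FGModuleCat.{w} R ⥤ X) [F.Additive] (N : X) :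
    Module R (F.obj (FGModuleCat.of R R) ⟶ N) where
  smul r t := F.map (fromRegular R (M := FGModuleCat.of R R) r) ≫ t
  one_smul t := by
    have := fromRegular_apply_one (𝟙 (FGModuleCat.of R R))
    exact (congrArg F.map this =≫ t).trans (by simp)
  mul_smul r s t := by
    have := fromRegular_smul (M := FGModuleCat.of R R) r s
    exact (congrArg F.map this =≫ t).trans (by rw [F.map_comp, Category.assoc]; rfl)
  smul_zero r := comp_zero
  smul_add r t t' := Preadditive.comp_add _ _ _ _ _ _
  add_smul r s t := by
    have := fromRegular_add (M := FGModuleCat.of R R) r s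
    exact (congrArg F.map this =≫ t).trans (by rw [F.map_add, Preadditive.add_comp]; rfl)
  zero_smul t := by
    have : fromRegular R (M := FGModuleCat.of R R) (0 : R) = 0 := by
      ext; exact smul_zero (1 : R)
    exact (congrArg F.map this =≫ t).trans (by simp)

/-- The right adjoint of a right exact functor `F` sends `N` to `Hom(F R, N)`. -/
theorem isLeftAdjoint_of_fgModuleCat [Algebra k R] [Module.Finite k R] [Linear k X]
    [∀ M N : X, Module.Finite k (M ⟶ N)]
    {F : FGModuleCat.{w} R ⥤ X} (hF : IsLinearRex k F) : F.IsLeftAdjoint := by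
  obtain ⟨_, _, _⟩ := hF
  have : IsNoetherianRing R := isNoetherian_of_tower k inferInstance
  refine Functor.isLeftAdjoint_of_rightAdjointObjIsDefined_eq_top ?_
  ext N
  simp only [Pi.top_apply, Prop.top_eq_true, iff_true]
  let := homModule F N
  have : IsScalarTower k R (F.obj (FGModuleCat.of R R) ⟶ N) := by
    refine ⟨fun a r t => ?_⟩
    have : a • r = algebraMap k R a • r := by rw [algebraMap_smul]
    rw [this, smul_assoc]
    change F.map (fromRegular R (M := FGModuleCat.of R R) (algebraMap k R a)) ≫ (r • t) =
      a • (r • t)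
    rw [fromRegular_algebraMap, F.map_smul]
    simp
  have : Module.Finite R (F.obj (FGModuleCat.of R R) ⟶ N) :=
    Module.Finite.of_restrictScalars_finite k R _
  let V := FGModuleCat.of R (F.obj (FGModuleCat.of R R) ⟶ N)
  let tr (M : FGModuleCat.{w} R) (t : F.obj M ⟶ N) : M ⟶ V := FGModuleCat.ofHom
    { toFun := fun m => F.map (fromRegular R m) ≫ t
      map_add' := fun m m' => by rw [fromRegular_add, F.map_add, Preadditive.add_comp]
      map_smul' := fun r m => by rw [fromRegular_smul, F.map_comp, Category.assoc]; rfl }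
  have htr (M : FGModuleCat.{w} R) : Function.Bijective (tr M) := by
    refine ⟨fun t t' h => isProgenerator_regular.hom_ext F _ _ fun g => ?_, fun φ => ?_⟩
    · have := congrArg (fun s : M ⟶ V => s.hom.hom (g.hom.hom (1 : R))) h
      rw [← fromRegular_apply_one g]
      exact this
    · obtain ⟨t, ht, -⟩ := isProgenerator_regular.existsUnique_desc F (c := M) (N := N)
        { toFun := fun h => φ.hom.hom (h.hom.hom (1 : R))
          map_zero' := φ.hom.hom.map_zero
          map_add' := fun h h' => φ.hom.hom.map_add _ _ }
        (fun r h => by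
          have h1 : h.hom.hom (r.hom.hom (1 : R)) =
              (r.hom.hom (1 : R) : R) • h.hom.hom (1 : R) := by
            rw [← h.hom.hom.map_smul]
            exact congrArg h.hom.hom (mul_one (r.hom.hom (1 : R) : R)).symm
          refine (congrArg φ.hom.hom h1).trans ((φ.hom.hom.map_smul _ _).trans ?_)
          change F.map (fromRegular R (M := FGModuleCat.of R R) _) ≫ _ = _
          rw [fromRegular_apply_one]
          rfl)
      refine ⟨t, ?_⟩
      ext m
      refine (ht _).trans ?_
      exact congrArg φ.hom.hom (one_smul R m)
  refine Functor.RepresentableBy.isRepresentable (Y := V)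
    { homEquiv := fun {M} => (Equiv.ofBijective _ (htr M)).symm
      homEquiv_comp := fun {M M'} f g => ?_ }
  rw [Equiv.symm_apply_eq]
  ext m
  obtain ⟨t, rfl⟩ := (htr M').2 g
  have h1 : (Equiv.ofBijective (tr M') (htr M')).symm (tr M' t) = t :=
    (Equiv.ofBijective _ (htr M')).symm_apply_apply t
  rw [h1]
  have h2 := comp_fromRegular m f
  refine Eq.trans ?_ (Category.assoc _ _ _)
  exact ((F.map_comp _ _).symm.trans (congrArg F.map h2) =≫ t).symm

end FGModuleCat

section Finite

variable (k : Type w) [Field k]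

/-- A finite linear category is abelian. -/
theorem exists_abelian (C : Type u) [Category.{v} C] [inst : Preadditive C] [Linear k C]
    [IsFiniteLinear k C] : ∃ h : Abelian C, h.toPreadditive = inst := by
  obtain ⟨R, _, _, _, F, _, _, _⟩ := IsFiniteLinear.exists_equivalence (k := k) (C := C)
  have : IsNoetherianRing R := isNoetherian_of_tower k inferInstance
  have : HasFiniteProducts C := ⟨fun _ => Adjunction.hasLimitsOfShape_of_equivalence F⟩
  exact ⟨abelianOfEquivalence F, rfl⟩

variable {k}

section Inverse

variable {C : Type u₁} [Category.{v₁} C] [Preadditive C] [Linear k C]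
  {E : Type u₂} [Category.{v₂} E] [Preadditive E] [Linear k E]

theorem additive_linear_inv (F : C ⥤ E) [F.IsEquivalence] [F.Additive] [F.Linear k] :
    F.inv.Additive ∧ F.inv.Linear k := by
  have h0 : F.asEquivalence.functor.Additive := ‹F.Additive›
  have h1 : F.asEquivalence.inverse.Additive := inferInstance
  have h2 : F.asEquivalence.functor.Linear k := ‹F.Linear k›
  exact ⟨h1, (inferInstance : F.asEquivalence.inverse.Linear k)⟩

theorem IsLinearRex.of_isEquivalence (F : C ⥤ E) [F.IsEquivalence] (h₁ : F.Additive)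
    (h₂ : F.Linear k) : IsLinearRex k F :=
  ⟨inferInstance, inferInstance, inferInstance⟩

theorem IsLinearLex.of_isEquivalence (F : C ⥤ E) [F.IsEquivalence] (h₁ : F.Additive)
    (h₂ : F.Linear k) : IsLinearLex k F :=
  ⟨inferInstance, inferInstance, inferInstance⟩

theorem IsFiniteLinear.of_isEquivalence [IsFiniteLinear k E] (F : C ⥤ E) [F.IsEquivalence]
    [F.Additive] [F.Linear k] : IsFiniteLinear k C := by
  obtain ⟨R, _, _, _, G, _, _, _⟩ := IsFiniteLinear.exists_equivalence (k := k) (C := E)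
  exact ⟨R, _, _, ‹_›, F ⋙ G, inferInstance, inferInstance, inferInstance⟩

end Inverse

/-- Right exact functors from a finite linear category have right adjoints. -/
theorem IsLinearRex.isLeftAdjoint {C : Type u₁} [Category.{v₁} C] [Preadditive C] [Linear k C]
    [IsFiniteLinear k C] {X : Type u} [Category.{w} X] [Preadditive X] [Linear k X]
    [∀ M N : X, Module.Finite k (M ⟶ N)] {F : C ⥤ X} (hF : IsLinearRex k F) :
    F.IsLeftAdjoint := by
  obtain ⟨R, _, _, _, G, _, _, _⟩ := IsFiniteLinear.exists_equivalence (k := k) (C := C)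
  have h := additive_linear_inv (k := k) G
  have := isLeftAdjoint_of_fgModuleCat
    ((IsLinearRex.of_isEquivalence G.inv h.1 h.2).comp hF)
  exact Functor.isLeftAdjoint_of_iso (F := G ⋙ G.inv ⋙ F)
    ((Functor.associator _ _ _).symm ≪≫
      Functor.isoWhiskerRight G.asEquivalence.unitIso.symm F ≪≫ F.leftUnitor)

end Finite

section ProgeneratorFinite

variable {k : Type w} [Field k] {C : Type u} [Category.{w} C] [Abelian C] [Linear k C]

/-- An abelian linear category with finite-dimensional morphism spaces and a progenerator is finite:
it is the category of finitely generated modules over the endomorphisms of the progenerator. -/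
theorem IsProgenerator.isFiniteLinear [∀ M N : C, Module.Finite k (M ⟶ N)] {P : C}
    (hP : IsProgenerator P) : IsFiniteLinear k C := by
  have := hP.projective
  have hfin : Module.Finite k (End P)ᵐᵒᵖ :=
    Module.Finite.equiv (M := (P ⟶ P)) (MulOpposite.opLinearEquiv k (M := End P))
  have : IsNoetherianRing (End P)ᵐᵒᵖ := isNoetherian_of_tower k inferInstance
  have hfg (c : C) : Module.Finite (End P)ᵐᵒᵖ ((preadditiveCoyonedaObj P).obj c) := by
    change Module.Finite (End P)ᵐᵒᵖ (P ⟶ c)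
    have : IsScalarTower k (End P)ᵐᵒᵖ (P ⟶ c) := ⟨fun a r t => Linear.smul_comp _ _ _ a r.unop t⟩
    exact Module.Finite.of_restrictScalars_finite k _ _
  let Φ : C ⥤ FGModuleCat.{w} (End P)ᵐᵒᵖ :=
    ObjectProperty.lift _ (preadditiveCoyonedaObj P) hfg
  have hfaith : Φ.Faithful := ⟨fun {c c' f g} h => hP.hom_ext (𝟭 C) _ _ fun t =>
    congrArg (fun s : Φ.obj c ⟶ Φ.obj c' => s.hom.hom (show P ⟶ c from t)) h⟩
  have hfull : Φ.Full := ⟨fun {c c'} s => by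
    obtain ⟨f, hf, -⟩ := hP.existsUnique_desc (𝟭 C) (c := c) (N := c')
      { toFun := fun t => s.hom.hom t
        map_zero' := s.hom.hom.map_zero
        map_add' := fun t t' => s.hom.hom.map_add t t' }
      (fun r t => s.hom.hom.map_smul (MulOpposite.op (show End P from r)) t)
    exact ⟨f, by ext t; exact hf t⟩⟩
  have hadd : Φ.Additive := ⟨by intros; ext t; exact Preadditive.comp_add _ _ _ _ _ _⟩
  have hlin : Φ.Linear k := ⟨fun {c c'} f a => by
    ext t
    refine (Linear.comp_smul _ _ _ (show P ⟶ _ from t) a f).trans ?_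
    refine (congrArg (a • ·) (Category.id_comp ((show P ⟶ _ from t) ≫ f)).symm).trans ?_
    exact (Linear.smul_comp _ _ _ a (𝟙 P) ((show P ⟶ _ from t) ≫ f)).symm⟩
  have hrex : PreservesFiniteColimits Φ := by
    have : PreservesFiniteColimits (Φ ⋙ forget₂ (FGModuleCat (End P)ᵐᵒᵖ) (ModuleCat (End P)ᵐᵒᵖ)) :=
      inferInstanceAs (PreservesFiniteColimits (preadditiveCoyonedaObj P))
    exact ⟨fun J _ _ => preservesColimitsOfShape_of_reflects_of_preserves _
      (forget₂ (FGModuleCat (End P)ᵐᵒᵖ) (ModuleCat (End P)ᵐᵒᵖ))⟩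
  let E := FGModuleCat.of (End P)ᵐᵒᵖ (End P)ᵐᵒᵖ
  let ρ : End E →+* End P :=
    { toFun := fun f => ((show E ⟶ E from f).hom.hom (1 : (End P)ᵐᵒᵖ) : (End P)ᵐᵒᵖ).unop
      map_one' := rfl
      map_zero' := rfl
      map_add' := fun f g => rfl
      map_mul' := fun f g => by
        refine congrArg MulOpposite.unop (?_ : (show E ⟶ E from f).hom.hom
          ((show E ⟶ E from g).hom.hom (1 : (End P)ᵐᵒᵖ)) =
          ((show E ⟶ E from g).hom.hom (1 : (End P)ᵐᵒᵖ) : (End P)ᵐᵒᵖ) *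
            ((show E ⟶ E from f).hom.hom (1 : (End P)ᵐᵒᵖ) : (End P)ᵐᵒᵖ))
        refine Eq.trans ?_ ((show E ⟶ E from f).hom.hom.map_smul
          ((show E ⟶ E from g).hom.hom (1 : (End P)ᵐᵒᵖ) : (End P)ᵐᵒᵖ) (1 : (End P)ᵐᵒᵖ))
        exact congrArg (show E ⟶ E from f).hom.hom (mul_one _).symm }
  have hE : IsProgenerator E := isProgenerator_regular
  obtain ⟨L, e, _, _, he⟩ := hE.exists_functor P ρ
  have hess : Φ.EssSurj := by
    let φ : E ⟶ Φ.obj (L.obj E) := fromRegular _ (M := Φ.obj (L.obj E)) e.inv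
    let ψ : Φ.obj (L.obj E) ⟶ E := ⟨ModuleCat.ofHom
      { toFun := fun t => MulOpposite.op (show End P from (show P ⟶ L.obj E from t) ≫ e.hom)
        map_add' := fun t t' => congrArg MulOpposite.op (Preadditive.add_comp _ _ _ _ _ _)
        map_smul' := fun r t => congrArg MulOpposite.op (Category.assoc _ _ _) }⟩
    have hφψ : φ ≫ ψ = 𝟙 _ := by
      refine FGModuleCat.hom_ext (LinearMap.ext fun (r : (End P)ᵐᵒᵖ) => ?_)
      refine congrArg MulOpposite.op (a₁ := ((show P ⟶ P from r.unop) ≫ e.inv) ≫ e.hom)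
        (a₂ := (show P ⟶ P from r.unop)) ?_
      rw [Category.assoc, e.inv_hom_id, Category.comp_id]
    have hψφ : ψ ≫ φ = 𝟙 _ := by
      ext t
      change ((show P ⟶ L.obj E from t) ≫ e.hom) ≫ e.inv = (show P ⟶ L.obj E from t)
      rw [Category.assoc, e.hom_inv_id, Category.comp_id]
    have hcomm (r : E ⟶ E) : r ≫ φ = φ ≫ Φ.map (L.map r) := by
      rw [← fromRegular_apply_one (r ≫ φ), ← fromRegular_apply_one (φ ≫ Φ.map (L.map r))]
      refine congrArg (fromRegular _) (?_ : (show P ⟶ P from ρ r) ≫ e.inv =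
        ((show P ⟶ P from (1 : End P)) ≫ e.inv) ≫ L.map r)
      refine Eq.trans ?_ (Category.id_comp e.inv =≫ L.map r).symm
      rw [Iso.eq_inv_comp, ← reassoc_of% he, e.hom_inv_id, Category.comp_id]
    obtain ⟨α, hα, -⟩ := hE.existsUnique_natTrans (𝟭 _) (L ⋙ Φ) φ hcomm
    have : PreservesFiniteColimits (L ⋙ Φ) := comp_preservesFiniteColimits _ _
    obtain ⟨β, hβ, -⟩ := hE.existsUnique_natTrans (L ⋙ Φ) (𝟭 _) ψ (fun r => by
      change Φ.map (L.map r) ≫ ψ = ψ ≫ r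
      calc
        Φ.map (L.map r) ≫ ψ = ψ ≫ (φ ≫ Φ.map (L.map r)) ≫ ψ := by
          rw [Category.assoc, reassoc_of% hψφ]
        _ = ψ ≫ r := by rw [← hcomm, Category.assoc, hφψ, Category.comp_id])
    have h1 : α ≫ β = 𝟙 _ := hE.natTrans_ext (by simp [hα, hβ, hφψ])
    have h2 : β ≫ α = 𝟙 _ := hE.natTrans_ext (by simp [hα, hβ, hψφ])
    exact ⟨fun M => ⟨L.obj M, ⟨⟨β.app M, α.app M, congrArg (fun s => s.app M) h2,
      congrArg (fun s => s.app M) h1⟩⟩⟩⟩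
  exact ⟨(End P)ᵐᵒᵖ, inferInstance, inferInstance, hfin, Φ, {}, hadd, hlin⟩

end ProgeneratorFinite

/-! ### Opposites of finite linear categories -/

section Coregular

variable (k : Type w) [Field k] (R : Type w) [Ring R] [Algebra k R]

/-- The linear dual of the regular right module, as a left module. -/
def Coregular : Type w := Module.Dual k R

instance : AddCommGroup (Coregular k R) := inferInstanceAs (AddCommGroup (Module.Dual k R))

instance : Module k (Coregular k R) := inferInstanceAs (Module k (Module.Dual k R))

instance : Module R (Coregular k R) where
  smul r φ := (show Module.Dual k R from φ).comp (LinearMap.mulRight k r)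
  one_smul φ := LinearMap.ext fun x => congrArg (show Module.Dual k R from φ) (mul_one x)
  mul_smul r s φ := LinearMap.ext fun x =>
    congrArg (show Module.Dual k R from φ) (mul_assoc x r s).symm
  smul_zero _ := rfl
  smul_add _ _ _ := rfl
  add_smul r s φ := LinearMap.ext fun x =>
    (congrArg (show Module.Dual k R from φ) (mul_add x r s)).trans (map_add _ _ _)
  zero_smul φ := LinearMap.ext fun x =>
    (congrArg (show Module.Dual k R from φ) (mul_zero x)).trans (map_zero _)

variable {k R} in
theorem coregular_smul_apply (r : R) (φ : Coregular k R) (x : R) :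
    (show Module.Dual k R from r • φ) x = (show Module.Dual k R from φ) (x * r) :=
  rfl

instance : IsScalarTower k R (Coregular k R) where
  smul_assoc a r φ := LinearMap.ext fun x => by
    rw [coregular_smul_apply, mul_smul_comm, map_smul]
    rfl

variable [Module.Finite k R]

attribute [local instance] Abelian.hasFiniteBiproducts

instance : Module.Finite k (Coregular k R) := inferInstanceAs (Module.Finite k (Module.Dual k R))

instance : Module.Finite R (Coregular k R) := Module.Finite.of_restrictScalars_finite k R _

variable {R}

open scoped ModuleCat in
/-- Morphisms to the coregular module are linear functionals. -/
def toCoregular {M : FGModuleCat.{w} R} (ξ : Module.Dual k M.obj) :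
    M ⟶ FGModuleCat.of R (Coregular k R) :=
  FGModuleCat.ofHom
    { toFun := fun m => (ξ.comp ((LinearMap.toSpanSingleton R M.obj m).restrictScalars k) :
        Module.Dual k R)
      map_add' := fun m m' => LinearMap.ext fun r =>
        (congrArg ξ (smul_add r m m')).trans (map_add _ _ _)
      map_smul' := fun s m => LinearMap.ext fun r => congrArg ξ (mul_smul r s m).symm }

open scoped ModuleCat in
/-- The coregular module is an injective cogenerator. -/
theorem isProgenerator_op_coregular [IsNoetherianRing R] :
    IsProgenerator (op (FGModuleCat.of R (Coregular k R))) := by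
  have hinj : Injective (FGModuleCat.of R (Coregular k R)) := by
    refine ⟨fun {M M'} g f hf => ?_⟩
    have hf' : Function.Injective f.hom.hom :=
      (ModuleCat.mono_iff_injective ((forget₂ (FGModuleCat R) (ModuleCat R)).map f)).1 inferInstance
    let ξ : Module.Dual k M.obj :=
      { toFun := fun m => (show Module.Dual k R from g.hom.hom m) 1
        map_add' := fun m m' => by rw [map_add]; rfl
        map_smul' := fun a m => by
          rw [← algebraMap_smul R a m, map_smul, ← map_smul (show Module.Dual k R from g.hom.hom m)]
          refine congrArg (show Module.Dual k R from g.hom.hom m) ?_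
          exact (one_mul (algebraMap k R a)).trans (Algebra.algebraMap_eq_smul_one a) }
    obtain ⟨s, hs⟩ := (f.hom.hom.restrictScalars k).exists_leftInverse_of_injective
      (LinearMap.ker_eq_bot.2 hf')
    refine ⟨toCoregular k (ξ.comp s), ?_⟩
    refine FGModuleCat.hom_ext (LinearMap.ext fun m => LinearMap.ext fun (r : R) => ?_)
    change ξ (s (r • f.hom.hom m)) = (show Module.Dual k R from g.hom.hom m) r
    have h1 : s (r • f.hom.hom m) = r • m := by
      rw [← map_smul]
      exact LinearMap.congr_fun hs (r • m)
    rw [h1]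
    change (show Module.Dual k R from g.hom.hom (r • m)) 1 = _
    rw [map_smul]
    exact congrArg (show Module.Dual k R from g.hom.hom m) (one_mul r)
  refine ⟨inferInstance, fun M => ?_⟩
  have : Module.Finite k M.unop.obj := Module.Finite.trans R _
  let b := Module.finBasis k (Module.Dual k M.unop.obj)
  refine ⟨_, biproduct.desc fun i => (toCoregular k (b i)).op, ⟨fun {Z} s t hst => ?_⟩⟩
  have hi (i) : s.unop ≫ toCoregular k (b i) = t.unop ≫ toCoregular k (b i) := by
    have := biproduct.ι _ i ≫= hst
    rw [biproduct.ι_desc_assoc, biproduct.ι_desc_assoc] at this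
    exact congrArg Quiver.Hom.unop this
  refine Quiver.Hom.unop_inj (FGModuleCat.hom_ext (LinearMap.ext fun z => ?_))
  have h : Module.Dual.eval k M.unop.obj (s.unop.hom.hom z) =
      Module.Dual.eval k M.unop.obj (t.unop.hom.hom z) := by
    refine b.ext fun i => ?_
    have := congrArg (fun f : Z.unop ⟶ FGModuleCat.of R (Coregular k R) =>
      (show Module.Dual k R from f.hom.hom z) 1) (hi i)
    change b i ((1 : R) • s.unop.hom.hom z) = b i ((1 : R) • t.unop.hom.hom z) at this
    rw [one_smul, one_smul] at this
    exact this
  exact Module.eval_apply_injective k h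

end Coregular

section Opposite

variable (k : Type w) [Field k]

/-- The opposite of a finite linear category is finite: the coregular module is a progenerator of
the opposite of a module category. -/
theorem IsFiniteLinear.op (C : Type u) [Category.{v} C] [Preadditive C] [Linear k C]
    [IsFiniteLinear k C] : IsFiniteLinear k Cᵒᵖ := by
  obtain ⟨R, _, _, _, F, _, _, _⟩ := IsFiniteLinear.exists_equivalence (k := k) (C := C)
  have : IsNoetherianRing R := isNoetherian_of_tower k inferInstance
  have (M N : (FGModuleCat.{w} R)ᵒᵖ) : Module.Finite k (M ⟶ N) := by
    have := finite_hom_fgModuleCat k R N.unop M.unop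
    exact Module.Finite.equiv (M := (N.unop ⟶ M.unop))
      { toFun := Quiver.Hom.op
        invFun := Quiver.Hom.unop
        map_add' := fun _ _ => rfl
        map_smul' := fun _ _ => rfl
        left_inv := fun _ => rfl
        right_inv := fun _ => rfl }
  have := (isProgenerator_op_coregular (R := R) k).isFiniteLinear (k := k)
  have : F.op.Linear k := ⟨fun f a => congrArg Quiver.Hom.op (F.map_smul a f.unop)⟩
  exact IsFiniteLinear.of_isEquivalence F.op

end Opposite

/-! ### The outer tensor product of modules -/

section Semisimple

variable {C : Type u₁} [Category.{v₁} C] [Abelian C] {E : Type u₂} [Category.{v₂} E] [Abelian E]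

/-- If all objects are projective, then all short exact sequences split, so that all additive
functors are exact. -/
theorem exact_of_projective (F : C ⥤ E) [F.Additive] (h : ∀ c : C, Projective c) :
    PreservesFiniteLimits F ∧ PreservesFiniteColimits F := by
  refine ((Functor.exact_tfae F).out 0 3).1 fun S hS => ?_
  have := h S.X₃
  exact (hS.splittingOfProjective.map F).shortExact

end Semisimple

section ForgetToVect

variable (k : Type w) [Field k] (R : Type w) [Ring R] [Algebra k R]

instance (V : ModuleCat.{w} k) : Projective V :=
  ModuleCat.projective_of_free (Module.Free.chooseBasis k V)

/-- The underlying vector space of a finitely generated module. -/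
abbrev toVect : FGModuleCat.{w} R ⥤ ModuleCat.{w} k :=
  forget₂ (FGModuleCat.{w} R) (ModuleCat.{w} R) ⋙ ModuleCat.restrictScalars (algebraMap k R)

theorem preservesFinite_toVect [IsNoetherianRing R] :
    PreservesFiniteLimits (toVect k R) ∧ PreservesFiniteColimits (toVect k R) :=
  have : PreservesFiniteLimits (ModuleCat.restrictScalars.{w} (algebraMap k R)) :=
    ⟨fun _ _ _ => ⟨fun {_} => inferInstance⟩⟩
  have : PreservesFiniteColimits (ModuleCat.restrictScalars.{w} (algebraMap k R)) :=
    ⟨fun _ _ _ => ⟨fun {_} => inferInstance⟩⟩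
  ⟨comp_preservesFiniteLimits _ _, comp_preservesFiniteColimits _ _⟩

/-- Exactness of a functor to finitely generated modules can be tested on underlying vector
spaces. -/
theorem exact_of_comp_toVect [IsNoetherianRing R] {C : Type u} [Category.{v} C]
    (F : C ⥤ FGModuleCat.{w} R)
    (h : PreservesFiniteLimits (F ⋙ toVect k R) ∧ PreservesFiniteColimits (F ⋙ toVect k R)) :
    PreservesFiniteLimits F ∧ PreservesFiniteColimits F := by
  obtain ⟨_, _⟩ := h
  obtain ⟨_, _⟩ := preservesFinite_toVect k R
  have : (toVect k R).ReflectsIsomorphisms := inferInstance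
  exact ⟨⟨fun J _ _ => by
      have : ReflectsLimitsOfShape J (toVect k R) := reflectsLimitsOfShape_of_reflectsIsomorphisms
      exact preservesLimitsOfShape_of_reflects_of_preserves F (toVect k R)⟩,
    ⟨fun J _ _ => by
      have : ReflectsColimitsOfShape J (toVect k R) :=
        reflectsColimitsOfShape_of_reflectsIsomorphisms
      exact preservesColimitsOfShape_of_reflects_of_preserves F (toVect k R)⟩⟩

end ForgetToVect

section OuterTensor

open TensorProduct

/-- The tensor product over `k` of an `R`-module and an `S`-module. -/
def OuterTensor (k : Type w) [Field k] (_R _S M N : Type w) [AddCommGroup M] [Module k M]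
    [AddCommGroup N] [Module k N] : Type w := M ⊗[k] N

section

variable (k : Type w) [Field k] (R S : Type w) (M N : Type w)
  [AddCommGroup M] [Module k M] [AddCommGroup N] [Module k N]

instance : AddCommGroup (OuterTensor k R S M N) := inferInstanceAs (AddCommGroup (M ⊗[k] N))

instance : Module k (OuterTensor k R S M N) := inferInstanceAs (Module k (M ⊗[k] N))

variable {M N} in
/-- The pure tensors in an outer tensor product. -/
def outerMk (m : M) (n : N) : OuterTensor k R S M N := m ⊗ₜ[k] n

variable {k R S M N} in
theorem outerMk_induction {p : OuterTensor k R S M N → Prop} (x : OuterTensor k R S M N)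
    (zero : p 0) (tmul : ∀ m n, p (outerMk k R S m n)) (add : ∀ x y, p x → p y → p (x + y)) : p x :=
  TensorProduct.induction_on (motive := p) x zero tmul add

end

variable (k : Type w) [Field k] (R S : Type w) [Ring R] [Algebra k R] [Ring S] [Algebra k S]
  (M N : Type w) [AddCommGroup M] [Module k M] [Module R M] [IsScalarTower k R M]
  [AddCommGroup N] [Module k N] [Module S N] [IsScalarTower k S N]

/-- The action of `R ⊗ S` on the outer tensor product. -/
def outerAction : R ⊗[k] S →ₐ[k] Module.End k (M ⊗[k] N) :=
  (Module.endTensorEndAlgHom (R := k) (S := k) (A := k)).comp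
    (Algebra.TensorProduct.map (Algebra.lsmul k k M) (Algebra.lsmul k k N))

instance : Module (R ⊗[k] S) (OuterTensor k R S M N) :=
  Module.compHom (M ⊗[k] N) (outerAction k R S M N).toRingHom

instance : IsScalarTower k (R ⊗[k] S) (OuterTensor k R S M N) :=
  ⟨fun a z x => LinearMap.congr_fun (map_smul (outerAction k R S M N) a z) x⟩

instance [Module.Finite k M] [Module.Finite k N] : Module.Finite k (OuterTensor k R S M N) :=
  inferInstanceAs (Module.Finite k (M ⊗[k] N))

instance [Module.Finite k M] [Module.Finite k N] :
    Module.Finite (R ⊗[k] S) (OuterTensor k R S M N) :=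
  Module.Finite.of_restrictScalars_finite k _ _

variable {k R S M N}

theorem smul_outerMk (r : R) (s : S) (m : M) (n : N) :
    (r ⊗ₜ[k] s) • outerMk k R S m n = outerMk k R S (r • m) (s • n) :=
  rfl

/-- A `k`-linear map out of an outer tensor product which is equivariant on pure tensors. -/
def outerLift {W : Type w} [AddCommGroup W] [Module k W] [Module (R ⊗[k] S) W]
    (φ : OuterTensor k R S M N →ₗ[k] W)
    (h : ∀ (r : R) (s : S) (m : M) (n : N),
      φ (outerMk k R S (r • m) (s • n)) = (r ⊗ₜ[k] s) • φ (outerMk k R S m n)) :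
    OuterTensor k R S M N →ₗ[R ⊗[k] S] W where
  toFun := φ
  map_add' := map_add φ
  map_smul' z x := by
    rw [RingHom.id_apply]
    induction z with
    | zero => rw [zero_smul, zero_smul, map_zero]
    | add z z' h h' => rw [add_smul, add_smul, map_add, h, h']
    | tmul r s =>
      induction x using outerMk_induction with
      | zero => rw [smul_zero, map_zero, smul_zero]
      | tmul m n => rw [smul_outerMk, h]
      | add x y hx hy => rw [smul_add, map_add, map_add, smul_add, hx, hy]

variable {M' N' : Type w} [AddCommGroup M'] [Module k M'] [Module R M'] [IsScalarTower k R M']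
  [AddCommGroup N'] [Module k N'] [Module S N'] [IsScalarTower k S N']

/-- The outer tensor product of linear maps. -/
def outerMap (f : M →ₗ[R] M') (g : N →ₗ[S] N') :
    OuterTensor k R S M N →ₗ[R ⊗[k] S] OuterTensor k R S M' N' :=
  outerLift (TensorProduct.map (f.restrictScalars k) (g.restrictScalars k)) fun r s m n => by
    rw [smul_outerMk r s m n |>.symm]
    change outerMk k R S (f (r • m)) (g (s • n)) = (r ⊗ₜ[k] s) • outerMk k R S (f m) (g n)
    rw [map_smul, map_smul, smul_outerMk]

theorem outerHom_ext {W : Type w} [AddCommGroup W] [Module (R ⊗[k] S) W]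
    {f g : OuterTensor k R S M N →ₗ[R ⊗[k] S] W}
    (h : ∀ (m : M) (n : N), f (outerMk k R S m n) = g (outerMk k R S m n)) : f = g :=
  LinearMap.ext fun x => outerMk_induction (p := fun x => f x = g x) x
    ((map_zero f).trans (map_zero g).symm) h
    (fun x y hx hy => by rw [map_add, map_add, hx, hy])

end OuterTensor

section OuterTensorFunctor

variable (k : Type w) [Field k] (R S : Type w) [Ring R] [Algebra k R] [Module.Finite k R]
  [Ring S] [Algebra k S] [Module.Finite k S]

open TensorProduct

open scoped ModuleCat

theorem fgModuleCat_finite (M : FGModuleCat.{w} R) : Module.Finite k M.obj :=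
  Module.Finite.trans R M.obj

attribute [local instance] fgModuleCat_finite

/-- The outer tensor product as a bifunctor. -/
def outerTensor : FGModuleCat.{w} R ⥤ FGModuleCat.{w} S ⥤ FGModuleCat.{w} (R ⊗[k] S) where
  obj M :=
    { obj := fun N => FGModuleCat.of _ (OuterTensor k R S M.obj N.obj)
      map := fun g => FGModuleCat.ofHom (outerMap LinearMap.id g.hom.hom)
      map_id := fun _ => FGModuleCat.hom_ext (outerHom_ext fun _ _ => rfl)
      map_comp := fun _ _ => FGModuleCat.hom_ext (outerHom_ext fun _ _ => rfl) }
  map f :=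
    { app := fun _ => FGModuleCat.ofHom (outerMap f.hom.hom LinearMap.id)
      naturality := fun _ _ _ => FGModuleCat.hom_ext (outerHom_ext fun _ _ => rfl) }
  map_id _ := NatTrans.ext (funext fun _ => FGModuleCat.hom_ext (outerHom_ext fun _ _ => rfl))
  map_comp _ _ := NatTrans.ext (funext fun _ => FGModuleCat.hom_ext (outerHom_ext fun _ _ => rfl))

/-- The outer tensor product is exact in each variable, because it is so on vector spaces. -/
theorem outerTensor_isBilinear : IsBilinearLex k (outerTensor k R S) ∧
    IsBilinearRex k (outerTensor k R S) := by
  have : IsNoetherianRing R := isNoetherian_of_tower k inferInstance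
  have : IsNoetherianRing S := isNoetherian_of_tower k inferInstance
  have : IsNoetherianRing (R ⊗[k] S) := isNoetherian_of_tower k inferInstance
  have hl (N : FGModuleCat.{w} S) : ((outerTensor k R S).flip.obj N).Additive ∧
      ((outerTensor k R S).flip.obj N).Linear k ∧
      PreservesFiniteLimits ((outerTensor k R S).flip.obj N) ∧
      PreservesFiniteColimits ((outerTensor k R S).flip.obj N) := by
    refine ⟨⟨fun {M M' f g} => FGModuleCat.hom_ext (outerHom_ext fun m n => add_tmul _ _ _)⟩,
      ⟨fun {M M'} f a => FGModuleCat.hom_ext (outerHom_ext fun m n => ?_)⟩,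
      exact_of_comp_toVect k _ _ ?_⟩
    · refine Eq.trans ?_ (algebraMap_smul (R ⊗[k] S) a
        (outerMk k R S (f.hom.hom m) (n : N.obj))).symm
      refine Eq.trans ?_ (TensorProduct.smul_tmul' a (f.hom.hom m) (n : N.obj)).symm
      exact congrArg (fun x => outerMk k R S x (n : N.obj)) (algebraMap_smul R a (f.hom.hom m))
    · let F : ModuleCat.{w} k ⥤ ModuleCat.{w} k :=
        MonoidalCategory.tensorRight (ModuleCat.of k N.obj)
      have hF := exact_of_projective F inferInstance
      obtain ⟨_, _⟩ := hF
      obtain ⟨_, _⟩ := preservesFinite_toVect k R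
      let i : toVect k R ⋙ F ≅ (outerTensor k R S).flip.obj N ⋙ toVect k (R ⊗[k] S) :=
        NatIso.ofComponents (fun M => LinearEquiv.toModuleIso
          { toFun := fun x => x
            invFun := fun x => x
            map_add' := fun _ _ => rfl
            map_smul' := fun a x => (algebraMap_smul (R ⊗[k] S) a
              (show OuterTensor k R S M.obj N.obj from x)).symm
            left_inv := fun _ => rfl
            right_inv := fun _ => rfl }) (fun {M M'} f => rfl)
      have : PreservesFiniteLimits (toVect k R ⋙ F) := comp_preservesFiniteLimits _ _
      have : PreservesFiniteColimits (toVect k R ⋙ F) := comp_preservesFiniteColimits _ _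
      exact ⟨preservesFiniteLimits_of_natIso i, preservesFiniteColimits_of_natIso i⟩
  have hr (M : FGModuleCat.{w} R) : ((outerTensor k R S).obj M).Additive ∧
      ((outerTensor k R S).obj M).Linear k ∧
      PreservesFiniteLimits ((outerTensor k R S).obj M) ∧
      PreservesFiniteColimits ((outerTensor k R S).obj M) := by
    refine ⟨⟨fun {N N' f g} => FGModuleCat.hom_ext (outerHom_ext fun m n => tmul_add _ _ _)⟩,
      ⟨fun {N N'} f a => FGModuleCat.hom_ext (outerHom_ext fun m n => ?_)⟩,
      exact_of_comp_toVect k _ _ ?_⟩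
    · refine Eq.trans ?_ (algebraMap_smul (R ⊗[k] S) a
        (outerMk k R S (m : M.obj) (f.hom.hom n))).symm
      refine Eq.trans ?_ (TensorProduct.tmul_smul a (m : M.obj) (f.hom.hom n))
      exact congrArg (fun x => outerMk k R S (m : M.obj) x) (algebraMap_smul S a (f.hom.hom n))
    · let F : ModuleCat.{w} k ⥤ ModuleCat.{w} k :=
        MonoidalCategory.tensorLeft (ModuleCat.of k M.obj)
      have hF := exact_of_projective F inferInstance
      obtain ⟨_, _⟩ := hF
      obtain ⟨_, _⟩ := preservesFinite_toVect k S
      let i : toVect k S ⋙ F ≅ (outerTensor k R S).obj M ⋙ toVect k (R ⊗[k] S) :=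
        NatIso.ofComponents (fun N => LinearEquiv.toModuleIso
          { toFun := fun x => x
            invFun := fun x => x
            map_add' := fun _ _ => rfl
            map_smul' := fun a x => (algebraMap_smul (R ⊗[k] S) a
              (show OuterTensor k R S M.obj N.obj from x)).symm
            left_inv := fun _ => rfl
            right_inv := fun _ => rfl }) (fun {N N'} f => rfl)
      have : PreservesFiniteLimits (toVect k S ⋙ F) := comp_preservesFiniteLimits _ _
      have : PreservesFiniteColimits (toVect k S ⋙ F) := comp_preservesFiniteColimits _ _
      exact ⟨preservesFiniteLimits_of_natIso i, preservesFiniteColimits_of_natIso i⟩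
  exact ⟨⟨fun N => ⟨(hl N).1, (hl N).2.1, (hl N).2.2.1⟩,
      fun M => ⟨(hr M).1, (hr M).2.1, (hr M).2.2.1⟩⟩,
    ⟨fun N => ⟨(hl N).1, (hl N).2.1, (hl N).2.2.2⟩,
      fun M => ⟨(hr M).1, (hr M).2.1, (hr M).2.2.2⟩⟩⟩

end OuterTensorFunctor

/-! ### Functors preserving progenerators, up to equivalence and duality -/

section Transport

open TensorProduct

variable {k : Type w} [Field k]

section EndTensor

universe v₄ v₅ v₆ u₄ u₅ u₆

variable {C : Type u₁} [Category.{v₁} C] [Preadditive C] [Linear k C]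
  {E : Type u₂} [Category.{v₂} E] [Preadditive E] [Linear k E]
  {D : Type u₃} [Category.{v₃} D] [Preadditive D] [Linear k D]
  {C' : Type u₄} [Category.{v₄} C'] [Preadditive C'] [Linear k C']
  {E' : Type u₅} [Category.{v₅} E'] [Preadditive E'] [Linear k E']
  {D' : Type u₆} [Category.{v₆} D'] [Preadditive D'] [Linear k D']

/-- Bijectivity of `End c ⊗ End e → End (T (c, e))` is invariant under compatible linear bijections
of the three endomorphism spaces. -/
theorem bijective_endTensor_of_equiv {T : C ⥤ E ⥤ D} {T' : C' ⥤ E' ⥤ D'} (hT : IsBilinearRex k T)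
    (hT' : IsBilinearRex k T') {c : C} {e : E} {c' : C'} {e' : E'}
    (h : Function.Bijective (endTensor hT c e)) (a : (c' ⟶ c') ≃ₗ[k] (c ⟶ c))
    (b : (e' ⟶ e') ≃ₗ[k] (e ⟶ e))
    (d : ((T.obj c).obj e ⟶ (T.obj c).obj e) ≃ₗ[k] ((T'.obj c').obj e' ⟶ (T'.obj c').obj e'))
    (hd : ∀ f g, d ((T.obj c).map (b g) ≫ (T.map (a f)).app e) =
      (T'.obj c').map g ≫ (T'.map f).app e') :
    Function.Bijective (endTensor hT' c' e') := by
  have key : (endTensor hT' c' e' : End c' ⊗[k] End e' → End ((T'.obj c').obj e')) =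
      d ∘ endTensor hT c e ∘ TensorProduct.congr a b := by
    have : (endTensor hT' c' e').toLinearMap =
        d.toLinearMap ∘ₗ (endTensor hT c e).toLinearMap ∘ₗ (TensorProduct.congr a b).toLinearMap :=
      TensorProduct.ext' fun f g => (hd f g).symm
    exact congrArg DFunLike.coe this
  rw [key]
  exact d.bijective.comp (h.comp (TensorProduct.congr a b).bijective)

/-- The action of a fully faithful linear functor on endomorphisms. -/
def mapEndEquiv (F : C ⥤ E) [F.Full] [F.Faithful] [F.Additive] [F.Linear k] (c : C) :
    (c ⟶ c) ≃ₗ[k] (F.obj c ⟶ F.obj c) :=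
  LinearEquiv.ofBijective (F.mapLinearMap k) ⟨F.map_injective, F.map_surjective⟩

/-- Passing to the opposite category, on endomorphisms. -/
def opEndEquiv (c : C) : (c ⟶ c) ≃ₗ[k] (op c ⟶ op c) where
  toFun := Quiver.Hom.op
  invFun := Quiver.Hom.unop
  map_add' _ _ := rfl
  map_smul' _ _ := rfl
  left_inv _ := rfl
  right_inv _ := rfl

/-- The bifunctor between opposite categories induced by a bifunctor. -/
abbrev opBifunctor (T : C ⥤ E ⥤ D) : Cᵒᵖ ⥤ Eᵒᵖ ⥤ Dᵒᵖ := T.op ⋙ Functor.opHom E D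

theorem IsLinearLex.op {F : C ⥤ E} (hF : IsLinearLex k F) : IsLinearRex k F.op := by
  obtain ⟨_, _, _⟩ := hF
  exact ⟨inferInstance, ⟨fun f a => congrArg Quiver.Hom.op (F.map_smul a f.unop)⟩,
    preservesFiniteColimits_op F⟩

theorem IsLinearRex.op {F : C ⥤ E} (hF : IsLinearRex k F) : IsLinearLex k F.op := by
  obtain ⟨_, _, _⟩ := hF
  exact ⟨inferInstance, ⟨fun f a => congrArg Quiver.Hom.op (F.map_smul a f.unop)⟩,
    preservesFiniteLimits_op F⟩

theorem IsBilinearLex.op {T : C ⥤ E ⥤ D} (hT : IsBilinearLex k T) :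
    IsBilinearRex k (opBifunctor T) :=
  ⟨fun e => (hT.left e.unop).op, fun c => (hT.right c.unop).op⟩

theorem IsBilinearRex.op {T : C ⥤ E ⥤ D} (hT : IsBilinearRex k T) :
    IsBilinearLex k (opBifunctor T) :=
  ⟨fun e => (hT.left e.unop).op, fun c => (hT.right c.unop).op⟩

theorem bijective_endTensor_op {T : C ⥤ E ⥤ D} (hT : IsBilinearRex k T) (hT' : IsBilinearLex k T)
    {c : C} {e : E} (h : Function.Bijective (endTensor hT c e)) :
    Function.Bijective (endTensor hT'.op (op c) (op e)) :=
  bijective_endTensor_of_equiv hT hT'.op h (opEndEquiv c).symm (opEndEquiv e).symm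
    (opEndEquiv ((T.obj c).obj e)) fun f g =>
      congrArg Quiver.Hom.op ((T.map f.unop).naturality g.unop)

theorem IsBilinearRex.of_iso {T T' : C ⥤ E ⥤ D} (hT : IsBilinearRex k T) (i : T ≅ T') :
    IsBilinearRex k T' :=
  ⟨fun e => (hT.left e).of_iso (((flipFunctor C E D).mapIso i).app e),
    fun c => (hT.right c).of_iso (i.app c)⟩

theorem IsBilinearLex.of_iso {T T' : C ⥤ E ⥤ D} (hT : IsBilinearLex k T) (i : T ≅ T') :
    IsBilinearLex k T' :=
  ⟨fun e => (hT.left e).of_iso (((flipFunctor C E D).mapIso i).app e),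
    fun c => (hT.right c).of_iso (i.app c)⟩

end EndTensor

universe v₄ v₅ v₆ u₄ u₅ u₆

variable {C : Type u₁} [Category.{v₁} C] [Abelian C] [Linear k C]
  {E : Type u₂} [Category.{v₂} E] [Abelian E] [Linear k E]
  {D : Type u₃} [Category.{v₃} D] [Abelian D] [Linear k D]
  {C' : Type u₄} [Category.{v₄} C'] [Abelian C'] [Linear k C']
  {E' : Type u₅} [Category.{v₅} E'] [Abelian E'] [Linear k E']
  {D' : Type u₆} [Category.{v₆} D'] [Abelian D'] [Linear k D']

/-- The hypothesis of the recognition principle is invariant under equivalences of the three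
categories. -/
theorem PreservesProgenerators.transport {T : C ⥤ E ⥤ D} {P : C} {Q : E}
    (h : PreservesProgenerators k T P Q) {T' : C' ⥤ E' ⥤ D'}
    (F : C' ⥤ C) [F.IsEquivalence] [F.Additive] [F.Linear k]
    (G : E' ⥤ E) [G.IsEquivalence] [G.Additive] [G.Linear k]
    (H : D ⥤ D') [H.IsEquivalence] [H.Additive] [H.Linear k]
    (i : F ⋙ T ⋙ (Functor.whiskeringLeft E' E D).obj G ⋙ (Functor.whiskeringRight E' D D').obj H ≅
      T') : PreservesProgenerators k T' (F.inv.obj P) (G.inv.obj Q) := by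
  have hlex : IsBilinearLex k T' := by
    refine IsBilinearLex.of_iso ⟨fun e => ?_, fun c => ?_⟩ i
    · exact (IsLinearLex.of_isEquivalence F inferInstance inferInstance).comp
        ((h.lex.left (G.obj e)).comp (IsLinearLex.of_isEquivalence H inferInstance inferInstance))
    · exact (IsLinearLex.of_isEquivalence G inferInstance inferInstance).comp
        ((h.lex.right (F.obj c)).comp (IsLinearLex.of_isEquivalence H inferInstance inferInstance))
  have hrex : IsBilinearRex k T' := by
    refine IsBilinearRex.of_iso ⟨fun e => ?_, fun c => ?_⟩ i
    · exact (IsLinearRex.of_isEquivalence F inferInstance inferInstance).comp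
        ((h.rex.left (G.obj e)).comp (IsLinearRex.of_isEquivalence H inferInstance inferInstance))
    · exact (IsLinearRex.of_isEquivalence G inferInstance inferInstance).comp
        ((h.rex.right (F.obj c)).comp (IsLinearRex.of_isEquivalence H inferInstance inferInstance))
  have hF := additive_linear_inv (k := k) F
  have hG := additive_linear_inv (k := k) G
  have := hF.1
  have := hG.1
  let p : F.obj (F.inv.obj P) ≅ P := F.asEquivalence.counitIso.app P
  let q : G.obj (G.inv.obj Q) ≅ Q := G.asEquivalence.counitIso.app Q
  let j : H.obj ((T.obj P).obj Q) ≅ (T'.obj (F.inv.obj P)).obj (G.inv.obj Q) :=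
    H.mapIso ((T.obj P).mapIso q.symm ≪≫ (T.mapIso p.symm).app (G.obj (G.inv.obj Q))) ≪≫
      (i.app (F.inv.obj P)).app (G.inv.obj Q)
  refine ⟨hlex, hrex, h.left.of_equivalence F.inv (Iso.refl _),
    h.right.of_equivalence G.inv (Iso.refl _), h.tensor.of_equivalence H j,
    bijective_endTensor_of_equiv h.rex hrex h.bijective
      ((mapEndEquiv F _).trans (Linear.homCongr k p p))
      ((mapEndEquiv G _).trans (Linear.homCongr k q q))
      ((mapEndEquiv H _).trans (Linear.homCongr k j j)) fun f g => ?_⟩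
  have hi₁ := (i.hom.app (F.inv.obj P)).naturality g
  have hi₂ := congr_app (i.hom.naturality f) (G.inv.obj Q)
  dsimp at hi₁ hi₂
  have hT : ((T.obj P).map (q.inv ≫ G.map g ≫ q.hom) ≫ (T.map (p.inv ≫ F.map f ≫ p.hom)).app Q) ≫
      (T.obj P).map q.inv ≫ (T.map p.inv).app (G.obj (G.inv.obj Q)) =
      ((T.obj P).map q.inv ≫ (T.map p.inv).app (G.obj (G.inv.obj Q))) ≫
        (T.obj _).map (G.map g) ≫ (T.map (F.map f)).app _ := by
    simp only [Category.assoc, NatTrans.naturality, ← NatTrans.comp_app_assoc,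
      NatTrans.naturality_assoc, ← Functor.map_comp, Iso.hom_inv_id, Category.comp_id]
  have key : H.map ((T.obj P).map (q.inv ≫ G.map g ≫ q.hom) ≫
        (T.map (p.inv ≫ F.map f ≫ p.hom)).app Q) ≫ j.hom =
      j.hom ≫ (T'.obj (F.inv.obj P)).map g ≫ (T'.map f).app (G.inv.obj Q) := by
    simp only [j, Iso.trans_hom, Functor.mapIso_hom, Iso.symm_hom, Iso.app_hom, Category.assoc]
    rw [← reassoc_of% hi₁, ← hi₂, ← H.map_comp_assoc, hT]
    simp only [Functor.map_comp, Category.assoc]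
  have hj : j.inv ≫ H.map ((T.obj P).map (q.inv ≫ G.map g ≫ q.hom) ≫
      (T.map (p.inv ≫ F.map f ≫ p.hom)).app Q) ≫ j.hom =
      (T'.obj (F.inv.obj P)).map g ≫ (T'.map f).app (G.inv.obj Q) := by
    rw [key, Iso.inv_hom_id_assoc]
  change (j.inv ≫ H.map ((T.obj P).map ((q.inv ≫ G.map g) ≫ q.hom) ≫
    (T.map ((p.inv ≫ F.map f) ≫ p.hom)).app Q)) ≫ j.hom = _
  simpa only [Category.assoc] using hj

end Transport

/-! ### Progenerators and injective cogenerators of the module model -/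

section Model

variable (k : Type w) [Field k] (R S : Type w) [Ring R] [Algebra k R] [Ring S] [Algebra k S]

open TensorProduct

open scoped ModuleCat

attribute [local instance] fgModuleCat_finite Abelian.hasFiniteBiproducts

section Carrier

variable {R S} in
/-- The vector space underlying a module does not depend on whether the scalars act directly or
through the algebra. -/
def carrierEquiv {M : FGModuleCat.{w} R} {M' : Type w} [AddCommGroup M'] [Module k M'] [Module R M']
    [IsScalarTower k R M'] (e : M.obj ≃ₗ[R] M') : M.obj ≃ₗ[k] M' where
  toFun := e
  invFun := e.symm
  map_add' := map_add e
  map_smul' a m := (e.map_smul (algebraMap k R a) m).trans (algebraMap_smul R a (e m))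
  left_inv := e.left_inv
  right_inv := e.right_inv

variable {R S} in
theorem finrank_carrier {M : FGModuleCat.{w} R} {M' : Type w} [AddCommGroup M'] [Module k M']
    [Module R M'] [IsScalarTower k R M'] (e : M.obj ≃ₗ[R] M') :
    Module.finrank k M.obj = Module.finrank k M' :=
  (carrierEquiv k e).finrank_eq

theorem finrank_regular_hom (M : FGModuleCat.{w} R) :
    Module.finrank k (FGModuleCat.of R R ⟶ M) = Module.finrank k M.obj :=
  LinearEquiv.finrank_eq
    { toFun := fun f => f.hom.hom (1 : R)
      map_add' := fun _ _ => rfl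
      map_smul' := fun _ _ => rfl
      invFun := fun m => FGModuleCat.ofHom (LinearMap.toSpanSingleton R M.obj m)
      left_inv := fun _ => FGModuleCat.hom_ext (LinearMap.ext_ring (one_smul R _))
      right_inv := fun m => one_smul R m }

end Carrier

variable [Module.Finite k R] [Module.Finite k S]

variable {R S} in
/-- An outer tensor product is determined by its underlying vector space and the action of pure
tensors. -/
def outerTensorIso {M : FGModuleCat.{w} R} {N : FGModuleCat.{w} S}
    {M' : Type w} [AddCommGroup M'] [Module k M'] [Module R M'] [IsScalarTower k R M']
    {N' : Type w} [AddCommGroup N'] [Module k N'] [Module S N'] [IsScalarTower k S N']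
    (e : M.obj ≃ₗ[R] M') (f : N.obj ≃ₗ[S] N') {W : Type w} [AddCommGroup W]
    [Module k W] [Module (R ⊗[k] S) W] [Module.Finite (R ⊗[k] S) W]
    (φ : (M' ⊗[k] N') ≃ₗ[k] W)
    (h : ∀ (r : R) (s : S) (m : M') (n : N'),
      φ ((r • m) ⊗ₜ[k] (s • n)) = (r ⊗ₜ[k] s) • φ (m ⊗ₜ[k] n)) :
    ((outerTensor k R S).obj M).obj N ≅ FGModuleCat.of (R ⊗[k] S) W :=
  let ψ : OuterTensor k R S M.obj N.obj ≃ₗ[k] W :=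
    (TensorProduct.congr (carrierEquiv k e) (carrierEquiv k f)).trans φ
  LinearEquiv.toFGModuleCatIso (V := OuterTensor k R S M.obj N.obj)
    (LinearEquiv.ofBijective (outerLift ψ.toLinearMap fun r s m n =>
      (congrArg₂ (fun x y => φ (x ⊗ₜ[k] y)) (map_smul e r m) (map_smul f s n)).trans
        (h r s (e m) (f n))) ψ.bijective)

/-- The outer tensor product of regular modules is regular. -/
def outerTensorRegularIso : ((outerTensor k R S).obj (FGModuleCat.of R R)).obj
    (FGModuleCat.of S S) ≅ FGModuleCat.of (R ⊗[k] S) (R ⊗[k] S) :=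
  outerTensorIso k (M := FGModuleCat.of R R) (N := FGModuleCat.of S S)
    (LinearEquiv.refl R R) (LinearEquiv.refl S S) (LinearEquiv.refl k (R ⊗[k] S))
    fun r s m n => (Algebra.TensorProduct.tmul_mul_tmul r m s n).symm

/-- The outer tensor product of coregular modules is coregular. -/
def outerTensorCoregularIso : ((outerTensor k R S).obj (FGModuleCat.of R (Coregular k R))).obj
    (FGModuleCat.of S (Coregular k S)) ≅
      FGModuleCat.of (R ⊗[k] S) (Coregular k (R ⊗[k] S)) :=
  outerTensorIso k (M := FGModuleCat.of R (Coregular k R)) (N := FGModuleCat.of S (Coregular k S))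
    (LinearEquiv.refl R (Coregular k R)) (LinearEquiv.refl S (Coregular k S))
    (show (Coregular k R ⊗[k] Coregular k S) ≃ₗ[k] Coregular k (R ⊗[k] S) from
      TensorProduct.dualDistribEquiv k R S)
    fun r s ξ η => TensorProduct.ext' fun x y =>
      (congrArg (TensorProduct.dualDistrib k R S (ξ ⊗ₜ[k] η))
        (Algebra.TensorProduct.tmul_mul_tmul x r y s)).symm

/-- `Hom(M, R^*)` is the dual of `M`. -/
theorem finrank_hom_coregular (M : FGModuleCat.{w} R) :
    Module.finrank k (M ⟶ FGModuleCat.of R (Coregular k R)) = Module.finrank k M.obj := by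
  refine Eq.trans (LinearEquiv.finrank_eq (N := Module.Dual k M.obj)
    { toFun := fun f =>
        { toFun := fun m => (show Module.Dual k R from f.hom.hom m) 1
          map_add' := fun m m' => by rw [map_add]; rfl
          map_smul' := fun a m => ?_ }
      map_add' := fun _ _ => rfl
      map_smul' := fun a f => LinearMap.ext fun m => ?_
      invFun := fun ξ => toCoregular k ξ
      left_inv := fun f => FGModuleCat.hom_ext (LinearMap.ext fun m => LinearMap.ext fun r => ?_)
      right_inv := fun ξ => LinearMap.ext fun m => ?_ }) (Subspace.dual_finrank_eq)
  · rw [← algebraMap_smul R a m, map_smul, ← map_smul (show Module.Dual k R from f.hom.hom m)]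
    exact congrArg (show Module.Dual k R from f.hom.hom m)
      ((one_mul (algebraMap k R a)).trans (Algebra.algebraMap_eq_smul_one a))
  · change (show Module.Dual k R from f.hom.hom m) (1 * algebraMap k R a) = _
    rw [one_mul, Algebra.algebraMap_eq_smul_one, map_smul]
    rfl
  · change (show Module.Dual k R from f.hom.hom (r • m)) 1 = _
    rw [map_smul]
    exact congrArg (show Module.Dual k R from f.hom.hom m) (one_mul r)
  · exact congrArg ξ (one_smul R m)

variable {R S} in
/-- `End M ⊗ End N → End (M ⊗ N)` is injective, as a restriction of the corresponding map for
endomorphisms of vector spaces. -/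
theorem endTensor_outerTensor_injective (M : FGModuleCat.{w} R) (N : FGModuleCat.{w} S) :
    Function.Injective (endTensor (outerTensor_isBilinear k R S).2 M N) := by
  let u {R : Type w} [Ring R] [Algebra k R] (M : FGModuleCat.{w} R) :
      End M →ₗ[k] (M.obj →ₗ[k] M.obj) :=
    { toFun := fun f => (show M ⟶ M from f).hom.hom.restrictScalars k
      map_add' := fun _ _ => rfl
      map_smul' := fun _ _ => rfl }
  have hu {R : Type w} [Ring R] [Algebra k R] (M : FGModuleCat.{w} R) :
      Function.Injective (u M) := fun f g h =>
    FGModuleCat.hom_ext (LinearMap.ext fun m => LinearMap.congr_fun h m)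
  let t : End (((outerTensor k R S).obj M).obj N) →
      ((M.obj ⊗[k] N.obj) →+ (M.obj ⊗[k] N.obj)) := fun f =>
    (show ((outerTensor k R S).obj M).obj N ⟶ _ from f).hom.hom.toAddMonoidHom
  have h : ∀ x, t (endTensor (outerTensor_isBilinear k R S).2 M N x) =
      (homTensorHomMap (RingHom.id k) M.obj N.obj M.obj N.obj
        (TensorProduct.map (u M) (u N) x)).toAddMonoidHom := by
    intro x
    induction x with
    | zero => rw [map_zero, map_zero, map_zero]; rfl
    | add x y hx hy =>
      rw [map_add, map_add, map_add]
      exact congrArg₂ (· + ·) hx hy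
    | tmul f g =>
      rw [endTensor_tmul]
      refine AddMonoidHom.ext fun x => ?_
      induction x with
      | zero => rw [map_zero, map_zero]
      | add x y hx hy => rw [map_add, map_add, hx, hy]
      | tmul m n => rfl
  intro x y hxy
  have hinj : Function.Injective (homTensorHomMap (RingHom.id k) M.obj N.obj M.obj N.obj) := by
    rw [← homTensorHomEquiv_toLinearMap]
    exact (homTensorHomEquiv k M.obj N.obj M.obj N.obj).injective
  refine TensorProduct.map_injective_of_flat_flat (u M) (u N) (hu M) (hu N) (hinj ?_)
  refine LinearMap.toAddMonoidHom_injective ?_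
  rw [← h, ← h, hxy]

variable {R S} in
/-- `End M ⊗ End N → End (M ⊗ N)` is bijective if the dimensions of `End M`, `End N` and
`End (M ⊗ N)` are those of `R`, `S` and `R ⊗ S`, as for regular and for coregular modules. -/
theorem endTensor_outerTensor_bijective {M : FGModuleCat.{w} R} {N : FGModuleCat.{w} S}
    (hM : Module.finrank k (M ⟶ M) = Module.finrank k R)
    (hN : Module.finrank k (N ⟶ N) = Module.finrank k S)
    {W : FGModuleCat.{w} (R ⊗[k] S)} (i : ((outerTensor k R S).obj M).obj N ≅ W)
    (hW : Module.finrank k (W ⟶ W) = Module.finrank k (R ⊗[k] S)) :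
    Function.Bijective (endTensor (outerTensor_isBilinear k R S).2 M N) := by
  have h₁ := endTensor_outerTensor_injective k M N
  have : Module.Finite k (End M) := finite_hom_fgModuleCat k R M M
  have : Module.Finite k (End N) := finite_hom_fgModuleCat k S N N
  have : Module.Finite k (End (((outerTensor k R S).obj M).obj N)) :=
    finite_hom_fgModuleCat k (R ⊗[k] S) _ _
  refine ⟨h₁, (LinearMap.injective_iff_surjective_of_finrank_eq_finrank
    (f := (endTensor (outerTensor_isBilinear k R S).2 M N).toLinearMap) ?_).1 h₁⟩
  have h₂ : Module.finrank k (End (((outerTensor k R S).obj M).obj N)) =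
      Module.finrank k (W ⟶ W) := (Linear.homCongr k i i).finrank_eq
  have hM' : Module.finrank k (End M) = Module.finrank k R := hM
  have hN' : Module.finrank k (End N) = Module.finrank k S := hN
  rw [h₂, hW, Module.finrank_tensorProduct, Module.finrank_tensorProduct, hM', hN']

variable [IsNoetherianRing R] [IsNoetherianRing S] [IsNoetherianRing (R ⊗[k] S)]

/-- The outer tensor product preserves the regular progenerators. -/
theorem preservesProgenerators_outerTensor :
    PreservesProgenerators k (outerTensor k R S) (FGModuleCat.of R R) (FGModuleCat.of S S) := by
  exact ⟨(outerTensor_isBilinear k R S).1, (outerTensor_isBilinear k R S).2,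
    isProgenerator_regular, isProgenerator_regular,
    isProgenerator_regular.of_equivalence (𝟭 _) (outerTensorRegularIso k R S).symm,
    endTensor_outerTensor_bijective k
      ((finrank_regular_hom k R _).trans
        (finrank_carrier k (M := FGModuleCat.of R R) (LinearEquiv.refl R R)))
      ((finrank_regular_hom k S _).trans
        (finrank_carrier k (M := FGModuleCat.of S S) (LinearEquiv.refl S S)))
      (outerTensorRegularIso k R S)
      ((finrank_regular_hom k _ _).trans
        (finrank_carrier k (M := FGModuleCat.of (R ⊗[k] S) (R ⊗[k] S))
          (LinearEquiv.refl (R ⊗[k] S) (R ⊗[k] S))))⟩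

/-- The opposite of the outer tensor product preserves the coregular progenerators. -/
theorem preservesProgenerators_op_outerTensor :
    PreservesProgenerators k (opBifunctor (outerTensor k R S))
      (op (FGModuleCat.of R (Coregular k R))) (op (FGModuleCat.of S (Coregular k S))) := by
  have hf (R : Type w) [Ring R] [Algebra k R] [Module.Finite k R] :
      Module.finrank k (FGModuleCat.of R (Coregular k R) ⟶ FGModuleCat.of R (Coregular k R)) =
        Module.finrank k R :=
    (finrank_hom_coregular k R _).trans ((finrank_carrier k (M := FGModuleCat.of R (Coregular k R))
      (LinearEquiv.refl R (Coregular k R))).trans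
      Subspace.dual_finrank_eq)
  exact ⟨(outerTensor_isBilinear k R S).2.op, (outerTensor_isBilinear k R S).1.op,
    isProgenerator_op_coregular k, isProgenerator_op_coregular k,
    (isProgenerator_op_coregular k).of_equivalence (𝟭 _) (outerTensorCoregularIso k R S).op,
    bijective_endTensor_op (outerTensor_isBilinear k R S).2 (outerTensor_isBilinear k R S).1
      (endTensor_outerTensor_bijective k (hf R) (hf S)
      (outerTensorCoregularIso k R S) (hf (R ⊗[k] S)))⟩

end Model

/-! ### Existence, uniqueness and duality of Deligne products -/

section Model

variable (k : Type w) [Field k] (C : Type u₁) [Category.{v₁} C] [Abelian C] [Linear k C]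
  [IsFiniteLinear k C] (E : Type u₂) [Category.{v₂} E] [Abelian E] [Linear k E]
  [IsFiniteLinear k E]

open TensorProduct in
/-- The outer tensor product of modules is a biexact bilinear functor to which the recognition
principle for Deligne products applies, in both its direct and its dual form. -/
theorem exists_preservesProgenerators :
    ∃ (D : Type (w + 1)) (_ : Category.{w} D) (_ : Abelian D) (_ : Linear k D)
      (T : C ⥤ E ⥤ D), IsFiniteLinear k D ∧ (∃ P Q, PreservesProgenerators k T P Q) ∧
        ∃ P Q, PreservesProgenerators k (opBifunctor T) P Q := by
  obtain ⟨R, _, _, _, F, _, _, _⟩ := IsFiniteLinear.exists_equivalence (k := k) (C := C)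
  obtain ⟨S, _, _, _, G, _, _, _⟩ := IsFiniteLinear.exists_equivalence (k := k) (C := E)
  have : IsNoetherianRing R := isNoetherian_of_tower k inferInstance
  have : IsNoetherianRing S := isNoetherian_of_tower k inferInstance
  have : IsNoetherianRing (R ⊗[k] S) := isNoetherian_of_tower k inferInstance
  have : F.op.Linear k := ⟨fun f a => congrArg Quiver.Hom.op (F.map_smul a f.unop)⟩
  have : G.op.Linear k := ⟨fun f a => congrArg Quiver.Hom.op (G.map_smul a f.unop)⟩
  refine ⟨FGModuleCat.{w} (R ⊗[k] S), inferInstance, inferInstance, inferInstance,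
    F ⋙ outerTensor k R S ⋙ (Functor.whiskeringLeft _ _ _).obj G,
    ⟨R ⊗[k] S, inferInstance, inferInstance, inferInstance, 𝟭 _, inferInstance, inferInstance,
      inferInstance⟩, ⟨_, _, (preservesProgenerators_outerTensor k R S).transport F G (𝟭 _) ?_⟩,
    ⟨_, _, (preservesProgenerators_op_outerTensor k R S).transport F.op G.op (𝟭 _) ?_⟩⟩
  · exact NatIso.ofComponents fun c => NatIso.ofComponents fun e => Iso.refl _
  · exact NatIso.ofComponents fun c => NatIso.ofComponents fun e => Iso.refl _

end Model

section Universal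

variable {k : Type w} [Field k] {C : Type u₁} [Category.{v₁} C] [Preadditive C] [Linear k C]
  {E : Type u₂} [Category.{v₂} E] [Preadditive E] [Linear k E]
  {D : Type (w + 1)} [Category.{w} D] [Abelian D] [Linear k D] {T : C ⥤ E ⥤ D}

/-- A right exact functor on a Deligne product is determined by its restriction along `T`. -/
theorem IsDeligneProduct.nonempty_iso (hT : IsDeligneProduct k T) {X : Type (w + 1)}
    [Category.{w} X] [Abelian X] [Linear k X] {F F' : D ⥤ X} (hF : IsLinearRex k F)
    (hF' : IsLinearRex k F') (i : postcomp T F ≅ postcomp T F') : Nonempty (F ≅ F') := by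
  obtain ⟨τ, hτ⟩ := (hT.bijective X F F' hF hF').2 i.hom
  obtain ⟨σ, hσ⟩ := (hT.bijective X F' F hF' hF).2 i.inv
  refine ⟨⟨τ, σ, (hT.bijective X F F hF hF).1 ?_, (hT.bijective X F' F' hF' hF').1 ?_⟩⟩
  · dsimp only at hτ hσ ⊢
    rw [Functor.map_comp, Functor.whiskerLeft_comp, hτ, hσ, i.hom_inv_id]
    rfl
  · dsimp only at hτ hσ ⊢
    rw [Functor.map_comp, Functor.whiskerLeft_comp, hτ, hσ, i.inv_hom_id]
    rfl

/-- A Deligne product is unique up to a linear equivalence. -/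
theorem IsDeligneProduct.exists_equivalence (hT : IsDeligneProduct k T) {D' : Type (w + 1)}
    [Category.{w} D'] [Abelian D'] [Linear k D'] {T' : C ⥤ E ⥤ D'} (hT' : IsDeligneProduct k T') :
    ∃ H : D ⥤ D', H.IsEquivalence ∧ H.Additive ∧ H.Linear k ∧ Nonempty (postcomp T H ≅ T') := by
  obtain ⟨H, hH, ⟨i⟩⟩ := hT.fac D' T' hT'.rex
  obtain ⟨H', hH', ⟨i'⟩⟩ := hT'.fac D T hT.rex
  obtain ⟨α⟩ := hT.nonempty_iso (F := 𝟭 D) (F' := H ⋙ H')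
    ⟨inferInstance, inferInstance, inferInstance⟩ (hH.comp hH')
    (i'.symm ≪≫ Functor.isoWhiskerRight i.symm ((Functor.whiskeringRight _ _ _).obj H'))
  obtain ⟨β⟩ := hT'.nonempty_iso (F := H' ⋙ H) (F' := 𝟭 D') (hH'.comp hH)
    ⟨inferInstance, inferInstance, inferInstance⟩
    (Functor.isoWhiskerRight i' ((Functor.whiskeringRight _ _ _).obj H) ≪≫ i)
  exact ⟨H, (CategoryTheory.Equivalence.mk H H' α β).isEquivalence_functor, hH.additive, hH.linear,
    ⟨i⟩⟩

/-- If the opposite of `T` is a Deligne product, then `T` determines left exact functors. -/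
theorem IsDeligneProduct.nonempty_iso_of_op (hT : IsDeligneProduct k (opBifunctor T))
    {X : Type (w + 1)} [Category.{w} X] [Abelian X] [Linear k X] {F F' : D ⥤ X}
    (hF : IsLinearLex k F) (hF' : IsLinearLex k F') (i : postcomp T F ≅ postcomp T F') :
    Nonempty (F ≅ F') := by
  obtain ⟨j⟩ := hT.nonempty_iso (X := Xᵒᵖ) hF'.op hF.op <| NatIso.ofComponents
    (fun c => NatIso.ofComponents (fun e => ((i.app c.unop).app e.unop).op)
      fun {e e'} g => Quiver.Hom.unop_inj ((i.hom.app c.unop).naturality g.unop).symm)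
    fun {c c'} f => NatTrans.ext (funext fun e =>
      Quiver.Hom.unop_inj (congr_app (i.hom.naturality f.unop) e.unop).symm)
  exact ⟨NatIso.removeOp j⟩

end Universal

section Dual

variable {k : Type w} [Field k] {C : Type u₁} [Category.{v₁} C] [Abelian C] [Linear k C]
  {E : Type u₂} [Category.{v₂} E] [Abelian E] [Linear k E]
  {D : Type (w + 1)} [Category.{w} D] [Abelian D] [Linear k D] {T : C ⥤ E ⥤ D}

/-- A Deligne product of finite linear categories is finite, and its opposite is a Deligne product
of the opposite categories. -/
theorem IsDeligneProduct.isFiniteLinear_and_op [IsFiniteLinear k C] [IsFiniteLinear k E]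
    (hT : IsDeligneProduct k T) :
    IsFiniteLinear k D ∧ IsDeligneProduct k (opBifunctor T) := by
  obtain ⟨D₀, _, _, _, T₀, _, ⟨P, Q, h⟩, ⟨P', Q', h'⟩⟩ := exists_preservesProgenerators k C E
  obtain ⟨H, _, _, _, ⟨i⟩⟩ := h.isDeligneProduct.exists_equivalence hT
  obtain ⟨_, _⟩ := additive_linear_inv (k := k) H
  have : H.op.Linear k := ⟨fun f a => congrArg Quiver.Hom.op (H.map_smul a f.unop)⟩
  refine ⟨IsFiniteLinear.of_isEquivalence H.inv,
    (h'.transport (𝟭 _) (𝟭 _) H.op ?_).isDeligneProduct⟩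
  exact NatIso.ofComponents
    (fun c => NatIso.ofComponents (fun e => ((i.app c.unop).app e.unop).symm.op)
      fun {e e'} g => Quiver.Hom.unop_inj ((i.inv.app c.unop).naturality g.unop).symm)
    fun {c c'} f => NatTrans.ext (funext fun e =>
      Quiver.Hom.unop_inj (congr_app (i.inv.naturality f.unop) e.unop).symm)

end Dual

/-! ### The two universal properties of `V ⊗ c` -/

section VecTensor

variable (k : Type w) [Field k] {C : Type u} [Category.{v} C] [Preadditive C] [Linear k C]
  [HasFiniteBiproducts C]

/-- The inclusion of a summand `c` of `V ⊗ c`. -/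
def vecι (V : FGModuleCat.{v₁} k) (c : C) (i : Fin (Module.finrank k V)) :
    c ⟶ ((vecTensor k C).obj V).obj c :=
  biproduct.ι (fun _ => c) i

/-- The projection to a summand `c` of `V ⊗ c`. -/
def vecπ (V : FGModuleCat.{v₁} k) (c : C) (i : Fin (Module.finrank k V)) :
    ((vecTensor k C).obj V).obj c ⟶ c :=
  biproduct.π (fun _ => c) i

/-- The morphism `c ⟶ V ⊗ c` given by a vector of `V`. -/
def coev (V : FGModuleCat.{v₁} k) (c : C) : V.obj →ₗ[k] (c ⟶ ((vecTensor k C).obj V).obj c) :=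
  (Module.finBasis k V).constr k (vecι k V c)

variable {k}

theorem coev_apply (V : FGModuleCat.{v₁} k) (c : C) (v : V.obj) :
    coev k V c v = ∑ i, (Module.finBasis k V).repr v i • vecι k V c i :=
  Module.Basis.constr_apply_fintype _ _ _ _

theorem coev_basis (V : FGModuleCat.{v₁} k) (c : C) (i) :
    coev k V c (Module.finBasis k V i) = vecι k V c i :=
  Module.Basis.constr_basis _ _ _ _

theorem coev_vecπ (V : FGModuleCat.{v₁} k) (c : C) (v : V.obj) (i) :
    coev k V c v ≫ vecπ k V c i = (Module.finBasis k V).repr v i • 𝟙 c := by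
  rw [coev_apply, Preadditive.sum_comp,
    Finset.sum_eq_single i (fun j _ hj => ?_) (by simp), Linear.smul_comp]
  · exact congrArg (_ • ·) (biproduct.ι_π_self (fun _ => c) i)
  · rw [Linear.smul_comp]
    exact (congrArg (_ • ·) (biproduct.ι_π_ne (fun _ => c) hj)).trans (smul_zero _)

/-- The morphism `V ⊗ c ⟶ d` given by a linear family of morphisms `c ⟶ d`. -/
def vecDesc {V : FGModuleCat.{v₁} k} {c d : C} (φ : V.obj →ₗ[k] (c ⟶ d)) :
    ((vecTensor k C).obj V).obj c ⟶ d :=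
  biproduct.desc fun i => φ (Module.finBasis k V i)

theorem coev_vecDesc {V : FGModuleCat.{v₁} k} {c d : C} (φ : V.obj →ₗ[k] (c ⟶ d)) (v : V.obj) :
    coev k V c v ≫ vecDesc φ = φ v := by
  conv_rhs => rw [← (Module.finBasis k V).sum_repr v, map_sum]
  rw [coev_apply, Preadditive.sum_comp]
  refine Finset.sum_congr rfl fun i _ => ?_
  rw [Linear.smul_comp, map_smul]
  exact congrArg (_ • ·) (biproduct.ι_desc _ i)

/-- Morphisms out of `V ⊗ c` are determined by their composites with the morphisms `c ⟶ V ⊗ c`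
given by vectors of `V`. -/
theorem vecTensor_hom_ext {V : FGModuleCat.{v₁} k} {c d : C}
    {f g : ((vecTensor k C).obj V).obj c ⟶ d} (h : ∀ v, coev k V c v ≫ f = coev k V c v ≫ g) :
    f = g :=
  biproduct.hom_ext' _ _ fun i => by
    change vecι k V c i ≫ f = vecι k V c i ≫ g
    rw [← coev_basis]
    exact h _

theorem coev_map (V : FGModuleCat.{v₁} k) {c d : C} (f : c ⟶ d) (v : V.obj) :
    coev k V c v ≫ ((vecTensor k C).obj V).map f = f ≫ coev k V d v := by
  rw [coev_apply, coev_apply, Preadditive.sum_comp, Preadditive.comp_sum]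
  refine Finset.sum_congr rfl fun i _ => ?_
  rw [Linear.smul_comp, Linear.comp_smul]
  exact congrArg (_ • ·) (biproduct.ι_map (fun _ => f) i)

theorem coev_map_app {V W : FGModuleCat.{v₁} k} (f : V ⟶ W) (c : C) (v : V.obj) :
    coev k V c v ≫ ((vecTensor k C).map f).app c = coev k W c (f.hom.hom v) := by
  have h : (Linear.rightComp k c (((vecTensor k C).map f).app c)) ∘ₗ coev k V c =
      coev k W c ∘ₗ f.hom.hom := by
    refine (Module.finBasis k V).ext fun i => ?_
    refine biproduct.hom_ext _ _ fun j => ?_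
    refine Eq.trans ?_ (coev_vecπ W c (f.hom.hom (Module.finBasis k V i)) j).symm
    rw [LinearMap.comp_apply, coev_basis]
    refine (Category.assoc _ _ _).trans ((_ ≫= biproduct.matrix_π _ j).trans ?_)
    refine (biproduct.ι_desc _ i).trans ?_
    rw [LinearMap.toMatrix_apply]
  exact LinearMap.congr_fun h v

/-- The morphism `V ⊗ c ⟶ c` given by a linear functional on `V`. -/
def contract {V : FGModuleCat.{v₁} k} (φ : Module.Dual k V.obj) (c : C) :
    ((vecTensor k C).obj V).obj c ⟶ c :=
  vecDesc (φ.smulRight (𝟙 c))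

theorem coev_contract {V : FGModuleCat.{v₁} k} (φ : Module.Dual k V.obj) (c : C) (v : V.obj) :
    coev k V c v ≫ contract φ c = φ v • 𝟙 c :=
  coev_vecDesc _ v

theorem map_contract {V : FGModuleCat.{v₁} k} (φ : Module.Dual k V.obj) {c d : C} (f : c ⟶ d) :
    ((vecTensor k C).obj V).map f ≫ contract φ d = contract φ c ≫ f :=
  vecTensor_hom_ext fun v => by
    rw [reassoc_of% (coev_map V f v), coev_contract, reassoc_of% (coev_contract φ c v),
      Linear.comp_smul, Linear.smul_comp, Category.id_comp, Category.comp_id]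

theorem map_app_contract {V W : FGModuleCat.{v₁} k} (f : V ⟶ W) (φ : Module.Dual k W.obj) (c : C) :
    ((vecTensor k C).map f).app c ≫ contract φ c = contract (φ.comp f.hom.hom) c :=
  vecTensor_hom_ext fun v => by
    rw [reassoc_of% (coev_map_app f c v), coev_contract, coev_contract]
    rfl

theorem contract_coord (V : FGModuleCat.{v₁} k) (c : C) (i) :
    contract ((Module.finBasis k V).coord i) c =
      vecπ k V c i :=
  vecTensor_hom_ext fun v => by
    rw [coev_contract]
    exact (coev_vecπ V c v i).symm

/-- Morphisms into `V ⊗ c` are determined by their contractions with linear functionals on `V`. -/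
theorem vecTensor_hom_ext' {V : FGModuleCat.{v₁} k} {c d : C}
    {f g : d ⟶ ((vecTensor k C).obj V).obj c}
    (h : ∀ φ : Module.Dual k V.obj, f ≫ contract φ c = g ≫ contract φ c) : f = g :=
  biproduct.hom_ext _ _ fun i => by
    change f ≫ vecπ k V c i = g ≫ vecπ k V c i
    rw [← contract_coord]
    exact h _

/-- The morphism `c ⟶ V ⊗ d` given by a family of morphisms `c ⟶ d` depending linearly on a linear
functional on `V`. -/
def vecLift {V : FGModuleCat.{v₁} k} {c d : C} (ψ : Module.Dual k V.obj →ₗ[k] (c ⟶ d)) :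
    c ⟶ ((vecTensor k C).obj V).obj d :=
  biproduct.lift fun i => ψ ((Module.finBasis k V).coord i)

theorem vecLift_contract {V : FGModuleCat.{v₁} k} {c d : C}
    (ψ : Module.Dual k V.obj →ₗ[k] (c ⟶ d)) (φ : Module.Dual k V.obj) :
    vecLift ψ ≫ contract φ d = ψ φ := by
  refine biproduct.lift_desc.trans ?_
  conv_rhs => rw [← (Module.finBasis k V).sum_dual_apply_smul_coord φ, map_sum]
  simp

/-- Morphisms `c ⟶ V ⊗ d` are elements of `V ⊗ Hom(c, d)`. -/
theorem bijective_sum_comp_coev (V : FGModuleCat.{v₁} k) {c d : C} {n : ℕ}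
    (b : Module.Basis (Fin n) k (c ⟶ d)) :
    Function.Bijective (fun v : Fin n → V.obj => ∑ j, b j ≫ coev k V d (v j)) := by
  have key (v : Fin n → V.obj) (φ : Module.Dual k V.obj) :
      (∑ j, b j ≫ coev k V d (v j)) ≫ contract φ d = b.equivFun.symm fun j => φ (v j) := by
    simp [Preadditive.sum_comp, coev_contract, Module.Basis.equivFun_symm_apply]
  refine ⟨fun v v' h => funext fun j => ?_, fun t => ?_⟩
  · refine Module.eval_apply_injective k (LinearMap.ext fun φ => ?_)
    have := congrArg (· ≫ contract φ d) h
    dsimp only at this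
    rw [key, key] at this
    exact congrFun (b.equivFun.symm.injective this) j
  · let χ : Module.Dual k V.obj →ₗ[k] (c ⟶ d) :=
      { toFun := fun φ => t ≫ contract φ d
        map_add' := fun φ φ' => by
          rw [← Preadditive.comp_add]
          congr 1
          exact vecTensor_hom_ext fun v => by
            rw [Preadditive.comp_add, coev_contract, coev_contract, coev_contract, ← add_smul]
            rfl
        map_smul' := fun a φ => by
          rw [RingHom.id_apply, ← Linear.comp_smul]
          congr 1
          exact vecTensor_hom_ext fun v => by
            rw [Linear.comp_smul, coev_contract, coev_contract, smul_smul]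
            rfl }
    refine ⟨fun j => (Module.evalEquiv k V.obj).symm (b.coord j ∘ₗ χ), ?_⟩
    refine vecTensor_hom_ext' fun φ => (key _ φ).trans ?_
    change _ = χ φ
    rw [LinearEquiv.symm_apply_eq]
    funext j
    rw [Module.apply_evalEquiv_symm_apply]
    rfl

/-- Morphisms `V ⊗ c ⟶ d` are elements of `V^* ⊗ Hom(c, d)`. -/
theorem bijective_sum_contract_comp (V : FGModuleCat.{v₁} k) {c d : C} {n : ℕ}
    (b : Module.Basis (Fin n) k (c ⟶ d)) :
    Function.Bijective
      (fun φ : Fin n → Module.Dual k V.obj => ∑ j, contract (φ j) c ≫ b j) := by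
  have key (φ : Fin n → Module.Dual k V.obj) (v : V.obj) :
      coev k V c v ≫ (∑ j, contract (φ j) c ≫ b j) = b.equivFun.symm fun j => φ j v := by
    simp [Preadditive.comp_sum, reassoc_of% (fun j => coev_contract (φ j) c v),
      Module.Basis.equivFun_symm_apply]
  refine ⟨fun φ φ' h => funext fun j => LinearMap.ext fun v => ?_, fun t => ?_⟩
  · have := congrArg (coev k V c v ≫ ·) h
    dsimp only at this
    rw [key, key] at this
    exact congrFun (b.equivFun.symm.injective this) j
  · refine ⟨fun j => b.coord j ∘ₗ (Linear.rightComp k c t) ∘ₗ coev k V c, ?_⟩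
    refine vecTensor_hom_ext fun v => (key _ v).trans ?_
    rw [LinearEquiv.symm_apply_eq]
    rfl

end VecTensor

/-! ### Exactness of the Hom functors -/

section HomExact

variable (k : Type w) [Field k] {C : Type u} [Category.{v} C] [Preadditive C] [Linear k C]

section Equiv

variable [HasFiniteBiproducts C]

/-- Linear maps `V → Hom(c, d)` are morphisms `V ⊗ c ⟶ d`. -/
def homVecEquiv (V : FGModuleCat.{v₁} k) (c d : C) :
    (V.obj →ₗ[k] (c ⟶ d)) ≃ (((vecTensor k C).obj V).obj c ⟶ d) where
  toFun := vecDesc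
  invFun t := Linear.rightComp k c t ∘ₗ coev k V c
  left_inv φ := LinearMap.ext fun v => coev_vecDesc φ v
  right_inv _ := vecTensor_hom_ext fun v => coev_vecDesc _ v

/-- Linear maps `V → Hom(c, d)` are morphisms `c ⟶ V^* ⊗ d`. -/
def homDualVecEquiv (V : FGModuleCat.{v₁} k) (c d : C) : (V.obj →ₗ[k] (c ⟶ d)) ≃
    (c ⟶ ((vecTensor k C).obj (FGModuleCat.of k (Module.Dual k V.obj))).obj d) where
  toFun ψ := vecLift (V := FGModuleCat.of k (Module.Dual k V.obj))
    (ψ ∘ₗ (Module.evalEquiv k V.obj).symm.toLinearMap)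
  invFun t :=
    { toFun := fun v => t ≫ contract (V := FGModuleCat.of k (Module.Dual k V.obj))
        (Module.Dual.eval k V.obj v) d
      map_add' := fun v v' => by
        rw [← Preadditive.comp_add]
        congr 1
        refine vecTensor_hom_ext fun x => ?_
        rw [Preadditive.comp_add, coev_contract, coev_contract, coev_contract, ← add_smul, map_add]
        rfl
      map_smul' := fun a v => by
        rw [RingHom.id_apply, ← Linear.comp_smul]
        congr 1
        refine vecTensor_hom_ext fun x => ?_
        rw [Linear.comp_smul, coev_contract, coev_contract, smul_smul, map_smul]
        rfl }
  left_inv ψ := LinearMap.ext fun v => (vecLift_contract _ _).trans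
    (congrArg ψ ((Module.evalEquiv k V.obj).symm_apply_apply v))
  right_inv t := vecTensor_hom_ext' fun φ => (vecLift_contract _ _).trans
    (congrArg (fun x => t ≫ contract (V := FGModuleCat.of k (Module.Dual k V.obj)) x d)
      ((Module.evalEquiv k V.obj).apply_symm_apply φ))

end Equiv

variable [IsFiniteLinear k C]

/-- `Hom(c, -)` is left exact as a functor to vector spaces: linear maps `V → Hom(c, x)` are
morphisms `V ⊗ c ⟶ x`. -/
theorem isLinearLex_homFunctor (c : Cᵒᵖ) : IsLinearLex k ((homFunctor k C).obj c) := by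
  have := hasFiniteBiproducts k (C := C)
  refine ⟨⟨fun {x y f g} => FGModuleCat.hom_ext
      (LinearMap.ext fun h => Preadditive.comp_add _ _ _ h f g)⟩,
    ⟨fun {x y} f a => FGModuleCat.hom_ext (LinearMap.ext fun h => Linear.comp_smul _ _ _ h a f)⟩,
    preservesFiniteLimits_of_equiv _
      (fun V => coyoneda.obj (op (((vecTensor k C).obj V).obj c.unop)))
      (fun V x => ⟨fun f => homVecEquiv k V c.unop x f.hom.hom, fun t => FGModuleCat.ofHom
        ((homVecEquiv k V c.unop x).symm t), fun f => ?_, fun t => ?_⟩)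
      fun V x y f h => vecTensor_hom_ext fun v => ?_⟩
  · exact FGModuleCat.hom_ext ((homVecEquiv k V c.unop x).symm_apply_apply f.hom.hom)
  · exact (homVecEquiv k V c.unop x).apply_symm_apply t
  · refine (coev_vecDesc _ v).trans ?_
    exact ((reassoc_of% (coev_vecDesc h.hom.hom v)) f).symm

/-- The functor `c ↦ Hom(c, d)`, with values in the opposite of vector spaces. -/
abbrev homYoneda (d : C) : C ⥤ (FGModuleCat.{v} k)ᵒᵖ := ((homFunctor k C).flip.obj d).rightOp

/-- `Hom(-, d)` takes finite colimits to limits of vector spaces: linear maps `V → Hom(c, d)` are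
morphisms `c ⟶ V^* ⊗ d`. -/
theorem isLinearRex_homYoneda (d : C) : IsLinearRex k (homYoneda k d) := by
  have := hasFiniteBiproducts k (C := C)
  refine ⟨⟨fun {x y f g} => Quiver.Hom.unop_inj (FGModuleCat.hom_ext
      (LinearMap.ext fun h => Preadditive.add_comp _ _ _ f g h))⟩,
    ⟨fun {x y} f a => Quiver.Hom.unop_inj (FGModuleCat.hom_ext
      (LinearMap.ext fun h => Linear.smul_comp _ _ _ a f h))⟩,
    preservesFiniteColimits_of_equiv _
      (fun V => yoneda.obj (((vecTensor k C).obj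
        (FGModuleCat.of k (Module.Dual k V.unop.obj))).obj d))
      (fun V c => ⟨fun f => homDualVecEquiv k V.unop c d f.unop.hom.hom, fun t =>
        (FGModuleCat.ofHom ((homDualVecEquiv k V.unop c d).symm t)).op, fun f => ?_, fun t => ?_⟩)
      fun V x y f h => vecTensor_hom_ext' fun φ => ?_⟩
  · exact Quiver.Hom.unop_inj (FGModuleCat.hom_ext
      ((homDualVecEquiv k V.unop c d).symm_apply_apply f.unop.hom.hom))
  · exact (homDualVecEquiv k V.unop c d).apply_symm_apply t
  · refine (vecLift_contract _ φ).trans (Eq.trans ?_ (Category.assoc _ _ _).symm)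
    refine Eq.trans ?_ (f ≫= vecLift_contract
      (h.unop.hom.hom ∘ₗ (Module.evalEquiv k V.unop.obj).symm.toLinearMap) φ).symm
    rfl

end HomExact

section HomTensor

variable (k : Type w) [Field k]
  {A : Type u₁} [Category.{v₁} A] [Preadditive A] [Linear k A] [IsFiniteLinear k A]
  {B : Type u₂} [Category.{v₂} B] [Preadditive B] [Linear k B] [IsFiniteLinear k B]

/-- The morphism `b ⟶ Hom(a, x) ⊗ b` given by a morphism `a ⟶ x`. -/
def homTensorι {a x : A} (b : B) :
    (a ⟶ x) →ₗ[k] (b ⟶ (((homTensor k A B).obj (op a)).obj b).obj x) :=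
  haveI := hasFiniteBiproducts k (C := B)
  coev k (FGModuleCat.of k (a ⟶ x)) b

section

variable {k}

theorem homTensor_hom_ext {a x : A} {b b' : B}
    {s t : (((homTensor k A B).obj (op a)).obj b).obj x ⟶ b'}
    (h : ∀ f : a ⟶ x, homTensorι k b f ≫ s = homTensorι k b f ≫ t) : s = t :=
  haveI := hasFiniteBiproducts k (C := B)
  vecTensor_hom_ext h

theorem homTensorι_map {a x y : A} (f : a ⟶ x) (g : x ⟶ y) (b : B) :
    homTensorι k b f ≫ (((homTensor k A B).obj (op a)).obj b).map g = homTensorι k b (f ≫ g) :=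
  haveI := hasFiniteBiproducts k (C := B)
  coev_map_app (FGModuleCat.ofHom (Linear.rightComp k a g)) b f

theorem homTensorι_map_app {a x : A} (f : a ⟶ x) {b b' : B} (h : b ⟶ b') :
    homTensorι k b f ≫ (((homTensor k A B).obj (op a)).map h).app x = h ≫ homTensorι k b' f :=
  haveI := hasFiniteBiproducts k (C := B)
  coev_map (FGModuleCat.of k (a ⟶ x)) h f

theorem homTensorι_map_app_app {a a' x : A} (g : a' ⟶ a) (f : a ⟶ x) (b : B) :
    homTensorι k b f ≫ (((homTensor k A B).map g.op).app b).app x = homTensorι k b (g ≫ f) :=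
  haveI := hasFiniteBiproducts k (C := B)
  coev_map_app (FGModuleCat.ofHom (Linear.leftComp k x g)) b f

/-- The universal property of `Hom(a, x) ⊗ b`. -/
theorem exists_homTensor_desc {a x : A} {b b' : B} (φ : (a ⟶ x) →ₗ[k] (b ⟶ b')) :
    ∃ t : (((homTensor k A B).obj (op a)).obj b).obj x ⟶ b', ∀ f, homTensorι k b f ≫ t = φ f :=
  haveI := hasFiniteBiproducts k (C := B)
  ⟨vecDesc (V := FGModuleCat.of k (a ⟶ x)) φ,
    coev_vecDesc (V := FGModuleCat.of k (a ⟶ x)) φ⟩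

end

/-- The morphism `Hom(x, a)^* ⊗ b ⟶ b` given by a morphism `x ⟶ a`. -/
def dualHomTensorπ {a x : A} (f : x ⟶ a) (b : B) :
    (((dualHomTensor k A B).obj (op a)).obj b).obj x ⟶ b :=
  haveI := hasFiniteBiproducts k (C := B)
  contract (V := FGModuleCat.of k (Module.Dual k (x ⟶ a))) (Module.Dual.eval k _ f) b

section

variable {k}

theorem dualHomTensor_hom_ext {a x : A} {b b' : B}
    {s t : b' ⟶ (((dualHomTensor k A B).obj (op a)).obj b).obj x}
    (h : ∀ f : x ⟶ a, s ≫ dualHomTensorπ k f b = t ≫ dualHomTensorπ k f b) : s = t :=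
  haveI := hasFiniteBiproducts k (C := B)
  vecTensor_hom_ext' (V := FGModuleCat.of k (Module.Dual k (x ⟶ a))) fun φ => by
    obtain ⟨f, rfl⟩ := (Module.evalEquiv k (x ⟶ a)).surjective φ
    exact h f

theorem map_dualHomTensorπ {a x y : A} (g : y ⟶ x) (f : x ⟶ a) (b : B) :
    (((dualHomTensor k A B).obj (op a)).obj b).map g ≫ dualHomTensorπ k f b =
      dualHomTensorπ k (g ≫ f) b :=
  haveI := hasFiniteBiproducts k (C := B)
  map_app_contract (V := FGModuleCat.of k (Module.Dual k (y ⟶ a)))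
    (W := FGModuleCat.of k (Module.Dual k (x ⟶ a))) _ (Module.Dual.eval k _ f) b

theorem map_app_dualHomTensorπ {a x : A} (f : x ⟶ a) {b b' : B} (h : b ⟶ b') :
    (((dualHomTensor k A B).obj (op a)).map h).app x ≫ dualHomTensorπ k f b' =
      dualHomTensorπ k f b ≫ h :=
  haveI := hasFiniteBiproducts k (C := B)
  map_contract (V := FGModuleCat.of k (Module.Dual k (x ⟶ a))) _ h

theorem map_app_app_dualHomTensorπ {a a' x : A} (g : a' ⟶ a) (f : x ⟶ a') (b : B) :
    (((dualHomTensor k A B).map g.op).app b).app x ≫ dualHomTensorπ k f b =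
      dualHomTensorπ k (f ≫ g) b :=
  haveI := hasFiniteBiproducts k (C := B)
  map_app_contract (V := FGModuleCat.of k (Module.Dual k (x ⟶ a)))
    (W := FGModuleCat.of k (Module.Dual k (x ⟶ a'))) _ (Module.Dual.eval k _ f) b

/-- The universal property of `Hom(x, a)^* ⊗ b`. -/
theorem exists_dualHomTensor_lift {a x : A} {b b' : B} (φ : (x ⟶ a) →ₗ[k] (b' ⟶ b)) :
    ∃ t : b' ⟶ (((dualHomTensor k A B).obj (op a)).obj b).obj x,
      ∀ f, t ≫ dualHomTensorπ k f b = φ f :=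
  haveI := hasFiniteBiproducts k (C := B)
  ⟨vecLift (V := FGModuleCat.of k (Module.Dual k (x ⟶ a)))
    (φ ∘ₗ (Module.evalEquiv k (x ⟶ a)).symm.toLinearMap), fun f => (vecLift_contract _ _).trans
      (congrArg φ ((Module.evalEquiv k _).symm_apply_apply f))⟩

theorem dualHomTensorπ_add {a x : A} (f g : x ⟶ a) (b : B) :
    dualHomTensorπ k (f + g) b = dualHomTensorπ k f b + dualHomTensorπ k g b :=
  haveI := hasFiniteBiproducts k (C := B)
  vecTensor_hom_ext (V := FGModuleCat.of k (Module.Dual k (x ⟶ a))) fun φ => by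
    refine (coev_contract _ b φ).trans (Eq.trans ?_ (Preadditive.comp_add _ _ _ _ _ _).symm)
    refine Eq.trans ?_ (congrArg₂ (· + ·) (coev_contract _ b φ) (coev_contract _ b φ)).symm
    rw [← add_smul, map_add]
    rfl

theorem dualHomTensorπ_smul {a x : A} (r : k) (f : x ⟶ a) (b : B) :
    dualHomTensorπ k (r • f) b = r • dualHomTensorπ k f b :=
  haveI := hasFiniteBiproducts k (C := B)
  vecTensor_hom_ext (V := FGModuleCat.of k (Module.Dual k (x ⟶ a))) fun φ => by
    refine (coev_contract _ b φ).trans (Eq.trans ?_ (Linear.comp_smul _ _ _ _ _ _).symm)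
    refine Eq.trans ?_ (congrArg (r • ·) (coev_contract _ b φ)).symm
    rw [smul_smul, map_smul]
    rfl

end

/-- Morphisms out of a sum of copies of `a` are families of morphisms out of `a`. -/
def fromBiproductEquiv [HasFiniteBiproducts A] (n : ℕ) (a x : A) :
    ((⨁ fun _ : Fin n => a) ⟶ x) ≃ (Fin n → (a ⟶ x)) where
  toFun g := fun j => biproduct.ι (fun _ => a) j ≫ g
  invFun v := biproduct.desc v
  left_inv _ := biproduct.hom_ext' _ _ fun j => biproduct.ι_desc _ j
  right_inv v := funext fun j => biproduct.ι_desc v j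

/-- Morphisms into a sum of copies of `a` are families of morphisms into `a`. -/
def toBiproductEquiv [HasFiniteBiproducts A] (n : ℕ) (a x : A) :
    (x ⟶ (⨁ fun _ : Fin n => a)) ≃ (Fin n → (x ⟶ a)) where
  toFun g := fun j => g ≫ biproduct.π (fun _ => a) j
  invFun v := biproduct.lift v
  left_inv _ := biproduct.hom_ext _ _ fun j => biproduct.lift_π _ j
  right_inv v := funext fun j => biproduct.lift_π v j

/-- The functor `Hom(a, -) ⊗ b` is left exact: as a functor of `x`, a choice of basis of
`Hom(b', b)` identifies `Hom(b', Hom(a, x) ⊗ b)` with the morphisms from a sum of copies of `a`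
to `x`. -/
theorem isLinearLex_homTensor (a : A) (b : B) :
    IsLinearLex k (((homTensor k A B).obj (op a)).obj b) := by
  have := hasFiniteBiproducts k (C := A)
  have := hasFiniteBiproducts k (C := B)
  let e (b' : B) (x : A) := (fromBiproductEquiv (Module.finrank k (b' ⟶ b)) a x).trans
    (Equiv.ofBijective (fun v => ∑ j, (Module.finBasis k (b' ⟶ b)) j ≫ homTensorι k b (v j))
      (bijective_sum_comp_coev (FGModuleCat.of k (a ⟶ x)) (Module.finBasis k (b' ⟶ b))))
  have e_apply (b' : B) (x : A) (g) : e b' x g = ∑ j, (Module.finBasis k (b' ⟶ b)) j ≫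
      homTensorι k b (biproduct.ι (fun _ => a) j ≫ g) := rfl
  have he (b' : B) {x y : A} (f : x ⟶ y) (g) :
      e b' y (g ≫ f) = e b' x g ≫ (((homTensor k A B).obj (op a)).obj b).map f := by
    rw [e_apply, e_apply, Preadditive.sum_comp]
    refine Finset.sum_congr rfl fun j _ => ?_
    rw [Category.assoc, homTensorι_map, Category.assoc]
  refine ⟨⟨fun {x y f g} => homTensor_hom_ext fun v => ?_⟩,
    ⟨fun {x y} f r => homTensor_hom_ext fun v => ?_⟩,
    preservesFiniteLimits_of_equiv _ (fun b' => coyoneda.obj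
      (op (⨁ fun _ : Fin (Module.finrank k (b' ⟶ b)) => a))) (fun b' x => (e b' x).symm)
      fun b' x y f h => (e b' y).symm_apply_eq.2 ?_⟩
  · rw [Preadditive.comp_add, homTensorι_map, homTensorι_map, homTensorι_map, Preadditive.comp_add,
      map_add]
  · rw [Linear.comp_smul, homTensorι_map, homTensorι_map, Linear.comp_smul, map_smul]
  · exact ((he b' f _).trans (congrArg (· ≫ _) ((e b' x).apply_symm_apply h))).symm

/-- The functor `Hom(-, a)^* ⊗ b` is right exact: as a functor of `x`, a choice of basis of
`Hom(b, b')` identifies `Hom(Hom(x, a)^* ⊗ b, b')` with the morphisms from `x` to a sum of copies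
of `a`. -/
theorem isLinearRex_dualHomTensor (a : A) (b : B) :
    IsLinearRex k (((dualHomTensor k A B).obj (op a)).obj b) := by
  have := hasFiniteBiproducts k (C := A)
  have := hasFiniteBiproducts k (C := B)
  let e (b' : B) (x : A) := ((toBiproductEquiv (Module.finrank k (b ⟶ b')) a x).trans
    (Equiv.piCongrRight fun _ => (Module.evalEquiv k (x ⟶ a)).toEquiv)).trans
    (Equiv.ofBijective _ (bijective_sum_contract_comp
      (FGModuleCat.of k (Module.Dual k (x ⟶ a))) (Module.finBasis k (b ⟶ b'))))
  have e_apply (b' : B) (x : A) (g) : e b' x g = ∑ j,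
      dualHomTensorπ k (g ≫ biproduct.π (fun _ => a) j) b ≫ (Module.finBasis k (b ⟶ b')) j := rfl
  have he (b' : B) {x y : A} (f : x ⟶ y) (g) :
      e b' x (f ≫ g) = (((dualHomTensor k A B).obj (op a)).obj b).map f ≫ e b' y g := by
    rw [e_apply, e_apply, Preadditive.comp_sum]
    refine Finset.sum_congr rfl fun j _ => ?_
    rw [reassoc_of% (map_dualHomTensorπ (k := k) f (g ≫ biproduct.π (fun _ => a) j) b),
      Category.assoc]
  refine ⟨⟨fun {x y f g} => dualHomTensor_hom_ext fun v => ?_⟩,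
    ⟨fun {x y} f r => dualHomTensor_hom_ext fun v => ?_⟩,
    preservesFiniteColimits_of_equiv _ (fun b' => yoneda.obj
      (⨁ fun _ : Fin (Module.finrank k (b ⟶ b')) => a)) (fun b' x => (e b' x).symm)
      fun b' x y f h => (e b' x).symm_apply_eq.2 ?_⟩
  · rw [Preadditive.add_comp, map_dualHomTensorπ, map_dualHomTensorπ, map_dualHomTensorπ,
      Preadditive.add_comp, dualHomTensorπ_add]
  · rw [Linear.smul_comp, map_dualHomTensorπ, map_dualHomTensorπ, Linear.smul_comp,
      dualHomTensorπ_smul]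
  · exact ((he b' f _).trans (_ ≫= ((e b' y).apply_symm_apply h))).symm

end HomTensor

/-! ### Universal families -/

section UniversalFamily

section Definition

variable {A : Type u₁} [Category.{v₁} A] {B : Type u₂} [Category.{v₂} B]
  {D : Type u₃} [Category.{v₃} D] {T : Aᵒᵖ ⥤ B ⥤ D}

/-- A dinatural family `t a : T (a, F a) ⟶ d` such that any morphism `T (a, b) ⟶ d` factors uniquely
through `T (a, g)` for some `g : b ⟶ F a`; in other words, `F a` represents `Hom(T (a, -), d)`. -/
structure IsUniversalFamily (T : Aᵒᵖ ⥤ B ⥤ D) (F : A ⥤ B) {d : D}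
    (t : ∀ a, (T.obj (op a)).obj (F.obj a) ⟶ d) : Prop where
  dinatural : ∀ {a a' : A} (f : a ⟶ a'), (T.map f.op).app (F.obj a) ≫ t a =
    (T.obj (op a')).map (F.map f) ≫ t a'
  bijective : ∀ (a : A) (b : B),
    Function.Bijective (fun g : b ⟶ F.obj a => (T.obj (op a)).map g ≫ t a)

/-- A dinatural family factors through a universal family with the same target. -/
theorem IsUniversalFamily.exists_natTrans {F F' : A ⥤ B} {d : D}
    {t : ∀ a, (T.obj (op a)).obj (F'.obj a) ⟶ d} (ht : IsUniversalFamily T F' t)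
    (s : ∀ a, (T.obj (op a)).obj (F.obj a) ⟶ d)
    (hs : ∀ {a a' : A} (f : a ⟶ a'), (T.map f.op).app (F.obj a) ≫ s a =
      (T.obj (op a')).map (F.map f) ≫ s a') :
    ∃ τ : F ⟶ F', ∀ a, (T.obj (op a)).map (τ.app a) ≫ t a = s a := by
  choose m hm using fun a => (ht.bijective a (F.obj a)).2 (s a)
  dsimp only at hm
  exact ⟨{ app := m
           naturality := fun a a' f => (ht.bijective a' _).1 (by
            dsimp only
            rw [Functor.map_comp, Category.assoc, hm, ← hs, Functor.map_comp, Category.assoc,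
              ← ht.dinatural, NatTrans.naturality_assoc, hm]) }, hm⟩

end Definition

variable {k : Type w} [Field k]
  {A : Type u₁} [Category.{v₁} A] [Preadditive A] [Linear k A]
  {B : Type u₂} [Category.{v₂} B] [Preadditive B] [Linear k B]
  {D : Type (w + 1)} [Category.{w} D] [Abelian D] [Linear k D] {T : Aᵒᵖ ⥤ B ⥤ D}

/-- Every object is the target of a universal family, whose functor sends `a` to the value of the
right adjoint of `T (a, -)`. -/
theorem IsDeligneProduct.exists_functor [IsFiniteLinear k B] [IsFiniteLinear k D]
    (hT : IsDeligneProduct k T) (d : D) : ∃ (F : A ⥤ B) (t : ∀ a, (T.obj (op a)).obj (F.obj a) ⟶ d),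
      IsLinearLex k F ∧ IsUniversalFamily T F t := by
  have (a : Aᵒᵖ) : (T.obj a).IsLeftAdjoint := (hT.rex.right a).isLeftAdjoint
  let R (a : A) : B := (T.obj (op a)).rightAdjoint.obj d
  let t (a : A) : (T.obj (op a)).obj (R a) ⟶ d :=
    (Adjunction.ofIsLeftAdjoint (T.obj (op a))).counit.app d
  have ht (a : A) (b : B) : Function.Bijective (fun g : b ⟶ R a => (T.obj (op a)).map g ≫ t a) := by
    convert ((Adjunction.ofIsLeftAdjoint (T.obj (op a))).homEquiv b d).symm.bijective using 2
    exact (Adjunction.homEquiv_counit _ _ _ _).symm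
  have hinj {a : A} {b : B} {g g' : b ⟶ R a}
      (h : (T.obj (op a)).map g ≫ t a = (T.obj (op a)).map g' ≫ t a) : g = g' :=
    (ht a b).1 h
  choose m hm using fun (a a' : A) (f : a ⟶ a') => (ht a' (R a)).2 ((T.map f.op).app (R a) ≫ t a)
  dsimp only at hm
  let F : A ⥤ B :=
    { obj := R
      map := fun {a a'} f => m a a' f
      map_id := fun a => hinj (by rw [hm]; simp)
      map_comp := fun {a a' a''} f g => hinj (by
        rw [hm, Functor.map_comp, Category.assoc, hm, NatTrans.naturality_assoc, hm, op_comp,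
          T.map_comp, NatTrans.comp_app, Category.assoc]) }
  have hF (a a' : A) (f : a ⟶ a') : (T.obj (op a')).map (F.map f) ≫ t a' =
      (T.map f.op).app (R a) ≫ t a := hm a a' f
  have hl (b : B) : IsLinearRex k (T.flip.obj b) := hT.rex.left b
  have hr (a : A) : IsLinearRex k (T.obj (op a)) := hT.rex.right _
  refine ⟨F, t, ⟨⟨fun {a a' f g} => hinj ?_⟩, ⟨fun {a a'} f r => hinj ?_⟩, ?_⟩,
    fun {a a'} f => (hm _ _ f).symm, ht⟩
  · have := (hl (R a)).additive
    have := (hr a').additive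
    have h := (T.flip.obj (R a)).map_add (f := f.op) (g := g.op)
    rw [hF, Functor.map_add, Preadditive.add_comp, hF, hF, ← Preadditive.add_comp]
    exact congrArg (· ≫ t a) h
  · have := (hl (R a)).linear
    have := (hr a').linear
    have h := (T.flip.obj (R a)).map_smul r f.op
    rw [hF, Functor.map_smul, Linear.smul_comp, hF, ← Linear.smul_comp]
    exact congrArg (· ≫ t a) h
  · have (b : B) : PreservesFiniteLimits (T.flip.obj b).rightOp := by
      have := (hl b).rex
      exact preservesFiniteLimits_rightOp _
    have (b : B) : PreservesFiniteLimits ((T.flip.obj b).rightOp ⋙ yoneda.obj d) :=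
      comp_preservesFiniteLimits _ _
    refine preservesFiniteLimits_of_equiv F (fun b => (T.flip.obj b).rightOp ⋙ yoneda.obj d)
      (fun b a => Equiv.ofBijective _ (ht a b)) fun b a a' f h => ?_
    change (T.obj (op a')).map (h ≫ F.map f) ≫ t a' =
      (T.map f.op).app b ≫ (T.obj (op a)).map h ≫ t a
    rw [Functor.map_comp, Category.assoc, hF, NatTrans.naturality_assoc]

section Finite

variable [IsFiniteLinear k D]

/-- The members of a universal family are jointly epimorphic. A morphism `d ⟶ x` is a transformation
`Hom(-, d) ⟶ Hom(-, x)`, which, by the universal property of the Deligne product, is determined by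
its restriction to the objects `T (a, b)`; there, every morphism to `d` factors through the
family. -/
theorem IsUniversalFamily.hom_ext (hT : IsDeligneProduct k T) {F : A ⥤ B} {d : D}
    {t : ∀ a, (T.obj (op a)).obj (F.obj a) ⟶ d} (ht : IsUniversalFamily T F t) {x : D}
    {s s' : d ⟶ x} (h : ∀ a, t a ≫ s = t a ≫ s') : s = s' := by
  have key := (hT.bijective (FGModuleCat.{w} k)ᵒᵖ _ _ (isLinearRex_homYoneda k x)
    (isLinearRex_homYoneda k d)).1 (a₁ := NatTrans.rightOp ((homFunctor k D).flip.map s))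
    (a₂ := NatTrans.rightOp ((homFunctor k D).flip.map s')) (NatTrans.ext (funext fun a =>
      NatTrans.ext (funext fun b => Quiver.Hom.unop_inj (FGModuleCat.hom_ext
        (LinearMap.ext fun g => ?_)))))
  · have := congrArg (fun τ => τ.unop.hom.hom (𝟙 d)) (congr_app key d)
    exact (Category.id_comp s).symm.trans (this.trans (Category.id_comp s'))
  · obtain ⟨g, rfl⟩ := (ht.bijective a.unop b).2 g
    refine (Category.assoc _ _ _).trans (Eq.trans ?_ (Category.assoc _ _ _).symm)
    exact _ ≫= h a.unop

/-- A transformation `τ : F ⟶ F'` induces a morphism between the targets of universal families. It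
induces transformations `Hom(T (a, b), d) ≅ Hom(b, F a) ⟶ Hom(b, F' a) ≅ Hom(T (a, b), d')`, which
extend to a transformation `Hom(-, d) ⟶ Hom(-, d')`. -/
theorem IsUniversalFamily.exists_hom_of_natTrans (hT : IsDeligneProduct k T) {F F' : A ⥤ B}
    {d d' : D} {t : ∀ a, (T.obj (op a)).obj (F.obj a) ⟶ d} (ht : IsUniversalFamily T F t)
    {t' : ∀ a, (T.obj (op a)).obj (F'.obj a) ⟶ d'} (ht' : IsUniversalFamily T F' t') (τ : F ⟶ F') :
    ∃ s : d ⟶ d', ∀ a, t a ≫ s = (T.obj (op a)).map (τ.app a) ≫ t' a := by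
  choose m hm using fun (a : A) (b : B) => (ht.bijective a b).2
  dsimp only at hm
  have hinj {a : A} {b : B} {g g' : b ⟶ F.obj a}
      (h : (T.obj (op a)).map g ≫ t a = (T.obj (op a)).map g' ≫ t a) : g = g' :=
    (ht.bijective a b).1 h
  have hr (a : A) : IsLinearRex k (T.obj (op a)) := hT.rex.right _
  let φ (a : A) (b : B) : ((T.obj (op a)).obj b ⟶ d) →ₗ[k] ((T.obj (op a)).obj b ⟶ d') :=
    { toFun := fun h => (T.obj (op a)).map (m a b h ≫ τ.app a) ≫ t' a
      map_add' := fun h h' => by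
        have := (hr a).additive
        have hadd : m a b (h + h') = m a b h + m a b h' :=
          hinj (by rw [hm, Functor.map_add, Preadditive.add_comp, hm, hm])
        rw [hadd, Preadditive.add_comp, Functor.map_add, Preadditive.add_comp]
      map_smul' := fun r h => by
        have := (hr a).linear
        have hsmul : m a b (r • h) = r • m a b h :=
          hinj (by rw [hm, Functor.map_smul, Linear.smul_comp, hm])
        rw [hsmul, Linear.smul_comp, Functor.map_smul, Linear.smul_comp, RingHom.id_apply] }
  have hφ (a : A) (b : B) (h : (T.obj (op a)).obj b ⟶ d) :
      φ a b h = (T.obj (op a)).map (m a b h ≫ τ.app a) ≫ t' a := rfl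
  have hφ₁ (a : A) {b b' : B} (g : b ⟶ b') (h : (T.obj (op a)).obj b' ⟶ d) :
      φ a b ((T.obj (op a)).map g ≫ h) = (T.obj (op a)).map g ≫ φ a b' h := by
    have : m a b ((T.obj (op a)).map g ≫ h) = g ≫ m a b' h :=
      hinj (by rw [hm, Functor.map_comp, Category.assoc, hm])
    rw [hφ, hφ, this, Category.assoc, Functor.map_comp, Category.assoc]
  have hφ₂ {a a' : A} (f : a ⟶ a') (b : B) (h : (T.obj (op a)).obj b ⟶ d) :
      φ a' b ((T.map f.op).app b ≫ h) = (T.map f.op).app b ≫ φ a b h := by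
    have : m a' b ((T.map f.op).app b ≫ h) = m a b h ≫ F.map f :=
      hinj (by rw [hm, Functor.map_comp, Category.assoc, ← ht.dinatural, NatTrans.naturality_assoc,
        hm])
    rw [hφ, hφ, this, Category.assoc, τ.naturality, ← Category.assoc, Functor.map_comp,
      Category.assoc, ← ht'.dinatural, NatTrans.naturality_assoc]
  let σ : postcomp T (homYoneda k d') ⟶ postcomp T (homYoneda k d) :=
    { app := fun a =>
        { app := fun b => (FGModuleCat.ofHom (φ a.unop b)).op
          naturality := fun b b' g => Quiver.Hom.unop_inj (FGModuleCat.hom_ext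
            (LinearMap.ext fun h => (hφ₁ a.unop g h).symm)) }
      naturality := fun a a' f => NatTrans.ext (funext fun b => Quiver.Hom.unop_inj
        (FGModuleCat.hom_ext (LinearMap.ext fun h => (hφ₂ f.unop b h).symm))) }
  obtain ⟨κ, hκ⟩ := (hT.bijective (FGModuleCat.{w} k)ᵒᵖ _ _ (isLinearRex_homYoneda k d')
    (isLinearRex_homYoneda k d)).2 σ
  let κ' (x : D) (h : x ⟶ d) : x ⟶ d' := (κ.app x).unop.hom.hom h
  have hκ' {x y : D} (g : x ⟶ y) (h : y ⟶ d) : κ' x (g ≫ h) = g ≫ κ' y h :=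
    congrArg (fun τ => τ.unop.hom.hom h) (κ.naturality g).symm
  refine ⟨κ' d (𝟙 d), fun a => ?_⟩
  have h1 : κ' _ (t a) = φ a (F.obj a) (t a) :=
    congrArg (fun τ => τ.unop.hom.hom (t a)) (congr_app (congr_app hκ (op a)) (F.obj a))
  have h2 : m a (F.obj a) (t a) = 𝟙 _ := hinj (by rw [hm]; simp)
  rw [← hκ', Category.comp_id, h1, hφ, h2, Category.id_comp]

/-- A universal family is a colimit: it is universal among dinatural families. -/
theorem IsUniversalFamily.exists_desc [IsFiniteLinear k B] (hT : IsDeligneProduct k T) {F : A ⥤ B}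
    {d : D} {t : ∀ a, (T.obj (op a)).obj (F.obj a) ⟶ d} (ht : IsUniversalFamily T F t) {x : D}
    (s : ∀ a, (T.obj (op a)).obj (F.obj a) ⟶ x)
    (hs : ∀ {a a' : A} (f : a ⟶ a'), (T.map f.op).app (F.obj a) ≫ s a =
      (T.obj (op a')).map (F.map f) ≫ s a') : ∃ r : d ⟶ x, ∀ a, t a ≫ r = s a := by
  obtain ⟨F', t', -, ht'⟩ := hT.exists_functor x
  obtain ⟨τ, hτ⟩ := ht'.exists_natTrans s hs
  obtain ⟨r, hr⟩ := ht.exists_hom_of_natTrans hT ht' τ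
  exact ⟨r, fun a => (hr a).trans (hτ a)⟩

end Finite

end UniversalFamily

section Represent

variable {k : Type w} [Field k]
  {A : Type u₁} [Category.{v₁} A] [Preadditive A] [Linear k A]
  {B : Type u₂} [Category.{v₂} B] [Preadditive B] [Linear k B]
  {D : Type (w + 1)} [Category.{w} D] [Abelian D] [Linear k D] {T : Aᵒᵖ ⥤ B ⥤ D}

section HomBifunctor

variable (k) {B' : Type u₃} [Category.{v₃} B'] [Preadditive B'] [Linear k B'] [IsFiniteLinear k B']

/-- The bifunctor `(a, b) ↦ Hom(G b, F a)`, with values in the opposite of vector spaces. -/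
def homBifunctor (F : A ⥤ B') (G : B ⥤ B') : Aᵒᵖ ⥤ B ⥤ (FGModuleCat.{v₃} k)ᵒᵖ where
  obj a := G ⋙ homYoneda k (F.obj a.unop)
  map f := Functor.whiskerLeft G (NatTrans.rightOp ((homFunctor k B').flip.map (F.map f.unop)))
  map_id a := NatTrans.ext (funext fun _ => Quiver.Hom.unop_inj (FGModuleCat.hom_ext
    (LinearMap.ext fun h => (congrArg (h ≫ ·) (F.map_id a.unop)).trans (Category.comp_id h))))
  map_comp f g := NatTrans.ext (funext fun _ => Quiver.Hom.unop_inj (FGModuleCat.hom_ext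
    (LinearMap.ext fun h => (congrArg (h ≫ ·) (F.map_comp g.unop f.unop)).trans
      (Category.assoc h _ _).symm)))

theorem isBilinearRex_homBifunctor {F : A ⥤ B'} (hF : IsLinearLex k F) {G : B ⥤ B'}
    (hG : IsLinearRex k G) : IsBilinearRex k (homBifunctor k F G) where
  left b := by
    have h := (hF.comp (isLinearLex_homFunctor k (op (G.obj b)))).op
    exact h.of_iso (NatIso.ofComponents fun a => Iso.refl _)
  right a := hG.comp (isLinearRex_homYoneda k _)

end HomBifunctor

/-- Every left exact functor is the functor of a universal family. Its target is obtained from the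
functor on the Deligne product which extends `(a, b) ↦ Hom(b, F a)`. -/
theorem IsDeligneProduct.exists_universalFamily [IsFiniteLinear k B] [IsFiniteLinear k D]
    (hT : IsDeligneProduct k T) {F : A ⥤ B} (hF : IsLinearLex k F) :
    ∃ (d : D) (t : ∀ a, (T.obj (op a)).obj (F.obj a) ⟶ d), IsUniversalFamily T F t := by
  -- The morphism spaces of `B` may live in another universe than `k`, so they are replaced by those
  -- of an equivalent module category.
  obtain ⟨S, _, _, _, E, _, hE₁, hE₂⟩ := IsFiniteLinear.exists_equivalence (k := k) (C := B)
  have : IsNoetherianRing S := isNoetherian_of_tower k inferInstance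
  have : IsFiniteLinear k (FGModuleCat.{w} S) := ⟨S, inferInstance, inferInstance, inferInstance,
    𝟭 _, inferInstance, inferInstance, inferInstance⟩
  have (M N : (FGModuleCat.{w} k)ᵒᵖ) : Module.Finite k (M ⟶ N) := by
    have := finite_hom_fgModuleCat k k N.unop M.unop
    exact Module.Finite.equiv (M := (N.unop ⟶ M.unop))
      { toFun := Quiver.Hom.op
        invFun := Quiver.Hom.unop
        map_add' := fun _ _ => rfl
        map_smul' := fun _ _ => rfl
        left_inv := fun _ => rfl
        right_inv := fun _ => rfl }
  obtain ⟨V, hV, ⟨i⟩⟩ := hT.fac (FGModuleCat.{w} k)ᵒᵖ (homBifunctor k (F ⋙ E) E)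
    (isBilinearRex_homBifunctor k (hF.comp (IsLinearLex.of_isEquivalence E hE₁ hE₂))
      (IsLinearRex.of_isEquivalence E hE₁ hE₂))
  -- `V` stands for `Hom(-, d)`, and its right adjoint recovers `d` as the image of the
  -- ground field.
  have := hV.isLeftAdjoint
  let adj := Adjunction.ofIsLeftAdjoint V
  let d : D := V.rightAdjoint.obj (op (FGModuleCat.of k k))
  let pt (M : FGModuleCat.{w} k) : M.obj ≃ (op M ⟶ op (FGModuleCat.of k k)) :=
    { toFun := fun m => (FGModuleCat.ofHom (LinearMap.toSpanSingleton k M.obj m)).op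
      invFun := fun f => f.unop.hom.hom (1 : k)
      left_inv := fun m => one_smul k m
      right_inv := fun f => Quiver.Hom.unop_inj (FGModuleCat.hom_ext
        (LinearMap.ext_ring (one_smul k _))) }
  have hpt {M N : FGModuleCat.{w} k} (f : M ⟶ N) (m : M.obj) : f.op ≫ pt M m = pt N (f.hom.hom m) :=
    Quiver.Hom.unop_inj (FGModuleCat.hom_ext (LinearMap.ext_ring
      (congrArg f.hom.hom (one_smul k m) |>.trans (one_smul k (f.hom.hom m)).symm)))
  let θ (a : A) (b : B) : (b ⟶ F.obj a) ≃ ((T.obj (op a)).obj b ⟶ d) :=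
    (((Functor.FullyFaithful.ofFullyFaithful E).homEquiv.trans
      (pt (FGModuleCat.of k (E.obj b ⟶ E.obj (F.obj a))))).trans
        ((i.app (op a)).app b).symm.homFromEquiv).trans (adj.homEquiv _ _)
  have hθ (a : A) (b : B) (g : b ⟶ F.obj a) : θ a b g = adj.homEquiv _ _ ((i.hom.app (op a)).app b ≫
      pt (FGModuleCat.of k (E.obj b ⟶ E.obj (F.obj a))) (E.map g)) := rfl
  have hθ₁ (a : A) {b b' : B} (h : b ⟶ b') (g : b' ⟶ F.obj a) :
      (T.obj (op a)).map h ≫ θ a b' g = θ a b (h ≫ g) := by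
    rw [hθ, hθ, ← adj.homEquiv_naturality_left]
    refine congrArg _ (((i.hom.app (op a)).naturality_assoc h _).trans (_ ≫= ?_))
    rw [E.map_comp]
    exact hpt (M := FGModuleCat.of k (E.obj b' ⟶ E.obj (F.obj a)))
      (N := FGModuleCat.of k (E.obj b ⟶ E.obj (F.obj a)))
      (FGModuleCat.ofHom (Linear.leftComp k (E.obj (F.obj a)) (E.map h))) (E.map g)
  have hθ₂ {a a' : A} (f : a ⟶ a') (b : B) (g : b ⟶ F.obj a) :
      (T.map f.op).app b ≫ θ a b g = θ a' b (g ≫ F.map f) := by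
    rw [hθ, hθ, ← adj.homEquiv_naturality_left]
    refine congrArg _ ?_
    refine (Category.assoc _ _ _).symm.trans ((congr_app (i.hom.naturality f.op) b =≫ _).trans
      ((Category.assoc _ _ _).trans (_ ≫= ?_)))
    rw [E.map_comp]
    exact hpt (M := FGModuleCat.of k (E.obj b ⟶ E.obj (F.obj a)))
      (N := FGModuleCat.of k (E.obj b ⟶ E.obj (F.obj a')))
      (FGModuleCat.ofHom (Linear.rightComp k (E.obj b) (E.map (F.map f)))) (E.map g)
  refine ⟨d, fun a => θ a _ (𝟙 _), fun {a a'} f => ?_, fun a b => ?_⟩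
  · rw [hθ₁, hθ₂, Category.comp_id, Category.id_comp]
  · convert (θ a b).bijective using 2 with g
    rw [hθ₁, Category.comp_id]

end Represent

/-! ### Coends -/

section Coend

variable {k : Type w} [Field k]
  {A : Type u₁} [Category.{v₁} A] [Preadditive A] [Linear k A]
  {B : Type u₂} [Category.{v₂} B] [Preadditive B] [Linear k B]

section Psi

variable {D : Type u₃} [Category.{v₃} D] {T : Aᵒᵖ ⥤ B ⥤ D}
  (h : ∀ F : FunLex k A B, HasCoend (integrand T F.obj))

/-- The universal cowedge with vertex `∫^a a ⊠ F a`. -/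
def psiLι (F : FunLex k A B) (a : A) :
    (T.obj (op a)).obj (F.obj.obj a) ⟶ (psiL k T h).obj F :=
  haveI := h F
  coend.ι (integrand T F.obj) a

variable {F G : FunLex k A B}

theorem psiL_hom_ext {d : D} {s t : (psiL k T h).obj F ⟶ d}
    (hst : ∀ a, psiLι h F a ≫ s = psiLι h F a ≫ t) : s = t :=
  haveI := h F
  coend.hom_ext hst

theorem exists_psiL_desc {d : D} (t : ∀ a, (T.obj (op a)).obj (F.obj.obj a) ⟶ d)
    (ht : ∀ {a a' : A} (f : a ⟶ a'), (T.map f.op).app (F.obj.obj a) ≫ t a =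
      (T.obj (op a')).map (F.obj.map f) ≫ t a') :
    ∃ s : (psiL k T h).obj F ⟶ d, ∀ a, psiLι h F a ≫ s = t a :=
  haveI := h F
  ⟨coend.desc t fun _ _ f => ht f, fun a => coend.ι_desc _ _ a⟩

theorem psiLι_map (τ : F ⟶ G) (a : A) :
    psiLι h F a ≫ (psiL k T h).map τ = (T.obj (op a)).map (τ.hom.app a) ≫ psiLι h G a :=
  haveI := h F
  haveI := h G
  coend.ι_map _ _

variable (F) in
theorem psiLι_dinatural {a a' : A} (f : a ⟶ a') :
    (T.map f.op).app (F.obj.obj a) ≫ psiLι h F a =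
      (T.obj (op a')).map (F.obj.map f) ≫ psiLι h F a' :=
  haveI := h F
  coend.condition (integrand T F.obj) f

end Psi

section Linear

variable {D : Type u₃} [Category.{v₃} D] [Preadditive D] [Linear k D] {T : Aᵒᵖ ⥤ B ⥤ D}
  (h : ∀ F : FunLex k A B, HasCoend (integrand T F.obj))

theorem psiL_additive (hT : IsBilinearRex k T) : (psiL k T h).Additive where
  map_add {F G σ τ} := psiL_hom_ext h fun a => by
    have := (hT.right (op a)).additive
    rw [Preadditive.comp_add, psiLι_map, psiLι_map, psiLι_map, ← Preadditive.add_comp,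
      ← Functor.map_add]
    rfl

theorem psiL_linear (hT : IsBilinearRex k T) : (psiL k T h).Linear k where
  map_smul {F G} τ r := psiL_hom_ext h fun a => by
    have := (hT.right (op a)).linear
    rw [Linear.comp_smul, psiLι_map, psiLι_map, ← Linear.smul_comp, ← Functor.map_smul]
    rfl

end Linear

variable {D : Type (w + 1)} [Category.{w} D] [Abelian D] [Linear k D] {T : Aᵒᵖ ⥤ B ⥤ D}

variable [IsFiniteLinear k B] [IsFiniteLinear k D]

/-- The coend `∫^a a ⊠ F a` exists for left exact `F`: it is the target of a universal family. -/
theorem IsDeligneProduct.hasCoend (hT : IsDeligneProduct k T) (F : FunLex k A B) :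
    HasCoend (integrand T F.obj) := by
  obtain ⟨d, t, ht⟩ := hT.exists_universalFamily F.property
  choose m hm using fun c : Cowedge (integrand T F.obj) =>
    ht.exists_desc hT (fun a => c.π a) fun f => Cowedge.condition c f
  exact HasColimit.mk ⟨Cowedge.mk d t fun _ _ f => ht.dinatural f,
    Multicofork.IsColimit.mk _ m hm fun c r hr => ht.hom_ext hT fun a =>
      (hr a).trans (hm c a).symm⟩

/-- The target of a universal family for `F` is the coend `∫^a a ⊠ F a`. -/
theorem IsUniversalFamily.exists_iso_psiL (hT : IsDeligneProduct k T)
    (h : ∀ F : FunLex k A B, HasCoend (integrand T F.obj)) {F : FunLex k A B} {d : D}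
    {t : ∀ a, (T.obj (op a)).obj (F.obj.obj a) ⟶ d} (ht : IsUniversalFamily T F.obj t) :
    ∃ e : d ≅ (psiL k T h).obj F, ∀ a, t a ≫ e.hom = psiLι h F a := by
  obtain ⟨r, hr⟩ := ht.exists_desc hT (psiLι h F) fun f => psiLι_dinatural h F f
  obtain ⟨s, hs⟩ := exists_psiL_desc h t ht.dinatural
  exact ⟨⟨r, s, ht.hom_ext hT fun a => by rw [reassoc_of% hr, hs, Category.comp_id],
    psiL_hom_ext h fun a => by rw [reassoc_of% hs, hr, Category.comp_id]⟩, hr⟩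

/-- The universal cowedge with vertex `∫^a a ⊠ F a` is a universal family. -/
theorem IsDeligneProduct.isUniversalFamily_psiLι (hT : IsDeligneProduct k T)
    (h : ∀ F : FunLex k A B, HasCoend (integrand T F.obj)) (F : FunLex k A B) :
    IsUniversalFamily T F.obj (psiLι h F) := by
  obtain ⟨d, t, ht⟩ := hT.exists_universalFamily F.property
  obtain ⟨e, he⟩ := ht.exists_iso_psiL hT h
  refine ⟨fun f => psiLι_dinatural h F f, fun a b => ?_⟩
  convert (e.homToEquiv (Z := (T.obj (op a)).obj b)).bijective.comp
    (ht.bijective a b) using 2 with g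
  change _ = (_ ≫ _) ≫ e.hom
  rw [Category.assoc, he]

/-- The functor `F ↦ ∫^a a ⊠ F a` is an equivalence. -/
theorem IsDeligneProduct.isEquivalence_psiL (hT : IsDeligneProduct k T)
    (h : ∀ F : FunLex k A B, HasCoend (integrand T F.obj)) : (psiL k T h).IsEquivalence where
  faithful := ⟨fun {F G τ σ} hτ => by
    refine ObjectProperty.hom_ext _ (NatTrans.ext (funext fun a =>
      ((hT.isUniversalFamily_psiLι h G).bijective a (F.obj.obj a)).1 ?_))
    dsimp only
    rw [← psiLι_map, ← psiLι_map, hτ]⟩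
  full := ⟨fun {F G} s => by
    obtain ⟨τ, hτ⟩ := (hT.isUniversalFamily_psiLι h G).exists_natTrans
      (fun a => psiLι h F a ≫ s) fun f => by
        rw [reassoc_of% psiLι_dinatural h F f]
    exact ⟨⟨τ⟩, psiL_hom_ext h fun a => (psiLι_map h _ a).trans (hτ a)⟩⟩
  essSurj := ⟨fun d => by
    obtain ⟨F, t, hF, ht⟩ := hT.exists_functor d
    obtain ⟨e, -⟩ := IsUniversalFamily.exists_iso_psiL hT h (F := ⟨F, hF⟩) ht
    exact ⟨⟨F, hF⟩, ⟨e.symm⟩⟩⟩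

end Coend

/-! ### The functor `Φˡ` -/

section Lift

variable {C : Type u₁} [Category.{v₁} C] {E : Type u₂} [Category.{v₂} E]
  {Y : Type u₃} [Category.{v₃} Y] (P : ObjectProperty Y)

/-- A bifunctor with values in a full subcategory. -/
def liftBifunctor (G : C ⥤ E ⥤ Y) (h : ∀ c e, P ((G.obj c).obj e)) :
    C ⥤ E ⥤ P.FullSubcategory where
  obj c := P.lift (G.obj c) (h c)
  map f := { app := fun e => ⟨(G.map f).app e⟩
             naturality := fun _ _ g => P.hom_ext ((G.map f).naturality g) }
  map_id c := NatTrans.ext (funext fun e => P.hom_ext (congr_app (G.map_id c) e))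
  map_comp f g := NatTrans.ext (funext fun e => P.hom_ext (congr_app (G.map_comp f g) e))

variable {P}

/-- Isomorphisms of bifunctors with values in a full subcategory can be checked in the ambient
category. -/
def isoOfPostcompι {G G' : C ⥤ E ⥤ P.FullSubcategory} (i : postcomp G P.ι ≅ postcomp G' P.ι) :
    G ≅ G' :=
  ((P.fullyFaithfulι.whiskeringRight E).whiskeringRight C).preimageIso i

end Lift

section PhiL

variable {k : Type w} [Field k]
  {A : Type u₁} [Category.{v₁} A] [Preadditive A] [Linear k A] [IsFiniteLinear k A]
  {B : Type u₂} [Category.{v₂} B] [Preadditive B] [Linear k B] [IsFiniteLinear k B]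

/-- A transformation out of `Hom(a, -) ⊗ b` is determined by a morphism out of `b`. -/
theorem homTensor_natTrans_ext {a : A} {b : B} {F : A ⥤ B}
    {σ τ : ((homTensor k A B).obj (op a)).obj b ⟶ F}
    (h : homTensorι k b (𝟙 a) ≫ σ.app a = homTensorι k b (𝟙 a) ≫ τ.app a) : σ = τ := by
  refine NatTrans.ext (funext fun x => homTensor_hom_ext fun f => ?_)
  rw [← Category.id_comp f, ← homTensorι_map, Category.assoc, Category.assoc, σ.naturality,
    τ.naturality, reassoc_of% h]

/-- Any morphism `b ⟶ F a` comes from a transformation `Hom(a, -) ⊗ b ⟶ F`. -/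
theorem exists_homTensor_natTrans {a : A} {b : B} {F : A ⥤ B} (hF : IsLinearLex k F)
    (g : b ⟶ F.obj a) : ∃ τ : ((homTensor k A B).obj (op a)).obj b ⟶ F,
      homTensorι k b (𝟙 a) ≫ τ.app a = g := by
  have := hF.additive
  have := hF.linear
  choose m hm using fun x : A => exists_homTensor_desc
    ((Linear.leftComp k (F.obj x) g) ∘ₗ (F.mapLinearMap k (X := a) (Y := x)))
  refine ⟨⟨m, fun x y f => homTensor_hom_ext fun h => ?_⟩, (hm a (𝟙 a)).trans ?_⟩
  · rw [reassoc_of% (homTensorι_map (k := k) h f b), hm, reassoc_of% (hm x h)]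
    change g ≫ F.map (h ≫ f) = (g ≫ F.map h) ≫ F.map f
    rw [F.map_comp, Category.assoc]
  · change g ≫ F.map (𝟙 a) = g
    rw [F.map_id, Category.comp_id]

variable (k A B) in
/-- The bifunctor `(a, b) ↦ Hom(a, -) ⊗ b`, with values in left exact functors. -/
abbrev homTensorLex : Aᵒᵖ ⥤ B ⥤ FunLex k A B :=
  liftBifunctor _ (homTensor k A B) fun a b => isLinearLex_homTensor k a.unop b

variable {D : Type (w + 1)} [Category.{w} D] [Abelian D] [Linear k D] {T : Aᵒᵖ ⥤ B ⥤ D}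
  [IsFiniteLinear k D]

/-- The target of a universal family for `Hom(a, -) ⊗ b` is `T (a, b)`. If `F` is the left exact
functor of a universal family with target `d'`, then both objects corepresent
`d' ↦ Hom(b, F a) ≅ Hom(Hom(a, -) ⊗ b, F)`. -/
theorem IsUniversalFamily.isIso_of_homTensor (hT : IsDeligneProduct k T) {a : A} {b : B} {d : D}
    {t : ∀ x, (T.obj (op x)).obj ((((homTensor k A B).obj (op a)).obj b).obj x) ⟶ d}
    (ht : IsUniversalFamily T (((homTensor k A B).obj (op a)).obj b) t) :
    IsIso ((T.obj (op a)).map (homTensorι k b (𝟙 a)) ≫ t a) := by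
  refine isIso_of_coyoneda_map_bijective _ fun d' => ?_
  obtain ⟨F, t', hF, ht'⟩ := hT.exists_functor d'
  refine ⟨fun r r' h => ?_, fun h => ?_⟩
  · obtain ⟨σ, hσ⟩ := ht'.exists_natTrans (fun x => t x ≫ r) fun f => by
      rw [reassoc_of% ht.dinatural f]
    obtain ⟨σ', hσ'⟩ := ht'.exists_natTrans (fun x => t x ≫ r') fun f => by
      rw [reassoc_of% ht.dinatural f]
    have hσσ' : σ = σ' := homTensor_natTrans_ext ((ht'.bijective a b).1 (by
      dsimp only at h ⊢
      rw [Functor.map_comp, Functor.map_comp, Category.assoc, Category.assoc, hσ, hσ',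
        ← Category.assoc, h, Category.assoc]))
    exact ht.hom_ext hT fun x => by rw [← hσ, ← hσ', hσσ']
  · obtain ⟨g, hg⟩ := (ht'.bijective a b).2 h
    obtain ⟨τ, hτ⟩ := exists_homTensor_natTrans hF g
    obtain ⟨r, hr⟩ := ht.exists_hom_of_natTrans hT ht' τ
    refine ⟨r, ?_⟩
    dsimp only at hg ⊢
    rw [Category.assoc, hr, ← Functor.map_comp_assoc, hτ, hg]

/-- `∫^x x ⊠ (Hom(a, x) ⊗ b) ≅ a ⊠ b`. -/
theorem IsDeligneProduct.exists_iso_psiL_homTensor (hT : IsDeligneProduct k T)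
    (h : ∀ F : FunLex k A B, HasCoend (integrand T F.obj)) :
    Nonempty (T ≅ postcomp (homTensorLex k A B) (psiL k T h)) := by
  let H := homTensorLex k A B
  let u (a : Aᵒᵖ) (b : B) : b ⟶ ((H.obj a).obj b).obj.obj a.unop := homTensorι k b (𝟙 a.unop)
  have hu₁ (a : Aᵒᵖ) {b b' : B} (g : b ⟶ b') :
      u a b ≫ ((H.obj a).map g).hom.app a.unop = g ≫ u a b' := homTensorι_map_app _ g
  have hu₂ {a a' : Aᵒᵖ} (f : a ⟶ a') (b : B) : u a b ≫ ((H.map f).app b).hom.app a.unop =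
      u a' b ≫ ((H.obj a').obj b).obj.map f.unop :=
    (homTensorι_map_app_app f.unop (𝟙 a.unop) b).trans ((congrArg (homTensorι k b)
      ((Category.comp_id _).trans (Category.id_comp _).symm)).trans
        (homTensorι_map (𝟙 a'.unop) f.unop b).symm)
  let s (a : Aᵒᵖ) (b : B) : (T.obj (op a.unop)).obj b ⟶ (psiL k T h).obj ((H.obj a).obj b) :=
    (T.obj (op a.unop)).map (u a b) ≫ psiLι h ((H.obj a).obj b) a.unop
  have (a : Aᵒᵖ) (b : B) : IsIso (s a b) :=
    (hT.isUniversalFamily_psiLι h ((H.obj a).obj b)).isIso_of_homTensor hT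
  refine ⟨NatIso.ofComponents (fun a => NatIso.ofComponents (fun b => asIso (s a b))
    fun {b b'} g => ?_) fun {a a'} f => NatTrans.ext (funext fun b => ?_)⟩
  · change (T.obj (op a.unop)).map g ≫ (_ ≫ _) = (_ ≫ _) ≫ (psiL k T h).map ((H.obj a).map g)
    rw [Category.assoc, psiLι_map, ← Functor.map_comp_assoc, ← Functor.map_comp_assoc, hu₁]
  · change (T.map f.unop.op).app b ≫ (_ ≫ _) = (_ ≫ _) ≫ (psiL k T h).map ((H.map f).app b)
    rw [Category.assoc, psiLι_map, ← Functor.map_comp_assoc, hu₂, Functor.map_comp, Category.assoc,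
      ← psiLι_dinatural, NatTrans.naturality_assoc]

end PhiL

/-! ### Couniversal families -/

section CouniversalFamily

section Definition

variable {A : Type u₁} [Category.{v₁} A] {B : Type u₂} [Category.{v₂} B]
  {D : Type u₃} [Category.{v₃} D] {T : Aᵒᵖ ⥤ B ⥤ D}

/-- A dinatural family `t a : d ⟶ T (a, F a)` such that any morphism `d ⟶ T (a, b)` factors uniquely
through `T (a, g)` for some `g : F a ⟶ b`; in other words, `F a` corepresents `Hom(d, T (a, -))`. -/
structure IsCouniversalFamily (T : Aᵒᵖ ⥤ B ⥤ D) (F : A ⥤ B) {d : D}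
    (t : ∀ a, d ⟶ (T.obj (op a)).obj (F.obj a)) : Prop where
  dinatural : ∀ {a a' : A} (f : a ⟶ a'), t a ≫ (T.obj (op a)).map (F.map f) =
    t a' ≫ (T.map f.op).app (F.obj a')
  bijective : ∀ (a : A) (b : B),
    Function.Bijective (fun g : F.obj a ⟶ b => t a ≫ (T.obj (op a)).map g)

variable {F F' : A ⥤ B} {d d' : D}

/-- Couniversal families are universal families for the opposite categories. -/
theorem isUniversalFamily_op_iff {t : ∀ a, d ⟶ (T.obj (op a)).obj (F.obj a)} :
    IsUniversalFamily (opBifunctor T) F.op (d := op d) (fun a => (t a.unop).op) ↔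
      IsCouniversalFamily T F t := by
  refine ⟨fun h => ⟨fun f => ?_, fun a b => ?_⟩, fun h => ⟨fun f => ?_, fun a b => ?_⟩⟩
  · exact congrArg Quiver.Hom.unop (h.dinatural f.op).symm
  · refine ⟨fun g g' hg => ?_, fun s => ?_⟩
    · exact Quiver.Hom.op_inj ((h.bijective (op a) (op b)).1 (congrArg Quiver.Hom.op hg))
    · obtain ⟨g, hg⟩ := (h.bijective (op a) (op b)).2 s.op
      exact ⟨g.unop, congrArg Quiver.Hom.unop hg⟩
  · exact congrArg Quiver.Hom.op (h.dinatural f.unop).symm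
  · refine ⟨fun g g' hg => ?_, fun s => ?_⟩
    · exact Quiver.Hom.unop_inj ((h.bijective a.unop b.unop).1 (congrArg Quiver.Hom.unop hg))
    · obtain ⟨g, hg⟩ := (h.bijective a.unop b.unop).2 s.unop
      exact ⟨g.op, congrArg Quiver.Hom.op hg⟩

/-- A dinatural family factors through a couniversal family with the same source. -/
theorem IsCouniversalFamily.exists_natTrans
    {t : ∀ a, d ⟶ (T.obj (op a)).obj (F'.obj a)} (ht : IsCouniversalFamily T F' t)
    (s : ∀ a, d ⟶ (T.obj (op a)).obj (F.obj a))
    (hs : ∀ {a a' : A} (f : a ⟶ a'), s a ≫ (T.obj (op a)).map (F.map f) =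
      s a' ≫ (T.map f.op).app (F.obj a')) :
    ∃ τ : F' ⟶ F, ∀ a, t a ≫ (T.obj (op a)).map (τ.app a) = s a := by
  obtain ⟨τ, hτ⟩ := (isUniversalFamily_op_iff.2 ht).exists_natTrans (F := F.op)
    (fun a => (s a.unop).op) fun f => congrArg Quiver.Hom.op (hs f.unop).symm
  exact ⟨NatTrans.unop τ, fun a => congrArg Quiver.Hom.unop (hτ (op a))⟩

end Definition

variable {k : Type w} [Field k]
  {A : Type u₁} [Category.{v₁} A] [Preadditive A] [Linear k A]
  {B : Type u₂} [Category.{v₂} B] [Preadditive B] [Linear k B]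
  {D : Type (w + 1)} [Category.{w} D] [Abelian D] [Linear k D] {T : Aᵒᵖ ⥤ B ⥤ D}
  [IsFiniteLinear k D]

theorem IsLinearLex.unop {C : Type u₁} [Category.{v₁} C] [Preadditive C] [Linear k C]
    {E : Type u₂} [Category.{v₂} E] [Preadditive E] [Linear k E] {F : Cᵒᵖ ⥤ Eᵒᵖ}
    (hF : IsLinearLex k F) : IsLinearRex k F.unop := by
  obtain ⟨_, _, _⟩ := hF
  exact ⟨⟨fun {d d' f g} => congrArg Quiver.Hom.unop (F.map_add (f := f.op) (g := g.op))⟩,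
    ⟨fun {d d'} f a => congrArg Quiver.Hom.unop (F.map_smul a f.op)⟩,
    preservesFiniteColimits_unop F⟩

/-- Every object is the source of a couniversal family for a right exact functor. -/
theorem IsDeligneProduct.exists_functor_of_op [IsFiniteLinear k B]
    (hT : IsDeligneProduct k (opBifunctor T)) (d : D) :
    ∃ (F : A ⥤ B) (t : ∀ a, d ⟶ (T.obj (op a)).obj (F.obj a)),
      IsLinearRex k F ∧ IsCouniversalFamily T F t := by
  have := IsFiniteLinear.op k B
  have := IsFiniteLinear.op k D
  obtain ⟨F, t, hF, ht⟩ := hT.exists_functor (op d)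
  exact ⟨F.unop, fun a => (t (op a)).unop, hF.unop, isUniversalFamily_op_iff.1 ht⟩

/-- Every right exact functor is the functor of a couniversal family. -/
theorem IsDeligneProduct.exists_couniversalFamily [IsFiniteLinear k B]
    (hT : IsDeligneProduct k (opBifunctor T)) {F : A ⥤ B} (hF : IsLinearRex k F) :
    ∃ (d : D) (t : ∀ a, d ⟶ (T.obj (op a)).obj (F.obj a)), IsCouniversalFamily T F t := by
  have := IsFiniteLinear.op k B
  have := IsFiniteLinear.op k D
  obtain ⟨d, t, ht⟩ := hT.exists_universalFamily hF.op
  exact ⟨d.unop, fun a => (t (op a)).unop, isUniversalFamily_op_iff.1 ht⟩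

theorem IsCouniversalFamily.hom_ext (hT : IsDeligneProduct k (opBifunctor T)) {F : A ⥤ B} {d : D}
    {t : ∀ a, d ⟶ (T.obj (op a)).obj (F.obj a)} (ht : IsCouniversalFamily T F t) {x : D}
    {s s' : x ⟶ d} (h : ∀ a, s ≫ t a = s' ≫ t a) : s = s' := by
  have := IsFiniteLinear.op k D
  exact Quiver.Hom.op_inj ((isUniversalFamily_op_iff.2 ht).hom_ext hT fun a =>
    congrArg Quiver.Hom.op (h a.unop))

theorem IsCouniversalFamily.exists_hom_of_natTrans (hT : IsDeligneProduct k (opBifunctor T))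
    {F F' : A ⥤ B} {d d' : D} {t : ∀ a, d ⟶ (T.obj (op a)).obj (F.obj a)}
    (ht : IsCouniversalFamily T F t) {t' : ∀ a, d' ⟶ (T.obj (op a)).obj (F'.obj a)}
    (ht' : IsCouniversalFamily T F' t') (τ : F' ⟶ F) :
    ∃ s : d' ⟶ d, ∀ a, s ≫ t a = t' a ≫ (T.obj (op a)).map (τ.app a) := by
  have := IsFiniteLinear.op k D
  obtain ⟨s, hs⟩ := (isUniversalFamily_op_iff.2 ht).exists_hom_of_natTrans hT
    (isUniversalFamily_op_iff.2 ht') (NatTrans.op τ)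
  exact ⟨s.unop, fun a => congrArg Quiver.Hom.unop (hs (op a))⟩

/-- A couniversal family is a limit: it is universal among dinatural families. -/
theorem IsCouniversalFamily.exists_lift [IsFiniteLinear k B]
    (hT : IsDeligneProduct k (opBifunctor T)) {F : A ⥤ B} {d : D}
    {t : ∀ a, d ⟶ (T.obj (op a)).obj (F.obj a)} (ht : IsCouniversalFamily T F t) {x : D}
    (s : ∀ a, x ⟶ (T.obj (op a)).obj (F.obj a))
    (hs : ∀ {a a' : A} (f : a ⟶ a'), s a ≫ (T.obj (op a)).map (F.map f) =
      s a' ≫ (T.map f.op).app (F.obj a')) : ∃ r : x ⟶ d, ∀ a, r ≫ t a = s a := by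
  have := IsFiniteLinear.op k B
  have := IsFiniteLinear.op k D
  obtain ⟨r, hr⟩ := (isUniversalFamily_op_iff.2 ht).exists_desc hT (fun a => (s a.unop).op)
    fun f => congrArg Quiver.Hom.op (hs f.unop).symm
  exact ⟨r.unop, fun a => congrArg Quiver.Hom.unop (hr (op a))⟩

end CouniversalFamily

/-! ### Ends -/

section End

variable {k : Type w} [Field k]
  {A : Type u₁} [Category.{v₁} A] [Preadditive A] [Linear k A]
  {B : Type u₂} [Category.{v₂} B] [Preadditive B] [Linear k B]

section Psi

variable {D : Type u₃} [Category.{v₃} D] {T : Aᵒᵖ ⥤ B ⥤ D}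
  (h : ∀ F : FunRex k A B, HasEnd (integrand T F.obj))

/-- The universal wedge with vertex `∫_a a ⊠ F a`. -/
def psiRπ (F : FunRex k A B) (a : A) :
    (psiR k T h).obj F ⟶ (T.obj (op a)).obj (F.obj.obj a) :=
  haveI := h F
  end_.π (integrand T F.obj) a

variable {F G : FunRex k A B}

theorem psiR_hom_ext {d : D} {s t : d ⟶ (psiR k T h).obj F}
    (hst : ∀ a, s ≫ psiRπ h F a = t ≫ psiRπ h F a) : s = t :=
  haveI := h F
  end_.hom_ext hst

theorem exists_psiR_lift {d : D} (t : ∀ a, d ⟶ (T.obj (op a)).obj (F.obj.obj a))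
    (ht : ∀ {a a' : A} (f : a ⟶ a'), t a ≫ (T.obj (op a)).map (F.obj.map f) =
      t a' ≫ (T.map f.op).app (F.obj.obj a')) :
    ∃ s : d ⟶ (psiR k T h).obj F, ∀ a, s ≫ psiRπ h F a = t a :=
  haveI := h F
  ⟨end_.lift t fun _ _ f => ht f, fun a => end_.lift_π _ _ a⟩

theorem psiR_map_π (τ : F ⟶ G) (a : A) :
    (psiR k T h).map τ ≫ psiRπ h G a = psiRπ h F a ≫ (T.obj (op a)).map (τ.hom.app a) :=
  haveI := h F
  haveI := h G
  end_.map_π _ _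

variable (F) in
theorem psiRπ_dinatural {a a' : A} (f : a ⟶ a') :
    psiRπ h F a ≫ (T.obj (op a)).map (F.obj.map f) =
      psiRπ h F a' ≫ (T.map f.op).app (F.obj.obj a') :=
  haveI := h F
  end_.condition (integrand T F.obj) f

end Psi

section Linear

variable {D : Type u₃} [Category.{v₃} D] [Preadditive D] [Linear k D] {T : Aᵒᵖ ⥤ B ⥤ D}
  (h : ∀ F : FunRex k A B, HasEnd (integrand T F.obj))

theorem psiR_additive (hT : IsBilinearRex k T) : (psiR k T h).Additive where
  map_add {F G σ τ} := psiR_hom_ext h fun a => by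
    have := (hT.right (op a)).additive
    rw [Preadditive.add_comp, psiR_map_π, psiR_map_π, psiR_map_π, ← Preadditive.comp_add,
      ← Functor.map_add]
    rfl

theorem psiR_linear (hT : IsBilinearRex k T) : (psiR k T h).Linear k where
  map_smul {F G} τ r := psiR_hom_ext h fun a => by
    have := (hT.right (op a)).linear
    rw [Linear.smul_comp, psiR_map_π, psiR_map_π, ← Linear.comp_smul, ← Functor.map_smul]
    rfl

end Linear

variable {D : Type (w + 1)} [Category.{w} D] [Abelian D] [Linear k D] {T : Aᵒᵖ ⥤ B ⥤ D}

variable [IsFiniteLinear k B] [IsFiniteLinear k D]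

/-- The end `∫_a a ⊠ F a` exists for right exact `F`: it is the source of a couniversal family. -/
theorem IsDeligneProduct.hasEnd (hT : IsDeligneProduct k (opBifunctor T)) (F : FunRex k A B) :
    HasEnd (integrand T F.obj) := by
  obtain ⟨d, t, ht⟩ := hT.exists_couniversalFamily F.property
  choose m hm using fun c : Wedge (integrand T F.obj) =>
    ht.exists_lift hT (fun a => c.ι a) fun f => Wedge.condition c f
  exact HasLimit.mk ⟨Wedge.mk d t fun _ _ f => ht.dinatural f,
    Multifork.IsLimit.mk _ m hm fun c r hr => ht.hom_ext hT fun a =>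
      (hr a).trans (hm c a).symm⟩

/-- The source of a couniversal family for `F` is the end `∫_a a ⊠ F a`. -/
theorem IsCouniversalFamily.exists_iso_psiR (hT : IsDeligneProduct k (opBifunctor T))
    (h : ∀ F : FunRex k A B, HasEnd (integrand T F.obj)) {F : FunRex k A B} {d : D}
    {t : ∀ a, d ⟶ (T.obj (op a)).obj (F.obj.obj a)} (ht : IsCouniversalFamily T F.obj t) :
    ∃ e : (psiR k T h).obj F ≅ d, ∀ a, e.hom ≫ t a = psiRπ h F a := by
  obtain ⟨r, hr⟩ := ht.exists_lift hT (psiRπ h F) fun f => psiRπ_dinatural h F f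
  obtain ⟨s, hs⟩ := exists_psiR_lift h t ht.dinatural
  exact ⟨⟨r, s, psiR_hom_ext h fun a => by rw [Category.assoc, hs, hr, Category.id_comp],
    ht.hom_ext hT fun a => by rw [Category.assoc, hr, hs, Category.id_comp]⟩, hr⟩

/-- The universal wedge with vertex `∫_a a ⊠ F a` is a couniversal family. -/
theorem IsDeligneProduct.isCouniversalFamily_psiRπ (hT : IsDeligneProduct k (opBifunctor T))
    (h : ∀ F : FunRex k A B, HasEnd (integrand T F.obj)) (F : FunRex k A B) :
    IsCouniversalFamily T F.obj (psiRπ h F) := by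
  obtain ⟨d, t, ht⟩ := hT.exists_couniversalFamily F.property
  obtain ⟨e, he⟩ := ht.exists_iso_psiR hT h
  refine ⟨fun f => psiRπ_dinatural h F f, fun a b => ?_⟩
  convert (e.symm.homFromEquiv (Z := (T.obj (op a)).obj b)).bijective.comp
    (ht.bijective a b) using 2 with g
  change _ = e.hom ≫ (_ ≫ _)
  rw [reassoc_of% he]

/-- The functor `F ↦ ∫_a a ⊠ F a` is an equivalence. -/
theorem IsDeligneProduct.isEquivalence_psiR (hT : IsDeligneProduct k (opBifunctor T))
    (h : ∀ F : FunRex k A B, HasEnd (integrand T F.obj)) : (psiR k T h).IsEquivalence where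
  faithful := ⟨fun {F G τ σ} hτ => by
    refine ObjectProperty.hom_ext _ (NatTrans.ext (funext fun a =>
      ((hT.isCouniversalFamily_psiRπ h F).bijective a (G.obj.obj a)).1 ?_))
    dsimp only
    rw [← psiR_map_π, ← psiR_map_π, hτ]⟩
  full := ⟨fun {F G} s => by
    obtain ⟨τ, hτ⟩ := (hT.isCouniversalFamily_psiRπ h F).exists_natTrans
      (fun a => s ≫ psiRπ h G a) fun f => by
        rw [Category.assoc, psiRπ_dinatural h G f, Category.assoc]
    exact ⟨⟨τ⟩, psiR_hom_ext h fun a => (psiR_map_π h _ a).trans (hτ a)⟩⟩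
  essSurj := ⟨fun d => by
    obtain ⟨F, t, hF, ht⟩ := hT.exists_functor_of_op d
    obtain ⟨e, -⟩ := IsCouniversalFamily.exists_iso_psiR hT h (F := ⟨F, hF⟩) ht
    exact ⟨⟨F, hF⟩, ⟨e⟩⟩⟩

end End

/-! ### The functor `Φʳ` -/

section PhiR

variable {k : Type w} [Field k]
  {A : Type u₁} [Category.{v₁} A] [Preadditive A] [Linear k A] [IsFiniteLinear k A]
  {B : Type u₂} [Category.{v₂} B] [Preadditive B] [Linear k B] [IsFiniteLinear k B]

/-- A transformation into `Hom(-, a)^* ⊗ b` is determined by a morphism into `b`. -/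
theorem dualHomTensor_natTrans_ext {a : A} {b : B} {F : A ⥤ B}
    {σ τ : F ⟶ ((dualHomTensor k A B).obj (op a)).obj b}
    (h : σ.app a ≫ dualHomTensorπ k (𝟙 a) b = τ.app a ≫ dualHomTensorπ k (𝟙 a) b) : σ = τ := by
  refine NatTrans.ext (funext fun x => dualHomTensor_hom_ext fun f => ?_)
  rw [← Category.comp_id f, ← map_dualHomTensorπ, ← σ.naturality_assoc, ← τ.naturality_assoc, h]

/-- Any morphism `F a ⟶ b` comes from a transformation `F ⟶ Hom(-, a)^* ⊗ b`. -/
theorem exists_dualHomTensor_natTrans {a : A} {b : B} {F : A ⥤ B} (hF : IsLinearRex k F)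
    (g : F.obj a ⟶ b) : ∃ τ : F ⟶ ((dualHomTensor k A B).obj (op a)).obj b,
      τ.app a ≫ dualHomTensorπ k (𝟙 a) b = g := by
  have := hF.additive
  have := hF.linear
  choose m hm using fun x : A => exists_dualHomTensor_lift
    ((Linear.rightComp k (F.obj x) g) ∘ₗ (F.mapLinearMap k (X := x) (Y := a)))
  refine ⟨⟨m, fun x y f => dualHomTensor_hom_ext fun h => ?_⟩, (hm a (𝟙 a)).trans ?_⟩
  · rw [Category.assoc, Category.assoc, map_dualHomTensorπ, hm, hm]
    change F.map f ≫ F.map h ≫ g = F.map (f ≫ h) ≫ g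
    rw [F.map_comp, Category.assoc]
  · change F.map (𝟙 a) ≫ g = g
    rw [F.map_id, Category.id_comp]

variable (k A B) in
/-- The bifunctor `(a, b) ↦ Hom(-, a)^* ⊗ b`, with values in right exact functors. -/
abbrev dualHomTensorRex : Aᵒᵖ ⥤ B ⥤ FunRex k A B :=
  liftBifunctor _ (dualHomTensor k A B) fun a b => isLinearRex_dualHomTensor k a.unop b

variable {D : Type (w + 1)} [Category.{w} D] [Abelian D] [Linear k D] {T : Aᵒᵖ ⥤ B ⥤ D}
  [IsFiniteLinear k D]

/-- The source of a couniversal family for `Hom(-, a)^* ⊗ b` is `T (a, b)`. If `F` is the right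
exact functor of a couniversal family with source `d'`, then both objects represent
`d' ↦ Hom(F a, b) ≅ Hom(F, Hom(-, a)^* ⊗ b)`. -/
theorem IsCouniversalFamily.isIso_of_dualHomTensor (hT : IsDeligneProduct k (opBifunctor T))
    {a : A} {b : B} {d : D}
    {t : ∀ x, d ⟶ (T.obj (op x)).obj ((((dualHomTensor k A B).obj (op a)).obj b).obj x)}
    (ht : IsCouniversalFamily T (((dualHomTensor k A B).obj (op a)).obj b) t) :
    IsIso (t a ≫ (T.obj (op a)).map (dualHomTensorπ k (𝟙 a) b)) := by
  refine isIso_of_yoneda_map_bijective _ fun d' => ?_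
  obtain ⟨F, t', hF, ht'⟩ := hT.exists_functor_of_op d'
  refine ⟨fun r r' h => ?_, fun h => ?_⟩
  · obtain ⟨σ, hσ⟩ := ht'.exists_natTrans (fun x => r ≫ t x) fun f => by
      rw [Category.assoc, Category.assoc, ht.dinatural f]
    obtain ⟨σ', hσ'⟩ := ht'.exists_natTrans (fun x => r' ≫ t x) fun f => by
      rw [Category.assoc, Category.assoc, ht.dinatural f]
    have hσσ' : σ = σ' := dualHomTensor_natTrans_ext ((ht'.bijective a b).1 (by
      dsimp only at h ⊢
      rw [Functor.map_comp, Functor.map_comp, reassoc_of% hσ, reassoc_of% hσ', h]))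
    exact ht.hom_ext hT fun x => by rw [← hσ, ← hσ', hσσ']
  · obtain ⟨g, hg⟩ := (ht'.bijective a b).2 h
    obtain ⟨τ, hτ⟩ := exists_dualHomTensor_natTrans hF g
    obtain ⟨r, hr⟩ := ht.exists_hom_of_natTrans hT ht' τ
    refine ⟨r, ?_⟩
    dsimp only at hg ⊢
    rw [reassoc_of% (hr a), ← Functor.map_comp, hτ, hg]

/-- `∫_x x ⊠ (Hom(x, a)^* ⊗ b) ≅ a ⊠ b`. -/
theorem IsDeligneProduct.exists_iso_psiR_dualHomTensor (hT : IsDeligneProduct k (opBifunctor T))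
    (h : ∀ F : FunRex k A B, HasEnd (integrand T F.obj)) :
    Nonempty (postcomp (dualHomTensorRex k A B) (psiR k T h) ≅ T) := by
  let H := dualHomTensorRex k A B
  let u (a : Aᵒᵖ) (b : B) : ((H.obj a).obj b).obj.obj a.unop ⟶ b := dualHomTensorπ k (𝟙 a.unop) b
  have hu₁ (a : Aᵒᵖ) {b b' : B} (g : b ⟶ b') :
      ((H.obj a).map g).hom.app a.unop ≫ u a b' = u a b ≫ g := map_app_dualHomTensorπ _ g
  have hu₂ {a a' : Aᵒᵖ} (f : a ⟶ a') (b : B) : ((H.map f).app b).hom.app a'.unop ≫ u a' b =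
      ((H.obj a).obj b).obj.map f.unop ≫ u a b :=
    (map_app_app_dualHomTensorπ f.unop (𝟙 a'.unop) b).trans ((congrArg (dualHomTensorπ k · b)
      ((Category.id_comp _).trans (Category.comp_id _).symm)).trans
        (map_dualHomTensorπ f.unop (𝟙 a.unop) b).symm)
  let s (a : Aᵒᵖ) (b : B) : (psiR k T h).obj ((H.obj a).obj b) ⟶ (T.obj (op a.unop)).obj b :=
    psiRπ h ((H.obj a).obj b) a.unop ≫ (T.obj (op a.unop)).map (u a b)
  have (a : Aᵒᵖ) (b : B) : IsIso (s a b) :=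
    (hT.isCouniversalFamily_psiRπ h ((H.obj a).obj b)).isIso_of_dualHomTensor hT
  refine ⟨NatIso.ofComponents (fun a => NatIso.ofComponents (fun b => asIso (s a b))
    fun {b b'} g => ?_) fun {a a'} f => NatTrans.ext (funext fun b => ?_)⟩
  · change (psiR k T h).map ((H.obj a).map g) ≫ (_ ≫ _) = (_ ≫ _) ≫ (T.obj (op a.unop)).map g
    rw [reassoc_of% (psiR_map_π h ((H.obj a).map g) a.unop), Category.assoc, ← Functor.map_comp,
      ← Functor.map_comp, hu₁]
  · change (psiR k T h).map ((H.map f).app b) ≫ (_ ≫ _) = (_ ≫ _) ≫ (T.map f.unop.op).app b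
    rw [reassoc_of% (psiR_map_π h ((H.map f).app b) a'.unop), Category.assoc, ← Functor.map_comp,
      hu₂, Functor.map_comp,
      reassoc_of% (psiRπ_dinatural h ((H.obj a).obj b) f.unop), NatTrans.naturality]

end PhiR

/-! ### The Eilenberg-Watts equivalences -/

section PostcompInverse

variable {C : Type u₁} [Category.{v₁} C] {E : Type u₂} [Category.{v₂} E]
  {D : Type u₃} [Category.{v₃} D] {Y : Type u} [Category.{v} Y]

/-- Transport of a bifunctor along an equivalence can be undone. -/
def postcompInverseIso {H : C ⥤ E ⥤ Y} {T : C ⥤ E ⥤ D} (e : Y ≌ D) (i : T ≅ postcomp H e.functor) :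
    postcomp T e.inverse ≅ H :=
  Functor.isoWhiskerRight i ((Functor.whiskeringRight E D Y).obj e.inverse) ≪≫
    Functor.isoWhiskerLeft H ((Functor.whiskeringRight E Y Y).mapIso e.unitIso.symm)

end PostcompInverse

section Combination

variable {k : Type w} [Field k]
  {A : Type u₁} [Category.{v₁} A] [Preadditive A] [Linear k A] [IsFiniteLinear k A]
  {B : Type u₂} [Category.{v₂} B] [Preadditive B] [Linear k B] [IsFiniteLinear k B]
  {D : Type (w + 1)} [Category.{w} D] [Abelian D] [Linear k D] {T : Aᵒᵖ ⥤ B ⥤ D}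
  [IsFiniteLinear k D]

/-- A quasi-inverse of `Ψˡ` is a functor `Φˡ`. -/
theorem IsDeligneProduct.isPhiL_inv (hT : IsDeligneProduct k T)
    (h : ∀ F : FunLex k A B, HasCoend (integrand T F.obj)) [(psiL k T h).IsEquivalence] :
    IsPhiL k T (psiL k T h).inv := by
  have := psiL_additive h hT.rex
  have := psiL_linear h hT.rex
  obtain ⟨h₁, h₂⟩ := additive_linear_inv (k := k) (psiL k T h)
  obtain ⟨i⟩ := hT.exists_iso_psiL_homTensor h
  exact ⟨IsLinearLex.of_isEquivalence _ h₁ h₂, ⟨Functor.isoWhiskerRight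
    (postcompInverseIso (psiL k T h).asEquivalence i)
    ((Functor.whiskeringRight _ _ _).obj (ObjectProperty.ι _))⟩⟩

/-- A quasi-inverse of `Ψʳ` is a functor `Φʳ`. -/
theorem IsDeligneProduct.isPhiR_inv (hT : IsDeligneProduct k T)
    (hT' : IsDeligneProduct k (opBifunctor T))
    (h : ∀ F : FunRex k A B, HasEnd (integrand T F.obj)) [(psiR k T h).IsEquivalence] :
    IsPhiR k T (psiR k T h).inv := by
  have := psiR_additive h hT.rex
  have := psiR_linear h hT.rex
  obtain ⟨h₁, h₂⟩ := additive_linear_inv (k := k) (psiR k T h)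
  obtain ⟨i⟩ := hT'.exists_iso_psiR_dualHomTensor h
  exact ⟨IsLinearRex.of_isEquivalence _ h₁ h₂, ⟨Functor.isoWhiskerRight
    (postcompInverseIso (psiR k T h).asEquivalence i.symm)
    ((Functor.whiskeringRight _ _ _).obj (ObjectProperty.ι _))⟩⟩

/-- Any `Φˡ` is a quasi-inverse of `Ψˡ`: both `Φˡ ⋙ Ψˡ` and the identity are left exact, and they
agree on the objects `a ⊠ b`. -/
theorem IsPhiL.exists_equivalence (hT : IsDeligneProduct k T)
    (hT' : IsDeligneProduct k (opBifunctor T))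
    (h : ∀ F : FunLex k A B, HasCoend (integrand T F.obj)) [(psiL k T h).IsEquivalence]
    {Φ : D ⥤ FunLex k A B} (hΦ : IsPhiL k T Φ) :
    ∃ e : FunLex k A B ≌ D, e.functor = psiL k T h ∧ e.inverse = Φ := by
  obtain ⟨i⟩ := hT.exists_iso_psiL_homTensor h
  obtain ⟨j⟩ := hΦ.iso
  let j' : postcomp T Φ ≅ homTensorLex k A B := isoOfPostcompι j
  obtain ⟨c⟩ := hT'.nonempty_iso_of_op (F := Φ ⋙ psiL k T h) (F' := 𝟭 D)
    (hΦ.exact.comp (IsLinearLex.of_isEquivalence _ (psiL_additive h hT.rex)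
      (psiL_linear h hT.rex))) ⟨inferInstance, inferInstance, inferInstance⟩
    (Functor.isoWhiskerRight j' ((Functor.whiskeringRight _ _ _).obj (psiL k T h)) ≪≫ i.symm)
  let e := (psiL k T h).asEquivalence
  let s : Φ ≅ e.inverse := Functor.isoWhiskerLeft Φ e.unitIso ≪≫
    Functor.isoWhiskerRight c e.inverse
  exact ⟨e.changeInverse s.symm, rfl, rfl⟩

/-- Any `Φʳ` is a quasi-inverse of `Ψʳ`: both `Φʳ ⋙ Ψʳ` and the identity are right exact, and they
agree on the objects `a ⊠ b`. -/
theorem IsPhiR.exists_equivalence (hT : IsDeligneProduct k T)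
    (hT' : IsDeligneProduct k (opBifunctor T))
    (h : ∀ F : FunRex k A B, HasEnd (integrand T F.obj)) [(psiR k T h).IsEquivalence]
    {Φ : D ⥤ FunRex k A B} (hΦ : IsPhiR k T Φ) :
    ∃ e : D ≌ FunRex k A B, e.functor = Φ ∧ e.inverse = psiR k T h := by
  obtain ⟨i⟩ := hT'.exists_iso_psiR_dualHomTensor h
  obtain ⟨j⟩ := hΦ.iso
  let j' : postcomp T Φ ≅ dualHomTensorRex k A B := isoOfPostcompι j
  obtain ⟨c⟩ := hT.nonempty_iso (F := Φ ⋙ psiR k T h) (F' := 𝟭 D)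
    (hΦ.exact.comp (IsLinearRex.of_isEquivalence _ (psiR_additive h hT.rex)
      (psiR_linear h hT.rex))) ⟨inferInstance, inferInstance, inferInstance⟩
    (Functor.isoWhiskerRight j' ((Functor.whiskeringRight _ _ _).obj (psiR k T h)) ≪≫ i)
  let e := (psiR k T h).asEquivalence
  let s : Φ ≅ e.inverse := Functor.isoWhiskerLeft Φ e.unitIso ≪≫
    Functor.isoWhiskerRight c e.inverse
  exact ⟨(e.changeInverse s.symm).symm, rfl, rfl⟩

end Combination

end EilenbergWatts

end

theorem theorem3p2 (k : Type w) [Field k] [IsAlgClosed k]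
    (A : Type u₁) [Category.{v₁} A] [Preadditive A] [Linear k A]
    [EilenbergWatts.IsFiniteLinear k A]
    (B : Type u₂) [Category.{v₂} B] [Preadditive B] [Linear k B]
    [EilenbergWatts.IsFiniteLinear k B] :
    (∃ (D : Type (w + 1)) (_ : Category.{w} D) (_ : Abelian D) (_ : Linear k D)
      (T : Aᵒᵖ ⥤ B ⥤ D), EilenbergWatts.IsDeligneProduct k T) ∧
    ∀ (D : Type (w + 1)) [Category.{w} D] [Abelian D] [Linear k D] (T : Aᵒᵖ ⥤ B ⥤ D),
      EilenbergWatts.IsDeligneProduct k T →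
      EilenbergWatts.IsFiniteLinear k D ∧
      (∃ Φl, EilenbergWatts.IsPhiL k T Φl) ∧
      (∃ Φr, EilenbergWatts.IsPhiR k T Φr) ∧
      ∃ (hl : ∀ F : EilenbergWatts.FunLex k A B,
            HasCoend (EilenbergWatts.integrand T F.obj))
        (hr : ∀ G : EilenbergWatts.FunRex k A B,
            HasEnd (EilenbergWatts.integrand T G.obj)),
        (EilenbergWatts.psiL k T hl).Additive ∧ (EilenbergWatts.psiL k T hl).Linear k ∧
        (EilenbergWatts.psiR k T hr).Additive ∧ (EilenbergWatts.psiR k T hr).Linear k ∧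
        ∀ (Φl : D ⥤ EilenbergWatts.FunLex k A B) (Φr : D ⥤ EilenbergWatts.FunRex k A B),
          EilenbergWatts.IsPhiL k T Φl → EilenbergWatts.IsPhiR k T Φr →
          (∃ e : EilenbergWatts.FunLex k A B ≌ D,
            e.functor = EilenbergWatts.psiL k T hl ∧ e.inverse = Φl) ∧
          (∃ e : D ≌ EilenbergWatts.FunRex k A B,
            e.functor = Φr ∧ e.inverse = EilenbergWatts.psiR k T hr) ∧
          (∃ e : EilenbergWatts.FunLex k A B ≌ EilenbergWatts.FunRex k A B,
            e.functor = EilenbergWatts.psiL k T hl ⋙ Φr ∧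
            e.inverse = EilenbergWatts.psiR k T hr ⋙ Φl) := by
  obtain ⟨hA, rfl⟩ := EilenbergWatts.exists_abelian k A
  obtain ⟨hB, rfl⟩ := EilenbergWatts.exists_abelian k B
  have := EilenbergWatts.IsFiniteLinear.op k A
  refine ⟨?_, fun D _ _ _ T hT => ?_⟩
  · obtain ⟨D, _, _, _, T, -, ⟨P, Q, h⟩, -⟩ :=
      EilenbergWatts.exists_preservesProgenerators k Aᵒᵖ B
    exact ⟨D, _, _, _, T, h.isDeligneProduct⟩
  · obtain ⟨_, hT'⟩ := hT.isFiniteLinear_and_op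
    have hl := hT.isEquivalence_psiL hT.hasCoend
    have hr := hT'.isEquivalence_psiR hT'.hasEnd
    refine ⟨‹_›, ⟨_, hT.isPhiL_inv hT.hasCoend⟩, ⟨_, hT.isPhiR_inv hT' hT'.hasEnd⟩, hT.hasCoend,
      hT'.hasEnd, EilenbergWatts.psiL_additive _ hT.rex, EilenbergWatts.psiL_linear _ hT.rex,
      EilenbergWatts.psiR_additive _ hT.rex, EilenbergWatts.psiR_linear _ hT.rex,
      fun Φl Φr hΦl hΦr => ?_⟩
    obtain ⟨e, he, he'⟩ := hΦl.exists_equivalence hT hT' hT.hasCoend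
    obtain ⟨e', hf, hf'⟩ := hΦr.exists_equivalence hT hT' hT'.hasEnd
    refine ⟨⟨e, he, he'⟩, ⟨e', hf, hf'⟩, e.trans e', ?_, ?_⟩
    · rw [← he, ← hf]
      rfl
    · rw [← he', ← hf']
      rfl
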